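/- Let $d\ge 1$, let $\Omega\subset\mathbb R^{d+1}$ be a bounded domain (open and connected), let $0<\alpha<1$, and suppose that $\partial\Omega$ is of class $C^{1,\alpha}$: near each boundary point, in suitable Cartesian coordinates, $\Omega$ is the region above the graph of a $C^1$ function with $\alpha$-Hölder continuous derivative. Let $\sigma$ be the surface measure on $\partial\Omega$, $\nu_y$ the outward unit normal at $y\in\partial\Omega$, and $\omega_{d+1}$ the area of the unit sphere of $\mathbb R^{d+1}$. The Neumann–Poincaré operator $\mathcal K$ is $$\mathcal K[f](x)=-\frac1{\omega_{d+1}}\,\mathrm{p.v.}\!\int_{\partial\Omega}\frac{(x-y)\cdot\nu_y}{|x-y|^{d+1}}f(y)\,d\sigma(y),\qquad x\in\partial\Omega .$$ For $0<s<1$, $H^s(\partial\Omega)$ is the space of $f\in L^2(\partial\Omega)$ with finite norm $$\|f\|_{H^s(\partial\Omega)}=\Big(\|f\|_{L^2(\partial\Omega)}^2+\int_{\partial\Omega}\int_{\partial\Omega}\frac{|f(x)-f(y)|^2}{|x-y|^{2s+d}}\,d\sigma(x)\,d\sigma(y)\Big)^{1/2};$$ $H^0(\partial\Omega)=L^2(\partial\Omega)$;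 and for $-1<s<0$, $H^s(\partial\Omega)$ is the dual of $H^{-s}(\partial\Omega)$, a function $g\in L^2(\partial\Omega)$ being identified with the functional $\varphi\mapsto\int_{\partial\Omega}g\varphi\,d\sigma$. Then: 1. for every $s$ with $0<s<(1-\alpha)/2$, $\mathcal K$ is a bounded operator from $H^s(\partial\Omega)$ into $H^{s+\alpha}(\partial\Omega)$; 2. for every $\varepsilon$ with $0<\varepsilon<1+\alpha$, $\mathcal K$ is a bounded operator from $L^2(\partial\Omega)$ into $H^{\alpha-\varepsilon}(\partial\Omega)$. Here "bounded from $H^s(\partial\Omega)$ into $H^t(\partial\Omega)$" means: for every $f\in H^s(\partial\Omega)$ the principal value exists for $\sigma$-almost every $x\in\partial\Omega$, the function $\mathcal K[f]$ belongs to $L^2(\partial\Omega)\cap H^t(\partial\Omega)$, and $\|\mathcal K[f]\|_{H^t(\partial\Omega)}\le C\|f\|_{H^s(\partial\Omega)}$ with a constant $C$ independent of $f$. -/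

import Mathlib

open MeasureTheory Filter Topology Set
open scoped ENNReal NNReal

noncomputable section

/-- `E n` is Euclidean `n`-space. -/
abbrev E (n : ℕ) : Type := EuclideanSpace ℝ (Fin n)

/-- The boundary of `Ω ⊆ ℝ^{d+1}` is of class `C^{1,α}`: near every boundary point, in suitable
Cartesian coordinates `(u, t) ∈ ℝ^d × ℝ`, the set `Ω` is the region `{t > φ u}` above the graph of
a `C¹` function `φ` whose derivative is Hölder continuous of exponent `α`. -/
def HasC1HolderBoundary {d : ℕ} (α : ℝ) (Ω : Set (E (d + 1))) : Prop :=
  ∀ p ∈ frontier Ω, ∃ (T : E (d + 1) ≃ₗᵢ[ℝ] WithLp 2 (E d × ℝ)) (φ : E d → ℝ) (r : ℝ) (L : ℝ),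
    0 < r ∧ ContDiff ℝ 1 φ ∧
    (∀ u v, ‖fderiv ℝ φ u - fderiv ℝ φ v‖ ≤ L * ‖u - v‖ ^ α) ∧
    ∀ x ∈ Metric.ball p r, (x ∈ Ω ↔ φ (T x).fst < (T x).snd)

/-- `ν` is an outward unit normal of `Ω` at `x`: to first order at `x`, the set `Ω` is the half
space `{y | (y - x) · ν < 0}`. That is, outside each cone `|(y - x) · ν| ≤ ε |y - x|`, the points
near `x` on the negative side are in `Ω` and those on the positive side are not. -/
def IsOuterUnitNormal {n : ℕ} (Ω : Set (E n)) (x ν : E n) : Prop :=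
  ‖ν‖ = 1 ∧ ∀ ε : ℝ, 0 < ε → ∀ᶠ y in 𝓝 x,
    (inner ℝ (y - x) ν < -(ε * ‖y - x‖) → y ∈ Ω) ∧
    (ε * ‖y - x‖ < inner ℝ (y - x) ν → y ∉ Ω)

/-- An outward unit normal is unique. -/
theorem IsOuterUnitNormal.unique {n : ℕ} {Ω : Set (E n)} {x ν₁ ν₂ : E n}
    (h₁ : IsOuterUnitNormal Ω x ν₁) (h₂ : IsOuterUnitNormal Ω x ν₂) : ν₁ = ν₂ := by
  by_contra hne
  obtain ⟨n₁, h₁⟩ := h₁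
  obtain ⟨n₂, h₂⟩ := h₂
  set v : E n := ν₂ - ν₁ with hv
  have hlt : inner ℝ ν₁ ν₂ < 1 := (inner_lt_one_iff_real_of_norm_eq_one n₁ n₂).2 hne
  have e₁ : inner ℝ v ν₁ = inner ℝ ν₁ ν₂ - 1 := by
    rw [hv, inner_sub_left, real_inner_self_eq_norm_sq, n₁, real_inner_comm]; norm_num
  have e₂ : inner ℝ v ν₂ = 1 - inner ℝ ν₁ ν₂ := by
    rw [hv, inner_sub_left, real_inner_self_eq_norm_sq, n₂]; norm_num
  have hvpos : 0 < ‖v‖ := norm_pos_iff.2 (sub_ne_zero.2 (Ne.symm hne))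
  set ε : ℝ := (1 - inner ℝ ν₁ ν₂) / (2 * ‖v‖) with hε
  have hεpos : 0 < ε := div_pos (by linarith) (by linarith)
  have hεv : ε * ‖v‖ = (1 - inner ℝ ν₁ ν₂) / 2 := by rw [hε]; field_simp
  have hev := (h₁ ε hεpos).and (h₂ ε hεpos)
  have ht : Tendsto (fun t : ℝ => x + t • v) (𝓝[>] 0) (𝓝 x) := by
    have : Tendsto (fun t : ℝ => x + t • v) (𝓝 0) (𝓝 (x + (0 : ℝ) • v)) :=
      (Continuous.tendsto (by fun_prop) _)
    simpa using this.mono_left nhdsWithin_le_nhds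
  obtain ⟨t, ⟨⟨hin, -⟩, ⟨-, hout⟩⟩, htpos⟩ :=
    ((ht.eventually hev).and self_mem_nhdsWithin).exists
  have htpos : 0 < t := htpos
  have key : ε * ‖t • v‖ = t * ((1 - inner ℝ ν₁ ν₂) / 2) := by
    rw [norm_smul, Real.norm_of_nonneg htpos.le, ← hεv]; ring
  simp only [add_sub_cancel_left, key, real_inner_smul_left, e₁, e₂] at hin hout
  exact hout (by nlinarith) (hin (by nlinarith))

open Classical in
/-- The outward unit normal `ν_x` of `Ω` at `x` (and `0` at points where there is none). -/
def outerNormal {n : ℕ} (Ω : Set (E n)) (x : E n) : E n :=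
  if h : ∃ ν, IsOuterUnitNormal Ω x ν then h.choose else 0

/-- The surface measure `σ` on `∂Ω`, for `Ω ⊆ ℝ^{d+1}`: the `d`-dimensional Hausdorff measure
(normalized to agree with Lebesgue measure on `d`-planes) restricted to `∂Ω`. -/
def surfaceMeasure {d : ℕ} (Ω : Set (E (d + 1))) : Measure (E (d + 1)) :=
  (Measure.euclideanHausdorffMeasure d).restrict (frontier Ω)

/-- `ω_{d+1}`, the area of the unit sphere of `ℝ^{d+1}`. -/
def sphereArea (d : ℕ) : ℝ :=
  (Measure.euclideanHausdorffMeasure d : Measure (E (d + 1))).real (Metric.sphere 0 1)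

/-- The integral kernel `-(1/ω_{d+1}) ((x - y) · ν_y) / |x - y|^{d+1}`. -/
def npKernel {d : ℕ} (Ω : Set (E (d + 1))) (x y : E (d + 1)) : ℝ :=
  -(1 / sphereArea d) * (inner ℝ (x - y) (outerNormal Ω y) / ‖x - y‖ ^ (d + 1))

variable {𝕜 : Type*} [RCLike 𝕜]

/-- The truncated integral `∫_{|x - y| > δ} K(x, y) f(y) dσ(y)`. -/
def npTruncated {d : ℕ} (Ω : Set (E (d + 1))) (f : E (d + 1) → 𝕜) (x : E (d + 1)) (δ : ℝ) : 𝕜 :=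
  ∫ y in {y | δ < ‖x - y‖}, (npKernel Ω x y : 𝕜) * f y ∂(surfaceMeasure Ω)

/-- The Cauchy principal value defining `𝒦[f](x)` exists. -/
def NPExistsAt {d : ℕ} (Ω : Set (E (d + 1))) (f : E (d + 1) → 𝕜) (x : E (d + 1)) : Prop :=
  ∃ l : 𝕜, Tendsto (npTruncated Ω f x) (𝓝[>] 0) (𝓝 l)

/-- The Neumann-Poincaré operator
`𝒦[f](x) = -(1/ω_{d+1}) p.v. ∫_{∂Ω} ((x - y) · ν_y) / |x - y|^{d+1} f(y) dσ(y)`. -/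
def npOperator {d : ℕ} (Ω : Set (E (d + 1))) (f : E (d + 1) → 𝕜) (x : E (d + 1)) : 𝕜 :=
  limUnder (𝓝[>] 0) (npTruncated Ω f x)

/-- The norm of `H^s(∂Ω)` for `0 < s < 1`, with values in `[0, ∞]`: the square root of
`‖f‖²_{L²(∂Ω)} + ∫∫ |f(x) - f(y)|² / |x - y|^{2s+d} dσ(x) dσ(y)`. -/
def slobodeckijNorm {d : ℕ} (Ω : Set (E (d + 1))) (s : ℝ) (f : E (d + 1) → 𝕜) : ℝ≥0∞ :=
  (eLpNorm f 2 (surfaceMeasure Ω) ^ 2 +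
    ∫⁻ x, ∫⁻ y, ‖f x - f y‖ₑ ^ 2 / edist x y ^ (2 * s + d)
      ∂(surfaceMeasure Ω) ∂(surfaceMeasure Ω)) ^ (1 / 2 : ℝ)

/-- The norm of `H^s(∂Ω)`, `-1 < s < 1`, on functions in `L²(∂Ω)`, with values in `[0, ∞]`. For
`s > 0` it is the norm above, for `s = 0` the `L²` norm, and for `s < 0` the norm of the functional
`φ ↦ ∫ f φ dσ` on `H^{-s}(∂Ω)`, as `H^s(∂Ω)` is the dual of `H^{-s}(∂Ω)`. -/
def sobolevNorm {d : ℕ} (Ω : Set (E (d + 1))) (s : ℝ) (f : E (d + 1) → 𝕜) : ℝ≥0∞ :=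
  if 0 < s then slobodeckijNorm Ω s f
  else if s = 0 then eLpNorm f 2 (surfaceMeasure Ω)
  else ⨆ (φ : E (d + 1) → 𝕜) (_ : MemLp φ 2 (surfaceMeasure Ω))
    (_ : slobodeckijNorm Ω (-s) φ ≤ 1), ‖∫ x, f x * φ x ∂(surfaceMeasure Ω)‖ₑ

/-- `f` is a function in `L²(∂Ω)` that belongs to `H^s(∂Ω)`, where `-1 < s < 1`. For `0 ≤ s` these
are all the elements of `H^s(∂Ω)`. -/
def MemSobolev {d : ℕ} (Ω : Set (E (d + 1))) (s : ℝ) (f : E (d + 1) → 𝕜) : Prop :=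
  MemLp f 2 (surfaceMeasure Ω) ∧ sobolevNorm Ω s f < ∞

variable (𝕜) in
/-- The Neumann-Poincaré operator is a bounded operator from `H^s(∂Ω)` into `H^t(∂Ω)`, where
`0 ≤ s < 1` and `-1 < t < 1`: for `f ∈ H^s(∂Ω)` the principal value `𝒦[f](x)` exists for almost
every `x ∈ ∂Ω`, it defines an element of `H^t(∂Ω)`, and `‖𝒦[f]‖_{H^t} ≤ C ‖f‖_{H^s}` with `C`
independent of `f`. -/
def NPBounded {d : ℕ} (Ω : Set (E (d + 1))) (s t : ℝ) : Prop :=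
  ∃ C : ℝ≥0, ∀ f : E (d + 1) → 𝕜, MemSobolev Ω s f →
    (∀ᵐ x ∂(surfaceMeasure Ω), NPExistsAt Ω f x) ∧
    MemSobolev Ω t (npOperator Ω f) ∧
    sobolevNorm Ω t (npOperator Ω f) ≤ C * sobolevNorm Ω s f

end

/-!
On a `C^{1,α}` boundary the normal satisfies `|⟨x - y, ν_y⟩| ≤ C |x - y|^{1 + α}`
(`exists_abs_inner_outerNormal_le`) and is itself `α`-Hölder continuous
(`exists_norm_outerNormal_sub_le`). Hence the kernel `k(x, y)` of the Neumann–Poincaré operator is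
only weakly singular: it has size `|x - y|^{α - d}`, and its increments in `x` have size
`|x - z| |x - y|^{α - d - 1}` when `|x - y| ≥ 2 |x - z|`
(`exists_isWeaklySingular_doubleLayerKernel`). Together with the bound `σ(B(x, ρ)) ≤ C ρ^d`, Schur's
test shows that the integral converges absolutely for almost every `x` and defines a bounded operator
on `L²`. In particular principal values are ordinary integrals (`ae_tendsto_npTruncated`), and for
`t ≤ 0` the bound from `L²` into `H^t` is clear.

For `t > 0` one has to bound the Gagliardo integral of `F x = ∫ k(x, y) f(y) dσ(y)`. Splitting the
integral in `F x - F z` at `|x - y| = 2 |x - z|` leaves two near parts and one far part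
(`IsWeaklySingular.enorm_integral_sub_le`), which Hardy inequalities control, for `0 < t < 1`, by
`∬ |x - y|^{2α - 2t - d} Ψ(x, y)²` with `Ψ(x, y) = |f(y)|`. If `t < α` the weight is integrable, and
the result is a multiple of `‖f‖²_{L²}` (`IsWeaklySingular.exists_gagliardo_le_lintegral`). If
`t = s + α < 1`, the same argument is applied with `f(y)` replaced by `f(y) - f(x)`, which does not
change `F x - F z` provided that the operator maps constants to constants. Then
`Ψ(x, y) = |f(x) - f(y)|`, and the bound is the Gagliardo integral of `f` of order `s`
(`IsWeaklySingular.exists_gagliardo_le_gagliardo`).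

That constants are mapped to constants is Gauss' lemma (`exists_integral_doubleLayer_eq`). The flux
through `∂Ω` of the regularized field `(y - x) (|y - x|² + ε²)^{-(d + 1)/2}` is the integral over `Ω`
of its divergence `(d + 1) ε² (|y - x|² + ε²)^{-(d + 3)/2}`, an approximate identity of fixed mass at
scale `ε`; as `Ω` is asymptotically a half space at `x ∈ ∂Ω`, the limit is half of that mass, whatever
`x` is. The divergence theorem used here is `setIntegral_fderiv_eq_integral_surfaceMeasure`. It is
proved by localization to charts and the fundamental theorem of calculus in the coordinates
`(u, τ) ↦ (u, φ u + τ)`, the surface measure being identified there by the area formula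
`comap_graphMap_euclideanHausdorffMeasure` for the Hausdorff measure of a graph.
-/

/-! ### Local comparison of measures -/

/-- If `μ ≤ (1 + ε) ν` near every point, for every `ε > 0`, then `μ ≤ ν`. -/
theorem MeasureTheory.Measure.le_of_locally_le_one_add_smul {X : Type*} [TopologicalSpace X]
    [SecondCountableTopology X] [MeasurableSpace X] [OpensMeasurableSpace X] {μ ν : Measure X}
    (h : ∀ ε : ℝ≥0, 0 < ε → ∀ x, ∃ U ∈ 𝓝 x, ∀ A ⊆ U, MeasurableSet A → μ A ≤ (1 + ε) * ν A) :
    μ ≤ ν := by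
  have key : ∀ ε : ℝ≥0, 0 < ε → ∀ A, MeasurableSet A → μ A ≤ (1 + ε) * ν A := by
    intro ε hε A hA
    choose U hU hUA using h ε hε
    obtain ⟨s, hs, hcov⟩ := TopologicalSpace.countable_cover_nhds
      (f := fun x => interior (U x)) (fun x => interior_mem_nhds.2 (hU x))
    rcases s.eq_empty_or_nonempty with rfl | hne
    · have : A = ∅ := by
        apply eq_empty_of_forall_notMem
        intro a _
        have : a ∈ (univ : Set X) := mem_univ a
        rw [← hcov] at this
        simp at this
      simp [this]
    obtain ⟨e, he⟩ := hs.exists_eq_range hne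
    set V : ℕ → Set X := fun n => interior (U (e n)) with hV
    have hVm : ∀ n, MeasurableSet (V n) := fun n => isOpen_interior.measurableSet
    have hVu : ⋃ n, disjointed V n = univ := by
      rw [iUnion_disjointed, ← hcov, he]; simp [hV]
    have hA' : A = ⋃ n, A ∩ disjointed V n := by rw [← inter_iUnion, hVu, inter_univ]
    have hd : Pairwise (Function.onFun Disjoint fun n => A ∩ disjointed V n) := fun i j hij =>
      (disjoint_disjointed V hij).mono inter_subset_right inter_subset_right
    have hm : ∀ n, MeasurableSet (A ∩ disjointed V n) := fun n =>
      hA.inter (MeasurableSet.disjointed hVm n)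
    rw [hA', measure_iUnion hd hm, measure_iUnion hd hm, ← ENNReal.tsum_mul_left]
    refine ENNReal.tsum_le_tsum fun n => hUA (e n) _ ?_ (hm n)
    exact inter_subset_right.trans ((disjointed_subset V n).trans interior_subset)
  refine Measure.le_iff.2 fun A hA => ?_
  by_cases hfin : ν A = ∞
  · simp [hfin]
  have ht : Tendsto (fun ε : ℝ≥0 => (1 + (ε : ℝ≥0∞)) * ν A) (𝓝[>] 0) (𝓝 ((1 + (0 : ℝ≥0)) * ν A)) := by
    have h1 : Tendsto (fun ε : ℝ≥0 => 1 + (ε : ℝ≥0∞)) (𝓝[>] 0) (𝓝 (1 + (0 : ℝ≥0))) := by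
      refine Tendsto.mono_left (Continuous.tendsto (f := fun ε : ℝ≥0 => 1 + (ε : ℝ≥0∞)) ?_ 0)
        nhdsWithin_le_nhds
      exact continuous_const.add ENNReal.continuous_coe
    exact ENNReal.Tendsto.mul_const h1 (Or.inr hfin)
  simp only [ENNReal.coe_zero, add_zero, one_mul] at ht
  exact ge_of_tendsto ht (eventually_mem_nhdsWithin.mono fun ε hε => key ε hε A hA)

/-- Lipschitz maps increase the `d`-dimensional Hausdorff measure by a factor at most `K ^ d`. -/
theorem LipschitzOnWith.euclideanHausdorffMeasure_image_le {X Y : Type*} [EMetricSpace X]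
    [EMetricSpace Y] [MeasurableSpace X] [BorelSpace X] [MeasurableSpace Y] [BorelSpace Y]
    {K : ℝ≥0} {f : X → Y} {s : Set X} (h : LipschitzOnWith K f s) (d : ℕ) :
    (Measure.euclideanHausdorffMeasure d : Measure Y) (f '' s)
      ≤ (K : ℝ≥0∞) ^ d * (Measure.euclideanHausdorffMeasure d : Measure X) s := by
  simp only [Measure.euclideanHausdorffMeasure_def, Measure.smul_apply, ENNReal.smul_def,
    smul_eq_mul]
  rw [mul_left_comm]
  gcongr
  simpa using h.hausdorffMeasure_image_le (d := (d : ℝ)) (by positivity)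

/-! ### The area formula for graphs -/

/-- The parametrization `u ↦ (u, φ u)` of the graph of `φ`, in the Cartesian coordinates `T`. -/
noncomputable def graphMap {d : ℕ} (T : E (d + 1) ≃ₗᵢ[ℝ] WithLp 2 (E d × ℝ)) (φ : E d → ℝ)
    (u : E d) : E (d + 1) :=
  T.symm (WithLp.toLp 2 (u, φ u))

/-- The area density `√(1 + |∇φ|²)` of the graph of `φ`. -/
noncomputable def graphDensity {d : ℕ} (φ : E d → ℝ) (u : E d) : ℝ :=
  √(1 + ‖gradient φ u‖ ^ 2)

theorem one_le_graphDensity {d : ℕ} (φ : E d → ℝ) (u : E d) : 1 ≤ graphDensity φ u :=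
  Real.one_le_sqrt.2 (by nlinarith [sq_nonneg ‖gradient φ u‖])

theorem continuous_gradient {d : ℕ} {φ : E d → ℝ} (hφ : ContDiff ℝ 1 φ) :
    Continuous (gradient φ) :=
  (LinearIsometryEquiv.continuous _).comp (hφ.continuous_fderiv one_ne_zero)

theorem continuous_graphDensity {d : ℕ} {φ : E d → ℝ} (hφ : ContDiff ℝ 1 φ) :
    Continuous (graphDensity φ) := by
  have := continuous_gradient hφ
  unfold graphDensity
  fun_prop

theorem norm_toLp_prod_sq {d : ℕ} (u : E d) (t : ℝ) :
    ‖(WithLp.toLp 2 (u, t) : WithLp 2 (E d × ℝ))‖ ^ 2 = ‖u‖ ^ 2 + t ^ 2 := by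
  rw [WithLp.prod_norm_sq_eq_of_L2]; simp

theorem norm_le_norm_toLp_prod {d : ℕ} (u : E d) (t : ℝ) :
    ‖u‖ ≤ ‖(WithLp.toLp 2 (u, t) : WithLp 2 (E d × ℝ))‖ :=
  le_of_sq_le_sq (by rw [norm_toLp_prod_sq]; nlinarith [sq_nonneg t]) (norm_nonneg _)

@[simp]
theorem apply_graphMap {d : ℕ} (T : E (d + 1) ≃ₗᵢ[ℝ] WithLp 2 (E d × ℝ)) (φ : E d → ℝ) (u : E d) :
    T (graphMap T φ u) = WithLp.toLp 2 (u, φ u) := by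
  simp [graphMap]

theorem graphMap_sub {d : ℕ} (T : E (d + 1) ≃ₗᵢ[ℝ] WithLp 2 (E d × ℝ)) (φ : E d → ℝ) (u v : E d) :
    graphMap T φ u - graphMap T φ v = T.symm (WithLp.toLp 2 (u - v, φ u - φ v)) := by
  simp only [graphMap, ← map_sub]; rfl

theorem norm_sub_le_norm_graphMap_sub {d : ℕ} (T : E (d + 1) ≃ₗᵢ[ℝ] WithLp 2 (E d × ℝ))
    (φ : E d → ℝ) (u v : E d) : ‖u - v‖ ≤ ‖graphMap T φ u - graphMap T φ v‖ := by
  rw [graphMap_sub, LinearIsometryEquiv.norm_map]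
  exact norm_le_norm_toLp_prod _ _

theorem continuous_graphMap {d : ℕ} (T : E (d + 1) ≃ₗᵢ[ℝ] WithLp 2 (E d × ℝ)) {φ : E d → ℝ}
    (hφ : Continuous φ) : Continuous (graphMap T φ) := by
  unfold graphMap
  refine T.symm.continuous.comp ?_
  exact (WithLp.prod_continuous_toLp 2 _ _).comp (continuous_id.prodMk hφ)

theorem continuous_fst_apply {d : ℕ} (T : E (d + 1) ≃ₗᵢ[ℝ] WithLp 2 (E d × ℝ)) :
    Continuous fun x => (T x).fst :=
  continuous_fst.comp ((WithLp.prod_continuous_ofLp 2 _ _).comp T.continuous)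

theorem continuous_snd_apply {d : ℕ} (T : E (d + 1) ≃ₗᵢ[ℝ] WithLp 2 (E d × ℝ)) :
    Continuous fun x => (T x).snd :=
  continuous_snd.comp ((WithLp.prod_continuous_ofLp 2 _ _).comp T.continuous)

theorem measurableEmbedding_graphMap {d : ℕ} (T : E (d + 1) ≃ₗᵢ[ℝ] WithLp 2 (E d × ℝ))
    {φ : E d → ℝ} (hφ : Continuous φ) : MeasurableEmbedding (graphMap T φ) := by
  refine (continuous_graphMap T hφ).measurableEmbedding fun u v h => ?_
  have := congrArg (fun x => (T x).fst) h
  simpa using this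

/-- A linear bijection of `ℝ^d` which stretches lengths as the linear graph map
`v ↦ (v, ⟨g, v⟩)` does, and hence has determinant `√(1 + |g|²)`: it is `v ↦ v + c ⟨g, v⟩ g`, where
`c |g|² = √(1 + |g|²) - 1`. -/
theorem exists_linearMap_norm_sq_eq {d : ℕ} (g : E d) :
    ∃ M : E d →ₗ[ℝ] E d, LinearMap.det M = √(1 + ‖g‖ ^ 2) ∧
      ∀ v, ‖M v‖ ^ 2 = ‖v‖ ^ 2 + (inner ℝ g v) ^ 2 := by
  set J : ℝ := √(1 + ‖g‖ ^ 2) with hJ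
  have hJ2 : J ^ 2 = 1 + ‖g‖ ^ 2 := Real.sq_sqrt (by positivity)
  have hJ0 : 0 ≤ J := Real.sqrt_nonneg _
  set c : ℝ := 1 / (1 + J) with hc
  have hcJ : c * (1 + J) = 1 := by rw [hc]; field_simp
  have hcg : c * ‖g‖ ^ 2 = J - 1 := by linear_combination (J - 1) * hcJ - c * hJ2
  refine ⟨LinearMap.transvection (innerₛₗ ℝ g) (c • g), ?_, fun v => ?_⟩
  · rw [LinearMap.transvection.det, innerₛₗ_apply_apply, real_inner_smul_right,
      real_inner_self_eq_norm_sq, hcg]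
    ring
  · have : LinearMap.transvection (innerₛₗ ℝ g) (c • g) v = v + inner ℝ g v • c • g := rfl
    rw [this, norm_add_sq_real, norm_smul, norm_smul, real_inner_smul_right, real_inner_smul_right,
      real_inner_comm g v, mul_pow, mul_pow, Real.norm_eq_abs, Real.norm_eq_abs, sq_abs, sq_abs]
    have h2 : 2 * c + c * (c * ‖g‖ ^ 2) = 1 := by rw [hcg]; linear_combination hcJ
    linear_combination (inner ℝ g v) ^ 2 * h2

/-- Near a given point `u₀`, the graph map is a nearly isometric perturbation of an affine map, so
that the areas of graphs over small sets are nearly the ones given by the density at `u₀`. -/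
theorem euclideanHausdorffMeasure_graphMap_image_near {d : ℕ}
    (T : E (d + 1) ≃ₗᵢ[ℝ] WithLp 2 (E d × ℝ)) {φ : E d → ℝ} (hφ : ContDiff ℝ 1 φ) (u₀ : E d)
    {δ : ℝ≥0} (hδ0 : 0 < δ) (hδ1 : δ < 1) :
    ∃ U ∈ 𝓝 u₀, ∀ A ⊆ U,
      (Measure.euclideanHausdorffMeasure d : Measure (E (d + 1))) (graphMap T φ '' A) ≤
        ((1 + δ : ℝ≥0) : ℝ≥0∞) ^ d * (ENNReal.ofReal (graphDensity φ u₀) * volume A) ∧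
      ENNReal.ofReal (graphDensity φ u₀) * volume A ≤ (((1 - δ)⁻¹ : ℝ≥0) : ℝ≥0∞) ^ d *
        (Measure.euclideanHausdorffMeasure d : Measure (E (d + 1))) (graphMap T φ '' A) := by
  obtain ⟨M, hdet, hM⟩ := exists_linearMap_norm_sq_eq (gradient φ u₀)
  have hMle : ∀ v, ‖v‖ ≤ ‖M v‖ := fun v =>
    le_of_sq_le_sq (by rw [hM]; nlinarith [sq_nonneg (inner ℝ (gradient φ u₀) v)]) (norm_nonneg _)
  obtain ⟨U, hU, hlin⟩ :=
    (hφ.contDiffAt.hasStrictFDerivAt (x := u₀) one_ne_zero).approximates_deriv_on_nhds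
      (Or.inr hδ0)
  have hvol : ∀ A : Set (E d), (Measure.euclideanHausdorffMeasure d : Measure (E d)) (M '' A) =
      ENNReal.ofReal (graphDensity φ u₀) * volume A := by
    intro A
    rw [EuclideanSpace.euclideanHausdorffMeasure_eq_volume, Measure.addHaar_image_linearMap, hdet,
      abs_of_nonneg (Real.sqrt_nonneg _)]
    rfl
  -- the increments of the graph map and those of `M` have nearly the same length
  have hdist : ∀ u ∈ U, ∀ v ∈ U,
      |‖graphMap T φ u - graphMap T φ v‖ - ‖M u - M v‖| ≤ δ * ‖M u - M v‖ := by
    intro u hu v hv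
    set w := u - v with hw
    set a : WithLp 2 (E d × ℝ) := WithLp.toLp 2 (w, inner ℝ (gradient φ u₀) w)
    have ha : ‖a‖ = ‖M w‖ := by
      rw [← sq_eq_sq₀ (norm_nonneg _) (norm_nonneg _), norm_toLp_prod_sq, hM]
    set b : WithLp 2 (E d × ℝ) := WithLp.toLp 2 (w, φ u - φ v)
    have hab : ‖b - a‖ ≤ δ * ‖w‖ := by
      have e1 : b - a = WithLp.toLp 2 (0, φ u - φ v - fderiv ℝ φ u₀ w) := by
        rw [← inner_gradient_left (𝕜 := ℝ)]
        change WithLp.toLp 2 (w - w, φ u - φ v - inner ℝ (gradient φ u₀) w) = _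
        rw [sub_self]
      have e2 : ‖b - a‖ = ‖φ u - φ v - fderiv ℝ φ u₀ w‖ := by
        rw [e1, ← sq_eq_sq₀ (norm_nonneg _) (norm_nonneg _), norm_toLp_prod_sq]; simp
      rw [e2]
      exact hlin u hu v hv
    rw [graphMap_sub, LinearIsometryEquiv.norm_map, ← map_sub, ← hw, ← ha]
    calc |‖b‖ - ‖a‖| ≤ ‖b - a‖ := abs_norm_sub_norm_le b a
      _ ≤ δ * ‖w‖ := hab
      _ ≤ δ * ‖a‖ := by rw [ha]; gcongr; exact hMle w
  have hinj : ∀ x y, M x = M y → x = y := by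
    intro x y h
    have := hMle (x - y)
    rw [map_sub, h, sub_self, norm_zero] at this
    exact sub_eq_zero.1 (norm_le_zero_iff.1 this)
  refine ⟨U, hU, fun A hA => ⟨?_, ?_⟩⟩
  · have hl : LipschitzOnWith (1 + δ) (graphMap T φ ∘ Function.invFun M) (M '' A) := by
      refine LipschitzOnWith.of_dist_le_mul ?_
      rintro _ ⟨u, hu, rfl⟩ _ ⟨v, hv, rfl⟩
      have hi := Function.leftInverse_invFun (f := M) (fun x y => hinj x y)
      simp only [Function.comp, hi u, hi v, dist_eq_norm]
      have := (abs_le.1 (hdist u (hA hu) v (hA hv))).2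
      push_cast
      linarith
    have := hl.euclideanHausdorffMeasure_image_le d
    rw [hvol] at this
    rw [← image_comp, Function.comp_assoc, Function.invFun_comp (fun x y => hinj x y)] at this
    exact this
  · have hl : LipschitzOnWith (1 - δ)⁻¹ (fun y => M (T y).fst) (graphMap T φ '' A) := by
      refine LipschitzOnWith.of_dist_le_mul ?_
      rintro _ ⟨u, hu, rfl⟩ _ ⟨v, hv, rfl⟩
      simp only [apply_graphMap, dist_eq_norm]
      have := (abs_le.1 (hdist u (hA hu) v (hA hv))).1
      change ‖M u - M v‖ ≤ _
      have h1 : ((1 - δ : ℝ≥0) : ℝ) = 1 - δ := by rw [NNReal.coe_sub hδ1.le]; simp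
      have h2 : (0 : ℝ) < 1 - δ := sub_pos.2 (by exact_mod_cast hδ1)
      rw [NNReal.coe_inv, h1, inv_mul_eq_div, le_div_iff₀ h2]
      linarith
    have := hl.euclideanHausdorffMeasure_image_le d
    rw [← image_comp] at this
    rw [← hvol]
    refine le_trans (le_of_eq ?_) this
    congr 1
    refine image_congr fun u _ => ?_
    simp

/-- The area formula for graphs. -/
theorem comap_graphMap_euclideanHausdorffMeasure {d : ℕ}
    (T : E (d + 1) ≃ₗᵢ[ℝ] WithLp 2 (E d × ℝ)) {φ : E d → ℝ} (hφ : ContDiff ℝ 1 φ) :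
    (Measure.euclideanHausdorffMeasure d : Measure (E (d + 1))).comap (graphMap T φ) =
      volume.withDensity fun u => ENNReal.ofReal (graphDensity φ u) := by
  have hemb := measurableEmbedding_graphMap T hφ.continuous
  have hJc := continuous_graphDensity hφ
  have hJ1 := one_le_graphDensity φ
  -- a `δ` for which all the factors below together are at most `1 + ε`
  have hδ : ∀ ε : ℝ≥0, 0 < ε → ∃ δ : ℝ≥0, 0 < δ ∧ δ < 1 ∧
      (1 + δ) ^ d * (1 + δ) ≤ 1 + ε ∧ (1 + δ) * ((1 - δ)⁻¹) ^ d ≤ 1 + ε := by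
    intro ε hε
    have h1 : Tendsto (fun δ : ℝ≥0 => (1 + δ) ^ d * (1 + δ)) (𝓝[>] 0) (𝓝 1) := by
      have : Continuous fun δ : ℝ≥0 => (1 + δ) ^ d * (1 + δ) := by fun_prop
      simpa using (this.tendsto 0).mono_left nhdsWithin_le_nhds
    have h2 : Tendsto (fun δ : ℝ≥0 => (1 + δ) * ((1 - δ)⁻¹) ^ d) (𝓝[>] 0) (𝓝 1) := by
      have h3 : Tendsto (fun δ : ℝ≥0 => 1 - δ) (𝓝 0) (𝓝 1) := by
        have : Continuous fun δ : ℝ≥0 => 1 - δ := by fun_prop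
        simpa using this.tendsto 0
      have h4 : Tendsto (fun δ : ℝ≥0 => 1 + δ) (𝓝 0) (𝓝 1) := by
        have : Continuous fun δ : ℝ≥0 => 1 + δ := by fun_prop
        simpa using this.tendsto 0
      simpa using (h4.mul ((h3.inv₀ one_ne_zero).pow d)).mono_left nhdsWithin_le_nhds
    have hlt : (1 : ℝ≥0) < 1 + ε := lt_add_of_pos_right _ hε
    obtain ⟨δ, ⟨⟨ha, hb⟩, hc⟩, hd⟩ := (((h1.eventually_le_const hlt).and
      (h2.eventually_le_const hlt)).and
      (mem_nhdsWithin_of_mem_nhds (Iio_mem_nhds one_pos))).and self_mem_nhdsWithin |>.exists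
    exact ⟨δ, hd, hc, ha, hb⟩
  -- the density is nearly constant near each point
  have hdens : ∀ (δ : ℝ≥0), 0 < δ → ∀ u₀, ∃ U ∈ 𝓝 u₀, ∀ A ⊆ U, MeasurableSet A →
      ENNReal.ofReal (graphDensity φ u₀) * volume A ≤ ((1 + δ : ℝ≥0) : ℝ≥0∞) *
        (volume.withDensity fun u => ENNReal.ofReal (graphDensity φ u)) A ∧
      (volume.withDensity fun u => ENNReal.ofReal (graphDensity φ u)) A ≤
        ((1 + δ : ℝ≥0) : ℝ≥0∞) * (ENNReal.ofReal (graphDensity φ u₀) * volume A) := by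
    intro δ hδ0 u₀
    have hpos : 0 < graphDensity φ u₀ := one_pos.trans_le (hJ1 u₀)
    have hδ' : (0 : ℝ) < δ := hδ0
    have hlt : graphDensity φ u₀ < (1 + δ) * graphDensity φ u₀ := by nlinarith
    have e1 : ∀ᶠ u in 𝓝 u₀, graphDensity φ u < (1 + δ) * graphDensity φ u₀ :=
      hJc.continuousAt.eventually_lt_const hlt
    have e2 : ∀ᶠ u in 𝓝 u₀, graphDensity φ u₀ < (1 + δ) * graphDensity φ u :=
      (hJc.const_mul (1 + (δ : ℝ))).continuousAt.eventually_const_lt hlt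
    have hco : ((1 + δ : ℝ≥0) : ℝ≥0∞) = ENNReal.ofReal (1 + δ) := by
      rw [← ENNReal.ofReal_coe_nnreal]; simp
    refine ⟨_, e1.and e2, fun A hA hAm => ⟨?_, ?_⟩⟩
    · rw [withDensity_apply _ hAm, ← lintegral_const_mul _ (by fun_prop), ← setLIntegral_const]
      refine setLIntegral_mono (by fun_prop) fun u hu => ?_
      rw [hco, ← ENNReal.ofReal_mul (by positivity)]
      exact ENNReal.ofReal_le_ofReal (hA hu).2.le
    · rw [withDensity_apply _ hAm, ← mul_assoc, ← setLIntegral_const]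
      refine setLIntegral_mono (by fun_prop) fun u hu => ?_
      rw [hco, ← ENNReal.ofReal_mul (by positivity)]
      exact ENNReal.ofReal_le_ofReal (hA hu).1.le
  apply le_antisymm
  · refine Measure.le_of_locally_le_one_add_smul fun ε hε u₀ => ?_
    obtain ⟨δ, h0, h1, h2, -⟩ := hδ ε hε
    obtain ⟨U, hU, hUA⟩ := euclideanHausdorffMeasure_graphMap_image_near T hφ u₀ h0 h1
    obtain ⟨V, hV, hVA⟩ := hdens δ h0 u₀
    refine ⟨U ∩ V, inter_mem hU hV, fun A hA hAm => ?_⟩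
    rw [hemb.comap_apply]
    refine (hUA A (hA.trans inter_subset_left)).1.trans ?_
    refine (mul_le_mul_right (hVA A (hA.trans inter_subset_right) hAm).1 _).trans ?_
    rw [← mul_assoc]
    exact mul_le_mul_left (by exact_mod_cast h2) _
  · refine Measure.le_of_locally_le_one_add_smul fun ε hε u₀ => ?_
    obtain ⟨δ, h0, h1, -, h2⟩ := hδ ε hε
    obtain ⟨U, hU, hUA⟩ := euclideanHausdorffMeasure_graphMap_image_near T hφ u₀ h0 h1
    obtain ⟨V, hV, hVA⟩ := hdens δ h0 u₀
    refine ⟨U ∩ V, inter_mem hU hV, fun A hA hAm => ?_⟩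
    rw [hemb.comap_apply]
    refine (hVA A (hA.trans inter_subset_right) hAm).2.trans ?_
    refine (mul_le_mul_right (hUA A (hA.trans inter_subset_left)).2 _).trans ?_
    rw [← mul_assoc]
    exact mul_le_mul_left (by exact_mod_cast h2) _

/-! ### The boundary in a chart -/

/-- The unit normal of the graph of `φ` at `(u, φ u)`, pointing downwards. -/
noncomputable def graphNormal {d : ℕ} (T : E (d + 1) ≃ₗᵢ[ℝ] WithLp 2 (E d × ℝ)) (φ : E d → ℝ)
    (u : E d) : E (d + 1) :=
  (graphDensity φ u)⁻¹ • T.symm (WithLp.toLp 2 (gradient φ u, -1))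

theorem norm_toLp_gradient {d : ℕ} (φ : E d → ℝ) (u : E d) :
    ‖(WithLp.toLp 2 (gradient φ u, (-1 : ℝ)) : WithLp 2 (E d × ℝ))‖ = graphDensity φ u := by
  rw [graphDensity, ← sq_eq_sq₀ (norm_nonneg _) (Real.sqrt_nonneg _), norm_toLp_prod_sq,
    Real.sq_sqrt (by positivity)]
  ring

theorem norm_graphNormal {d : ℕ} (T : E (d + 1) ≃ₗᵢ[ℝ] WithLp 2 (E d × ℝ)) (φ : E d → ℝ)
    (u : E d) : ‖graphNormal T φ u‖ = 1 := by
  have h := one_le_graphDensity φ u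
  rw [graphNormal, norm_smul, LinearIsometryEquiv.norm_map, norm_toLp_gradient, norm_inv,
    Real.norm_of_nonneg (by linarith)]
  field_simp

theorem inner_graphNormal {d : ℕ} (T : E (d + 1) ≃ₗᵢ[ℝ] WithLp 2 (E d × ℝ)) (φ : E d → ℝ)
    (u : E d) (z : E (d + 1)) :
    inner ℝ z (graphNormal T φ u) =
      (graphDensity φ u)⁻¹ * (fderiv ℝ φ u (T z).fst - (T z).snd) := by
  obtain ⟨w, rfl⟩ := T.symm.surjective z
  rw [graphNormal, real_inner_smul_right, LinearIsometryEquiv.inner_map_map,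
    WithLp.prod_inner_apply, ← inner_gradient_left (𝕜 := ℝ), real_inner_comm]
  simp
  left
  ring

theorem norm_inv_smul_sub_le {V : Type*} [NormedAddCommGroup V] [NormedSpace ℝ V] {a b : V}
    (ha : 1 ≤ ‖a‖) (hb : 1 ≤ ‖b‖) : ‖‖a‖⁻¹ • a - ‖b‖⁻¹ • b‖ ≤ 2 * ‖a - b‖ := by
  have e : ‖a‖⁻¹ • a - ‖b‖⁻¹ • b = ‖a‖⁻¹ • (a - b) + (‖a‖⁻¹ * (‖b‖ - ‖a‖) * ‖b‖⁻¹) • b := by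
    have : ‖a‖⁻¹ * (‖b‖ - ‖a‖) * ‖b‖⁻¹ = ‖a‖⁻¹ - ‖b‖⁻¹ := by field_simp
    rw [this]; module
  have h1 : ‖a‖⁻¹ ≤ 1 := inv_le_one_of_one_le₀ ha
  have h2 : |‖b‖ - ‖a‖| ≤ ‖a - b‖ := by rw [norm_sub_rev]; exact abs_norm_sub_norm_le b a
  have h3 : ‖b‖⁻¹ * ‖b‖ = 1 := inv_mul_cancel₀ (by linarith)
  have h4 : 0 ≤ ‖a‖⁻¹ := by positivity
  rw [e]
  refine (norm_add_le _ _).trans ?_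
  rw [norm_smul, norm_smul, norm_mul, norm_mul, norm_inv, norm_inv, norm_norm, norm_norm,
    mul_assoc, h3, mul_one, Real.norm_eq_abs]
  nlinarith [norm_nonneg (a - b), abs_nonneg (‖b‖ - ‖a‖)]

theorem norm_graphNormal_sub_le {d : ℕ} (T : E (d + 1) ≃ₗᵢ[ℝ] WithLp 2 (E d × ℝ)) (φ : E d → ℝ)
    (u v : E d) :
    ‖graphNormal T φ u - graphNormal T φ v‖ ≤ 2 * ‖fderiv ℝ φ u - fderiv ℝ φ v‖ := by
  simp only [graphNormal]
  rw [← map_smul, ← map_smul, ← map_sub, LinearIsometryEquiv.norm_map, ← norm_toLp_gradient φ u,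
    ← norm_toLp_gradient φ v]
  refine (norm_inv_smul_sub_le ?_ ?_).trans (le_of_eq ?_)
  · rw [norm_toLp_gradient]; exact one_le_graphDensity φ u
  · rw [norm_toLp_gradient]; exact one_le_graphDensity φ v
  · congr 1
    rw [← sq_eq_sq₀ (norm_nonneg _) (norm_nonneg _)]
    have : (WithLp.toLp 2 (gradient φ u, (-1 : ℝ)) : WithLp 2 (E d × ℝ)) -
        WithLp.toLp 2 (gradient φ v, (-1 : ℝ)) =
        WithLp.toLp 2 (gradient φ u - gradient φ v, (-1 : ℝ) - (-1)) := rfl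
    rw [this, norm_toLp_prod_sq, gradient, gradient, ← map_sub, LinearIsometryEquiv.norm_map]
    ring

/-- Inside a chart, the boundary is the graph. -/
theorem mem_frontier_iff_of_chart {d : ℕ} {Ω : Set (E (d + 1))} (hΩo : IsOpen Ω)
    {T : E (d + 1) ≃ₗᵢ[ℝ] WithLp 2 (E d × ℝ)} {φ : E d → ℝ} (hφ : Continuous φ)
    {p : E (d + 1)} {r : ℝ} (h : ∀ x ∈ Metric.ball p r, (x ∈ Ω ↔ φ (T x).fst < (T x).snd))
    {x : E (d + 1)} (hx : x ∈ Metric.ball p r) :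
    x ∈ frontier Ω ↔ φ (T x).fst = (T x).snd := by
  have hnhds : ∀ᶠ y in 𝓝 x, y ∈ Metric.ball p r := Metric.isOpen_ball.mem_nhds hx
  have c1 : Continuous fun y => φ (T y).fst := hφ.comp (continuous_fst_apply T)
  have c2 := continuous_snd_apply T
  rw [frontier, Set.mem_sdiff, hΩo.interior_eq]
  constructor
  · rintro ⟨hcl, hno⟩
    rw [h x hx, not_lt] at hno
    refine le_antisymm ?_ hno
    by_contra hlt
    push Not at hlt
    have hev : ∀ᶠ y in 𝓝 x, (T y).snd < φ (T y).fst :=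
      c2.continuousAt.eventually_lt c1.continuousAt hlt
    obtain ⟨y, ⟨hy1, hy2⟩, hy3⟩ := mem_closure_iff_nhds.1 hcl _ (hev.and hnhds)
    exact lt_asymm hy1 ((h y hy2).1 hy3)
  · intro heq
    refine ⟨?_, fun hxΩ => ((h x hx).1 hxΩ).ne heq⟩
    set e : E (d + 1) := T.symm (WithLp.toLp 2 (0, 1))
    have ht : Tendsto (fun s : ℝ => x + s • e) (𝓝[>] 0) (𝓝 x) := by
      have : Continuous fun s : ℝ => x + s • e := by fun_prop
      simpa using (this.tendsto 0).mono_left nhdsWithin_le_nhds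
    refine mem_closure_of_tendsto ht ?_
    filter_upwards [ht.eventually hnhds, self_mem_nhdsWithin] with s hs (hs0 : 0 < s)
    rw [h _ hs]
    simp [e, heq, hs0]

theorem eq_graphMap_of_chart {d : ℕ} {Ω : Set (E (d + 1))} (hΩo : IsOpen Ω)
    {T : E (d + 1) ≃ₗᵢ[ℝ] WithLp 2 (E d × ℝ)} {φ : E d → ℝ} (hφ : Continuous φ)
    {p : E (d + 1)} {r : ℝ} (h : ∀ x ∈ Metric.ball p r, (x ∈ Ω ↔ φ (T x).fst < (T x).snd))
    {x : E (d + 1)} (hx : x ∈ Metric.ball p r) (hxf : x ∈ frontier Ω) :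
    x = graphMap T φ (T x).fst := by
  apply T.injective
  rw [apply_graphMap, (mem_frontier_iff_of_chart hΩo hφ h hx).1 hxf]
  rfl

theorem isOuterUnitNormal_graphNormal {d : ℕ} {Ω : Set (E (d + 1))}
    {T : E (d + 1) ≃ₗᵢ[ℝ] WithLp 2 (E d × ℝ)} {φ : E d → ℝ} (hφ : ContDiff ℝ 1 φ)
    {p : E (d + 1)} {r : ℝ} (h : ∀ x ∈ Metric.ball p r, (x ∈ Ω ↔ φ (T x).fst < (T x).snd))
    {u : E d} (hu : graphMap T φ u ∈ Metric.ball p r) :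
    IsOuterUnitNormal Ω (graphMap T φ u) (graphNormal T φ u) := by
  refine ⟨norm_graphNormal T φ u, fun ε hε => ?_⟩
  have hJ := one_le_graphDensity φ u
  have hJ0 : 0 < graphDensity φ u := by linarith
  have hnhds : ∀ᶠ y in 𝓝 (graphMap T φ u), y ∈ Metric.ball p r := Metric.isOpen_ball.mem_nhds hu
  have hfst : Tendsto (fun y => (T y).fst) (𝓝 (graphMap T φ u)) (𝓝 u) := by
    simpa using (continuous_fst_apply T).tendsto (graphMap T φ u)
  have hd := hfst.eventually ((hφ.differentiable one_ne_zero u).hasFDerivAt.isLittleO.def hε)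
  filter_upwards [hnhds, hd] with y hy hyd
  set v := (T y).fst
  set t := (T y).snd
  have hnorm : ‖v - u‖ ≤ ‖y - graphMap T φ u‖ := by
    rw [← T.norm_map, map_sub, apply_graphMap]
    exact norm_le_norm_toLp_prod (v - u) (t - φ u)
  have hin : inner ℝ (y - graphMap T φ u) (graphNormal T φ u) * graphDensity φ u =
      fderiv ℝ φ u (v - u) - (t - φ u) := by
    rw [inner_graphNormal, map_sub, apply_graphMap]
    simp only [WithLp.sub_fst, WithLp.sub_snd]
    field_simp
    rfl
  have hrem := abs_le.1 ((Real.norm_eq_abs _ ▸ hyd).trans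
    (mul_le_mul_of_nonneg_left hnorm hε.le))
  have hεn : 0 ≤ ε * ‖y - graphMap T φ u‖ := by positivity
  rw [h y hy]
  constructor
  · intro hlt
    nlinarith [mul_lt_mul_of_pos_right hlt hJ0]
  · intro hlt
    rw [not_lt]
    nlinarith [mul_lt_mul_of_pos_right hlt hJ0]

theorem outerNormal_spec {n : ℕ} {Ω : Set (E n)} {x ν : E n} (h : IsOuterUnitNormal Ω x ν) :
    outerNormal Ω x = ν := by
  have hex : ∃ ν, IsOuterUnitNormal Ω x ν := ⟨ν, h⟩
  rw [outerNormal, dif_pos hex]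
  exact hex.choose_spec.unique h

theorem outerNormal_graphMap {d : ℕ} {Ω : Set (E (d + 1))}
    {T : E (d + 1) ≃ₗᵢ[ℝ] WithLp 2 (E d × ℝ)} {φ : E d → ℝ} (hφ : ContDiff ℝ 1 φ)
    {p : E (d + 1)} {r : ℝ} (h : ∀ x ∈ Metric.ball p r, (x ∈ Ω ↔ φ (T x).fst < (T x).snd))
    {u : E d} (hu : graphMap T φ u ∈ Metric.ball p r) :
    outerNormal Ω (graphMap T φ u) = graphNormal T φ u :=
  outerNormal_spec (isOuterUnitNormal_graphNormal hφ h hu)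

/-- Inside a chart, the surface measure is the image of `√(1 + |∇φ|²) du` on the graph. -/
theorem surfaceMeasure_restrict_of_chart {d : ℕ} {Ω : Set (E (d + 1))} (hΩo : IsOpen Ω)
    {T : E (d + 1) ≃ₗᵢ[ℝ] WithLp 2 (E d × ℝ)} {φ : E d → ℝ} (hφ : ContDiff ℝ 1 φ)
    {p : E (d + 1)} {r : ℝ} (h : ∀ x ∈ Metric.ball p r, (x ∈ Ω ↔ φ (T x).fst < (T x).snd)) :
    (surfaceMeasure Ω).restrict (Metric.ball p r) =
      ((volume.withDensity fun u => ENNReal.ofReal (graphDensity φ u)).map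
        (graphMap T φ)).restrict (Metric.ball p r) := by
  rw [← comap_graphMap_euclideanHausdorffMeasure T hφ,
    (measurableEmbedding_graphMap T hφ.continuous).map_comap, surfaceMeasure,
    Measure.restrict_restrict Metric.isOpen_ball.measurableSet,
    Measure.restrict_restrict Metric.isOpen_ball.measurableSet]
  congr 1
  ext x
  refine and_congr_right fun hx => ⟨fun hf => ⟨_, (eq_graphMap_of_chart hΩo hφ.continuous h hx hf).symm⟩, ?_⟩
  rintro ⟨u, rfl⟩
  rw [mem_frontier_iff_of_chart hΩo hφ.continuous h hx]
  simp

theorem integral_surfaceMeasure_of_chart {d : ℕ} {Ω : Set (E (d + 1))} (hΩo : IsOpen Ω)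
    {T : E (d + 1) ≃ₗᵢ[ℝ] WithLp 2 (E d × ℝ)} {φ : E d → ℝ} (hφ : ContDiff ℝ 1 φ)
    {p : E (d + 1)} {r : ℝ} (h : ∀ x ∈ Metric.ball p r, (x ∈ Ω ↔ φ (T x).fst < (T x).snd))
    {f : E (d + 1) → ℝ} (hf : ∀ x ∉ Metric.ball p r, f x = 0) :
    ∫ x, f x ∂(surfaceMeasure Ω) = ∫ u, graphDensity φ u * f (graphMap T φ u) := by
  have hf' : Function.support f ⊆ Metric.ball p r := fun x hx => by
    by_contra hx'; exact hx (hf x hx')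
  rw [← setIntegral_eq_integral_of_forall_compl_eq_zero (fun x hx => hf x hx),
    surfaceMeasure_restrict_of_chart hΩo hφ h,
    setIntegral_eq_integral_of_forall_compl_eq_zero (fun x hx => hf x hx),
    (measurableEmbedding_graphMap T hφ.continuous).integral_map,
    integral_withDensity_eq_integral_toReal_smul
      (continuous_graphDensity hφ).measurable.ennreal_ofReal (by simp)]
  refine integral_congr_ae (Eventually.of_forall fun u => ?_)
  have := one_le_graphDensity φ u
  simp only [smul_eq_mul]
  rw [ENNReal.toReal_ofReal (by linarith)]

/-! ### Regularity of the boundary -/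

theorem abs_inner_outerNormal_le_of_chart {d : ℕ} {Ω : Set (E (d + 1))} (hΩo : IsOpen Ω)
    {T : E (d + 1) ≃ₗᵢ[ℝ] WithLp 2 (E d × ℝ)} {φ : E d → ℝ} (hφ : ContDiff ℝ 1 φ)
    {p : E (d + 1)} {r α L : ℝ} (hα : 0 < α)
    (hL : ∀ u v, ‖fderiv ℝ φ u - fderiv ℝ φ v‖ ≤ L * ‖u - v‖ ^ α)
    (h : ∀ x ∈ Metric.ball p r, (x ∈ Ω ↔ φ (T x).fst < (T x).snd))
    {x y : E (d + 1)} (hx : x ∈ Metric.ball p r) (hxf : x ∈ frontier Ω)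
    (hy : y ∈ Metric.ball p r) (hyf : y ∈ frontier Ω) :
    |inner ℝ (x - y) (outerNormal Ω y)| ≤ |L| * ‖x - y‖ ^ (1 + α) := by
  have ex := eq_graphMap_of_chart hΩo hφ.continuous h hx hxf
  have ey := eq_graphMap_of_chart hΩo hφ.continuous h hy hyf
  set v := (T x).fst
  set u := (T y).fst
  have hvu : ‖v - u‖ ≤ ‖x - y‖ := by
    rw [ex, ey]; exact norm_sub_le_norm_graphMap_sub T φ v u
  have hmvt : ‖φ v - φ u - fderiv ℝ φ u (v - u)‖ ≤ |L| * ‖v - u‖ ^ α * ‖v - u‖ := by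
    refine (convex_closedBall u ‖v - u‖).norm_image_sub_le_of_norm_fderiv_le' (𝕜 := ℝ)
      (fun w _ => hφ.differentiable one_ne_zero w) (fun w hw => ?_)
      (Metric.mem_closedBall_self (norm_nonneg _)) (by simp [dist_eq_norm])
    refine (hL w u).trans ?_
    have hw' : ‖w - u‖ ≤ ‖v - u‖ := by simpa [dist_eq_norm] using hw
    calc L * ‖w - u‖ ^ α ≤ |L| * ‖w - u‖ ^ α := by gcongr; exact le_abs_self L
      _ ≤ _ := by gcongr
  have hJ := one_le_graphDensity φ u
  have hin : inner ℝ (x - y) (outerNormal Ω y) =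
      -((graphDensity φ u)⁻¹ * (φ v - φ u - fderiv ℝ φ u (v - u))) := by
    conv_lhs => rw [ex, ey]
    rw [outerNormal_graphMap hφ h (ey ▸ hy), inner_graphNormal, map_sub, apply_graphMap,
      apply_graphMap]
    change (graphDensity φ u)⁻¹ * (fderiv ℝ φ u (v - u) - (φ v - φ u)) = _
    ring
  rw [hin, abs_neg, abs_mul, abs_of_nonneg (by positivity), ← Real.norm_eq_abs (_ - _)]
  calc (graphDensity φ u)⁻¹ * ‖φ v - φ u - fderiv ℝ φ u (v - u)‖
      ≤ 1 * ‖φ v - φ u - fderiv ℝ φ u (v - u)‖ := by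
        gcongr; exact inv_le_one_of_one_le₀ hJ
    _ ≤ |L| * ‖v - u‖ ^ α * ‖v - u‖ := by rw [one_mul]; exact hmvt
    _ = |L| * ‖v - u‖ ^ (1 + α) := by
        rw [add_comm, Real.rpow_add_one' (norm_nonneg _) (by positivity), mul_assoc]
    _ ≤ _ := by gcongr

theorem norm_outerNormal_sub_le_of_chart {d : ℕ} {Ω : Set (E (d + 1))} (hΩo : IsOpen Ω)
    {T : E (d + 1) ≃ₗᵢ[ℝ] WithLp 2 (E d × ℝ)} {φ : E d → ℝ} (hφ : ContDiff ℝ 1 φ)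
    {p : E (d + 1)} {r α L : ℝ} (hα : 0 < α)
    (hL : ∀ u v, ‖fderiv ℝ φ u - fderiv ℝ φ v‖ ≤ L * ‖u - v‖ ^ α)
    (h : ∀ x ∈ Metric.ball p r, (x ∈ Ω ↔ φ (T x).fst < (T x).snd))
    {x y : E (d + 1)} (hx : x ∈ Metric.ball p r) (hxf : x ∈ frontier Ω)
    (hy : y ∈ Metric.ball p r) (hyf : y ∈ frontier Ω) :
    ‖outerNormal Ω x - outerNormal Ω y‖ ≤ 2 * |L| * ‖x - y‖ ^ α := by
  have ex := eq_graphMap_of_chart hΩo hφ.continuous h hx hxf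
  have ey := eq_graphMap_of_chart hΩo hφ.continuous h hy hyf
  set v := (T x).fst
  set u := (T y).fst
  have hvu : ‖v - u‖ ≤ ‖x - y‖ := by
    rw [ex, ey]; exact norm_sub_le_norm_graphMap_sub T φ v u
  have e : outerNormal Ω x - outerNormal Ω y = graphNormal T φ v - graphNormal T φ u := by
    conv_lhs => rw [ex, ey]
    rw [outerNormal_graphMap hφ h (ex ▸ hx), outerNormal_graphMap hφ h (ey ▸ hy)]
  rw [e]
  refine (norm_graphNormal_sub_le T φ v u).trans ?_
  calc 2 * ‖fderiv ℝ φ v - fderiv ℝ φ u‖ ≤ 2 * (L * ‖v - u‖ ^ α) := by gcongr; exact hL v u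
    _ ≤ 2 * (|L| * ‖x - y‖ ^ α) := by
      refine mul_le_mul_of_nonneg_left ?_ zero_le_two
      exact (mul_le_mul_of_nonneg_right (le_abs_self L) (by positivity)).trans (by gcongr)
    _ = _ := by ring

/-- An estimate that holds near each point of a compact set, with constants that may depend on the
point, holds for all pairs of close points of the set with one constant. -/
theorem IsCompact.exists_uniform_of_locally {X : Type*} [PseudoMetricSpace X] {K : Set X}
    (hK : IsCompact K) {Q : ℝ → X → X → Prop} (hQ : ∀ C C' x y, C ≤ C' → Q C x y → Q C' x y)
    (h : ∀ p ∈ K, ∃ r > 0, ∃ C, ∀ x ∈ K, x ∈ Metric.ball p r → ∀ y ∈ K, y ∈ Metric.ball p r →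
      Q C x y) :
    ∃ δ > 0, ∃ C, ∀ x ∈ K, ∀ y ∈ K, dist x y < δ → Q C x y := by
  have key : ∃ δ > 0, ∃ C, ∀ x ∈ K, x ∈ K → ∀ y ∈ K, dist x y < δ → Q C x y := by
    refine hK.induction_on (p := fun s => ∃ δ > 0, ∃ C, ∀ x ∈ s, x ∈ K → ∀ y ∈ K, dist x y < δ →
      Q C x y) ⟨1, one_pos, 0, by simp⟩ ?_ ?_ ?_
    · rintro s t hst ⟨δ, hδ, C, hC⟩
      exact ⟨δ, hδ, C, fun x hx => hC x (hst hx)⟩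
    · rintro s t ⟨δ, hδ, C, hC⟩ ⟨δ', hδ', C', hC'⟩
      refine ⟨min δ δ', lt_min hδ hδ', max C C', ?_⟩
      rintro x (hx | hx) hxK y hy hxy
      · exact hQ _ _ _ _ (le_max_left _ _) (hC x hx hxK y hy (hxy.trans_le (min_le_left _ _)))
      · exact hQ _ _ _ _ (le_max_right _ _) (hC' x hx hxK y hy (hxy.trans_le (min_le_right _ _)))
    · intro p hp
      obtain ⟨r, hr, C, hC⟩ := h p hp
      refine ⟨Metric.ball p (r / 2), mem_nhdsWithin_of_mem_nhds (Metric.ball_mem_nhds _ (by linarith)),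
        r / 2, by linarith, C, fun x hx hxK y hy hxy => ?_⟩
      rw [Metric.mem_ball] at hx
      refine hC x hxK (Metric.mem_ball.2 (by linarith)) y hy (Metric.mem_ball.2 ?_)
      linarith [dist_triangle y x p, dist_comm x y]
  obtain ⟨δ, hδ, C, hC⟩ := key
  exact ⟨δ, hδ, C, fun x hx => hC x hx hx⟩

/-- A bounded quantity which is locally `O(|x - y| ^ β)` on a compact set is so globally. -/
theorem IsCompact.exists_forall_le_mul_rpow {n : ℕ} {K : Set (E n)} (hK : IsCompact K)
    {q : E n → E n → ℝ} {β : ℝ} (hβ : 0 < β) {B : ℝ} (hB : ∀ x ∈ K, ∀ y ∈ K, q x y ≤ B)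
    (h : ∀ p ∈ K, ∃ r > 0, ∃ C, ∀ x ∈ K, x ∈ Metric.ball p r → ∀ y ∈ K, y ∈ Metric.ball p r →
      q x y ≤ C * ‖x - y‖ ^ β) :
    ∃ C, 0 ≤ C ∧ ∀ x ∈ K, ∀ y ∈ K, q x y ≤ C * ‖x - y‖ ^ β := by
  obtain ⟨δ, hδ, C, hC⟩ := hK.exists_uniform_of_locally
    (Q := fun C x y => q x y ≤ C * ‖x - y‖ ^ β)
    (fun C C' x y hCC' hq => hq.trans (by gcongr)) h
  refine ⟨max |C| (|B| / δ ^ β), le_max_of_le_left (abs_nonneg _), fun x hx y hy => ?_⟩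
  rcases lt_or_ge (dist x y) δ with hlt | hge
  · refine (hC x hx y hy hlt).trans ?_
    gcongr
    exact (le_abs_self C).trans (le_max_left _ _)
  · refine (hB x hx y hy).trans ?_
    have h1 : δ ^ β ≤ ‖x - y‖ ^ β := by rw [← dist_eq_norm]; gcongr
    have h2 : 0 < δ ^ β := by positivity
    calc B ≤ |B| := le_abs_self B
      _ = |B| / δ ^ β * δ ^ β := by field_simp
      _ ≤ max |C| (|B| / δ ^ β) * ‖x - y‖ ^ β := by
        gcongr
        exact le_max_right _ _

theorem isOuterUnitNormal_outerNormal {d : ℕ} {Ω : Set (E (d + 1))} (hΩo : IsOpen Ω) {α : ℝ}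
    (hΩ : HasC1HolderBoundary α Ω) {x : E (d + 1)} (hx : x ∈ frontier Ω) :
    IsOuterUnitNormal Ω x (outerNormal Ω x) := by
  obtain ⟨T, φ, r, L, hr, hφ, -, h⟩ := hΩ x hx
  have hxb : x ∈ Metric.ball x r := Metric.mem_ball_self hr
  have e := eq_graphMap_of_chart hΩo hφ.continuous h hxb hx
  have hu : graphMap T φ (T x).fst ∈ Metric.ball x r := by rw [← e]; exact hxb
  have := isOuterUnitNormal_graphNormal hφ h hu
  rw [← e] at this
  rwa [outerNormal_spec this]

theorem isCompact_frontier_of_isBounded {n : ℕ} {Ω : Set (E n)} (hΩb : Bornology.IsBounded Ω) :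
    IsCompact (frontier Ω) :=
  Metric.isCompact_of_isClosed_isBounded isClosed_frontier
    (hΩb.closure.subset frontier_subset_closure)

theorem exists_abs_inner_outerNormal_le {d : ℕ} {Ω : Set (E (d + 1))} (hΩo : IsOpen Ω)
    (hΩb : Bornology.IsBounded Ω) {α : ℝ} (hα : 0 < α) (hΩ : HasC1HolderBoundary α Ω) :
    ∃ C, 0 ≤ C ∧ ∀ x ∈ frontier Ω, ∀ y ∈ frontier Ω,
      |inner ℝ (x - y) (outerNormal Ω y)| ≤ C * ‖x - y‖ ^ (1 + α) := by
  have hK := isCompact_frontier_of_isBounded hΩb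
  obtain ⟨B, hB⟩ := hK.isBounded.exists_norm_le
  refine hK.exists_forall_le_mul_rpow (B := 2 * B) (by positivity) (fun x hx y hy => ?_)
    fun p hp => ?_
  · refine (abs_real_inner_le_norm _ _).trans ?_
    rw [(isOuterUnitNormal_outerNormal hΩo hΩ hy).1]
    linarith [norm_sub_le x y, hB x hx, hB y hy]
  · obtain ⟨T, φ, r, L, hr, hφ, hL, h⟩ := hΩ p hp
    exact ⟨r, hr, |L|, fun x hx hxb y hy hyb =>
      abs_inner_outerNormal_le_of_chart hΩo hφ hα hL h hxb hx hyb hy⟩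

theorem exists_norm_outerNormal_sub_le {d : ℕ} {Ω : Set (E (d + 1))} (hΩo : IsOpen Ω)
    (hΩb : Bornology.IsBounded Ω) {α : ℝ} (hα : 0 < α) (hΩ : HasC1HolderBoundary α Ω) :
    ∃ C, 0 ≤ C ∧ ∀ x ∈ frontier Ω, ∀ y ∈ frontier Ω,
      ‖outerNormal Ω x - outerNormal Ω y‖ ≤ C * ‖x - y‖ ^ α := by
  have hK := isCompact_frontier_of_isBounded hΩb
  refine hK.exists_forall_le_mul_rpow (B := 2) hα (fun x hx y hy => ?_) fun p hp => ?_
  · refine (norm_sub_le _ _).trans ?_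
    rw [(isOuterUnitNormal_outerNormal hΩo hΩ hx).1, (isOuterUnitNormal_outerNormal hΩo hΩ hy).1]
    norm_num
  · obtain ⟨T, φ, r, L, hr, hφ, hL, h⟩ := hΩ p hp
    exact ⟨r, hr, 2 * |L|, fun x hx hxb y hy hyb =>
      norm_outerNormal_sub_le_of_chart hΩo hφ hα hL h hxb hx hyb hy⟩

theorem continuousOn_outerNormal {d : ℕ} {Ω : Set (E (d + 1))} (hΩo : IsOpen Ω)
    (hΩb : Bornology.IsBounded Ω) {α : ℝ} (hα : 0 < α) (hΩ : HasC1HolderBoundary α Ω) :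
    ContinuousOn (outerNormal Ω) (frontier Ω) := by
  obtain ⟨C, hC0, hC⟩ := exists_norm_outerNormal_sub_le hΩo hΩb hα hΩ
  intro x hx
  rw [ContinuousWithinAt, tendsto_iff_norm_sub_tendsto_zero]
  have hlim : Tendsto (fun y => C * ‖y - x‖ ^ α) (𝓝[frontier Ω] x) (𝓝 0) := by
    have hc : Continuous fun y : E (d + 1) => C * ‖y - x‖ ^ α :=
      continuous_const.mul ((continuous_id.sub continuous_const).norm.rpow_const
        fun _ => Or.inr hα.le)
    simpa [hα.ne'] using (hc.tendsto x).mono_left nhdsWithin_le_nhds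
  exact squeeze_zero' (Eventually.of_forall fun _ => norm_nonneg _)
    (eventually_mem_nhdsWithin.mono fun y hy => hC y hy x hx) hlim

theorem volume_closedBall_eq {d : ℕ} (u : E d) {ρ : ℝ} (hρ : 0 ≤ ρ) :
    volume (Metric.closedBall u ρ) = ENNReal.ofReal (ρ ^ d) * volume (Metric.ball (0 : E d) 1) := by
  rw [Measure.addHaar_closedBall _ _ hρ]; simp

/-- The surface measure is upper Ahlfors regular of dimension `d`. -/
theorem exists_surfaceMeasure_closedBall_le {d : ℕ} {Ω : Set (E (d + 1))} (hΩo : IsOpen Ω)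
    (hΩb : Bornology.IsBounded Ω) {α : ℝ} (hΩ : HasC1HolderBoundary α Ω) :
    ∃ C : ℝ≥0, ∀ (x : E (d + 1)) (ρ : ℝ), 0 < ρ →
      surfaceMeasure Ω (Metric.closedBall x ρ) ≤ C * ENNReal.ofReal ρ ^ d := by
  have hK := isCompact_frontier_of_isBounded hΩb
  have hloc : ∃ δ > 0, ∃ C : ℝ≥0, ∀ x ∈ frontier Ω, ∀ ρ, 0 < ρ → ρ < δ →
      surfaceMeasure Ω (Metric.closedBall x ρ) ≤ C * ENNReal.ofReal ρ ^ d := by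
    refine hK.induction_on (p := fun s => ∃ δ > 0, ∃ C : ℝ≥0, ∀ x ∈ s, ∀ ρ, 0 < ρ → ρ < δ →
      surfaceMeasure Ω (Metric.closedBall x ρ) ≤ C * ENNReal.ofReal ρ ^ d)
      ⟨1, one_pos, 0, by simp⟩ ?_ ?_ ?_
    · rintro s t hst ⟨δ, hδ, C, hC⟩
      exact ⟨δ, hδ, C, fun x hx => hC x (hst hx)⟩
    · rintro s t ⟨δ, hδ, C, hC⟩ ⟨δ', hδ', C', hC'⟩
      refine ⟨min δ δ', lt_min hδ hδ', max C C', ?_⟩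
      rintro x (hx | hx) ρ h0 hρ
      · refine (hC x hx ρ h0 (hρ.trans_le (min_le_left _ _))).trans ?_
        gcongr; exact le_max_left _ _
      · refine (hC' x hx ρ h0 (hρ.trans_le (min_le_right _ _))).trans ?_
        gcongr; exact le_max_right _ _
    · intro p hp
      obtain ⟨T, φ, r, L, hr, hφ, -, h⟩ := hΩ p hp
      obtain ⟨B, hB⟩ := (isCompact_closedBall ((T p).fst) r).exists_bound_of_continuousOn
        (continuous_graphDensity hφ).continuousOn
      refine ⟨Metric.ball p (r / 2),
        mem_nhdsWithin_of_mem_nhds (Metric.ball_mem_nhds _ (by linarith)), r / 2, by linarith,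
        B.toNNReal * (volume (Metric.ball (0 : E d) 1)).toNNReal, fun x hx ρ h0 hρ => ?_⟩
      rw [Metric.mem_ball] at hx
      have hsub : Metric.closedBall x ρ ⊆ Metric.ball p r :=
        Metric.closedBall_subset_ball' (by linarith)
      have hfst : ∀ y z : E (d + 1), dist (T y).fst (T z).fst ≤ dist y z := by
        intro y z
        rw [dist_eq_norm, dist_eq_norm, ← T.norm_map, map_sub]
        exact norm_le_norm_toLp_prod ((T y).fst - (T z).fst) ((T y).snd - (T z).snd)
      have hpre : graphMap T φ ⁻¹' Metric.closedBall x ρ ⊆ Metric.closedBall (T x).fst ρ := by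
        intro u hu
        have := hfst (graphMap T φ u) x
        rw [apply_graphMap] at this
        exact this.trans hu
      have hm : MeasurableSet (Metric.closedBall x ρ) := Metric.isClosed_closedBall.measurableSet
      rw [← Measure.restrict_eq_self (surfaceMeasure Ω) hsub,
        surfaceMeasure_restrict_of_chart hΩo hφ h, Measure.restrict_eq_self _ hsub,
        (measurableEmbedding_graphMap T hφ.continuous).map_apply]
      refine (measure_mono hpre).trans ?_
      rw [withDensity_apply _ Metric.isClosed_closedBall.measurableSet]
      calc ∫⁻ u in Metric.closedBall (T x).fst ρ, ENNReal.ofReal (graphDensity φ u)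
          ≤ ∫⁻ u in Metric.closedBall (T x).fst ρ, ENNReal.ofReal B := by
            refine setLIntegral_mono measurable_const fun u hu => ENNReal.ofReal_le_ofReal ?_
            refine (le_abs_self _).trans (hB u ?_)
            have := hfst x p
            rw [Metric.mem_closedBall] at hu ⊢
            linarith [dist_triangle u (T x).fst (T p).fst]
        _ = ENNReal.ofReal B * (ENNReal.ofReal (ρ ^ d) * volume (Metric.ball (0 : E d) 1)) := by
            rw [setLIntegral_const, volume_closedBall_eq _ h0.le]
        _ = _ := by
            rw [ENNReal.coe_mul, ENNReal.coe_toNNReal measure_ball_lt_top.ne,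
              ENNReal.ofReal_pow h0.le]
            simp only [ENNReal.ofReal]
            ring
  obtain ⟨δ, hδ, C, hC⟩ := hloc
  have hfin : surfaceMeasure Ω univ < ∞ := by
    rw [surfaceMeasure, Measure.restrict_apply_univ, ← Measure.restrict_apply_self]
    change surfaceMeasure Ω (frontier Ω) < ∞
    refine hK.measure_lt_top_of_nhdsWithin fun x hx =>
      ⟨Metric.closedBall x (δ / 2), mem_nhdsWithin_of_mem_nhds
        (Metric.closedBall_mem_nhds _ (by linarith)), ?_⟩
    exact (hC x hx (δ / 2) (by linarith) (by linarith)).trans_lt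
      (ENNReal.mul_lt_top ENNReal.coe_lt_top (ENNReal.pow_lt_top ENNReal.ofReal_lt_top))
  set D : ℝ≥0 := (surfaceMeasure Ω univ / ENNReal.ofReal (δ / 2) ^ d).toNNReal with hD
  have hδp : ENNReal.ofReal (δ / 2) ^ d ≠ 0 := pow_ne_zero _ (by simpa using hδ)
  have hDc : (D : ℝ≥0∞) = surfaceMeasure Ω univ / ENNReal.ofReal (δ / 2) ^ d :=
    ENNReal.coe_toNNReal (ENNReal.div_lt_top hfin.ne hδp).ne
  refine ⟨max (C * 2 ^ d) D, fun x ρ h0 => ?_⟩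
  rcases lt_or_ge ρ (δ / 2) with hlt | hge
  · by_cases hne : (Metric.closedBall x ρ ∩ frontier Ω).Nonempty
    · obtain ⟨z, hz, hzf⟩ := hne
      have hsub : Metric.closedBall x ρ ⊆ Metric.closedBall z (2 * ρ) := by
        refine Metric.closedBall_subset_closedBall' ?_
        rw [Metric.mem_closedBall, dist_comm] at hz
        linarith
      refine (measure_mono hsub).trans ((hC z hzf (2 * ρ) (by linarith) (by linarith)).trans ?_)
      rw [ENNReal.ofReal_mul zero_le_two, mul_pow, ← mul_assoc]
      gcongr
      refine le_trans (le_of_eq ?_) (ENNReal.coe_le_coe.2 (le_max_left _ _))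
      simp
    · have : surfaceMeasure Ω (Metric.closedBall x ρ) = 0 := by
        rw [surfaceMeasure, Measure.restrict_apply Metric.isClosed_closedBall.measurableSet,
          not_nonempty_iff_eq_empty.1 hne, measure_empty]
      simp [this]
  · calc surfaceMeasure Ω (Metric.closedBall x ρ) ≤ surfaceMeasure Ω univ := measure_mono (subset_univ _)
      _ = D * ENNReal.ofReal (δ / 2) ^ d := by
        rw [hDc, ENNReal.div_mul_cancel hδp (ENNReal.pow_lt_top ENNReal.ofReal_lt_top).ne]
      _ ≤ _ := by
        gcongr
        exact le_max_right _ _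

/-! ### The divergence theorem -/

theorem integral_fderiv_apply_eq_zero {V : Type*} [NormedAddCommGroup V] [NormedSpace ℝ V]
    [FiniteDimensional ℝ V] [MeasurableSpace V] [BorelSpace V] (μ : Measure V)
    [μ.IsAddHaarMeasure] {g : V → ℝ} (hg : ContDiff ℝ 1 g) (hgc : HasCompactSupport g) (v : V) :
    ∫ x, fderiv ℝ g x v ∂μ = 0 := by
  have hi : Integrable (fun x => fderiv ℝ g x v) μ :=
    ((hg.continuous_fderiv one_ne_zero).clm_apply continuous_const).integrable_of_hasCompactSupport
      (hgc.fderiv_apply ℝ v)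
  have := integral_mul_fderiv_eq_neg_fderiv_mul_of_integrable (μ := μ) (f := fun _ => (1 : ℝ))
    (g := g) (v := v) (by simp) (by simpa using hi)
    (by simpa using hg.continuous.integrable_of_hasCompactSupport hgc)
    (fun x _ => differentiableAt_const _) (fun x _ => hg.differentiable one_ne_zero x)
  simpa using this

/-- The coordinates `(u, τ) ↦ (u, φ u + τ)`, in which the graph of `φ` is flat. -/
noncomputable def flatteningMap {d : ℕ} (T : E (d + 1) ≃ₗᵢ[ℝ] WithLp 2 (E d × ℝ)) {φ : E d → ℝ}
    (hφ : Continuous φ) : E d × ℝ ≃ₜ E (d + 1) where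
  toFun q := T.symm (WithLp.toLp 2 (q.1, φ q.1 + q.2))
  invFun x := ((T x).fst, (T x).snd - φ (T x).fst)
  left_inv q := by simp
  right_inv x := by
    apply T.injective
    simp
    rfl
  continuous_toFun := by
    refine T.symm.continuous.comp ((WithLp.prod_continuous_toLp 2 _ _).comp ?_)
    fun_prop
  continuous_invFun := by
    have h1 := continuous_fst_apply T
    have h2 := continuous_snd_apply T
    fun_prop

theorem flatteningMap_apply {d : ℕ} (T : E (d + 1) ≃ₗᵢ[ℝ] WithLp 2 (E d × ℝ)) {φ : E d → ℝ}
    (hφ : Continuous φ) (q : E d × ℝ) :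
    flatteningMap T hφ q = T.symm (WithLp.toLp 2 (q.1, φ q.1 + q.2)) := rfl

theorem measurePreserving_flatteningMap {d : ℕ} (T : E (d + 1) ≃ₗᵢ[ℝ] WithLp 2 (E d × ℝ))
    {φ : E d → ℝ} (hφ : Continuous φ) : MeasurePreserving (flatteningMap T hφ) := by
  have h1 : MeasurePreserving (fun q : E d × ℝ => (q.1, φ q.1 + q.2)) := by
    refine (MeasurePreserving.id volume).skew_product (g := fun u t => φ u + t) ?_ ?_
    · exact (by fun_prop : Continuous (Function.uncurry fun u t => φ u + t)).measurable
    · exact Eventually.of_forall fun u => map_add_left_eq_self volume (φ u)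
  exact (T.symm.measurePreserving.comp (WithLp.volume_preserving_toLp (E d) ℝ)).comp h1

theorem hasFDerivAt_flatteningMap {d : ℕ} (T : E (d + 1) ≃ₗᵢ[ℝ] WithLp 2 (E d × ℝ)) {φ : E d → ℝ}
    (hφ : ContDiff ℝ 1 φ) :
    ContDiff ℝ 1 (flatteningMap T hφ.continuous) ∧ ∀ q v,
      fderiv ℝ (flatteningMap T hφ.continuous) q v =
        T.symm (WithLp.toLp 2 (v.1, fderiv ℝ φ q.1 v.1 + v.2)) := by
  set S : E d × ℝ →L[ℝ] E (d + 1) :=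
    (T.symm.toContinuousLinearEquiv : WithLp 2 (E d × ℝ) →L[ℝ] E (d + 1)).comp
      ((WithLp.prodContinuousLinearEquiv 2 ℝ (E d) ℝ).symm : E d × ℝ →L[ℝ] WithLp 2 (E d × ℝ))
  have hS : (flatteningMap T hφ.continuous : E d × ℝ → E (d + 1)) =
      fun q => S (q.1, φ q.1 + q.2) := rfl
  have hd : ContDiff ℝ 1 fun q : E d × ℝ => (q.1, φ q.1 + q.2) :=
    contDiff_fst.prodMk ((hφ.comp contDiff_fst).add contDiff_snd)
  refine ⟨hS ▸ S.contDiff.comp hd, fun q v => ?_⟩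
  have hφ' := (hφ.differentiable one_ne_zero q.1).hasFDerivAt
  have h1 : HasFDerivAt (fun q : E d × ℝ => (q.1, φ q.1 + q.2)) _ q :=
    hasFDerivAt_fst.prodMk ((hφ'.comp q hasFDerivAt_fst).add hasFDerivAt_snd)
  have h2 : HasFDerivAt (fun q : E d × ℝ => S (q.1, φ q.1 + q.2)) _ q :=
    S.hasFDerivAt.comp q h1
  rw [hS, h2.fderiv]
  rfl

/-- The divergence theorem for functions supported in a chart. In the flattened coordinates
`(u, τ)`, the derivative splits into a tangential derivative, whose integral vanishes, and a
multiple of the derivative in `τ`, which is integrated over `τ > 0`. -/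
theorem setIntegral_fderiv_of_chart {d : ℕ} {Ω : Set (E (d + 1))} (hΩo : IsOpen Ω)
    {T : E (d + 1) ≃ₗᵢ[ℝ] WithLp 2 (E d × ℝ)} {φ : E d → ℝ} (hφ : ContDiff ℝ 1 φ)
    {p : E (d + 1)} {r : ℝ} (h : ∀ x ∈ Metric.ball p r, (x ∈ Ω ↔ φ (T x).fst < (T x).snd))
    {g : E (d + 1) → ℝ} (hg : ContDiff ℝ 1 g) (hgs : tsupport g ⊆ Metric.ball p r)
    (e : E (d + 1)) :
    ∫ x in Ω, fderiv ℝ g x e =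
      ∫ x, g x * inner ℝ e (outerNormal Ω x) ∂(surfaceMeasure Ω) := by
  have hgc : HasCompactSupport g := HasCompactSupport.of_support_subset_isCompact
    (isCompact_closedBall p r)
    ((subset_tsupport g).trans (hgs.trans Metric.ball_subset_closedBall))
  have hg0 : ∀ x ∉ Metric.ball p r, g x = 0 := fun x hx =>
    image_eq_zero_of_notMem_tsupport fun hx' => hx (hgs hx')
  have hg0' : ∀ x ∉ Metric.ball p r, fderiv ℝ g x = 0 := fun x hx =>
    image_eq_zero_of_notMem_tsupport fun hx' => hx (hgs (tsupport_fderiv_subset ℝ hx'))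
  set Ψ := flatteningMap T hφ.continuous with hΨ
  obtain ⟨hΨd, hΨf⟩ := hasFDerivAt_flatteningMap T hφ
  set k : E d × ℝ → ℝ := fun q => g (Ψ q) with hk
  have hkd : ContDiff ℝ 1 k := hg.comp hΨd
  have hkc : HasCompactSupport k := hgc.comp_homeomorph Ψ
  have hkf : ∀ q v, fderiv ℝ k q v =
      fderiv ℝ g (Ψ q) (T.symm (WithLp.toLp 2 (v.1, fderiv ℝ φ q.1 v.1 + v.2))) := by
    intro q v
    have h2 : fderiv ℝ k q = (fderiv ℝ g (Ψ q)).comp (fderiv ℝ Ψ q) :=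
      ((hg.differentiable one_ne_zero _).hasFDerivAt.comp q
        (hΨd.differentiable one_ne_zero q).hasFDerivAt).fderiv
    rw [h2, ContinuousLinearMap.comp_apply, hΨf]
  set a : E d := (T e).fst
  set b : ℝ := (T e).snd
  have he : e = T.symm (WithLp.toLp 2 (a, b)) := by
    apply T.injective; simp; rfl
  have hsplit : ∀ q, fderiv ℝ g (Ψ q) e =
      fderiv ℝ k q (a, 0) + (b - fderiv ℝ φ q.1 a) * fderiv ℝ k q (0, 1) := by
    intro q
    rw [← smul_eq_mul, ← map_smul, ← map_add, hkf, he]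
    simp
  have hcont := hkd.continuous_fderiv one_ne_zero
  have hφc : Continuous fun u => fderiv ℝ φ u a :=
    (hφ.continuous_fderiv one_ne_zero).clm_apply continuous_const
  have hi1 : Integrable (fun q => fderiv ℝ k q (a, 0)) (volume.prod volume) :=
    (hcont.clm_apply continuous_const).integrable_of_hasCompactSupport (hkc.fderiv_apply ℝ _)
  have hi2 : Integrable (fun q : E d × ℝ => (b - fderiv ℝ φ q.1 a) * fderiv ℝ k q (0, 1))
      (volume.prod volume) := by
    refine Continuous.integrable_of_hasCompactSupport ?_ ((hkc.fderiv_apply ℝ _).mul_left)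
    exact (continuous_const.sub (hφc.comp continuous_fst)).mul
      (hcont.clm_apply continuous_const)
  -- the tangential derivative integrates to zero over each slice
  have hslice1 : ∀ τ : ℝ, ∫ u, fderiv ℝ k (u, τ) (a, 0) = 0 := by
    intro τ
    have hd : ContDiff ℝ 1 fun u => k (u, τ) := hkd.comp (contDiff_id.prodMk contDiff_const)
    have hc : HasCompactSupport fun u => k (u, τ) :=
      hkc.comp_isClosedEmbedding (Function.LeftInverse.isClosedEmbedding (f := Prod.fst)
        (fun _ => rfl) continuous_fst (continuous_id.prodMk continuous_const))
    refine Eq.trans ?_ (integral_fderiv_apply_eq_zero volume hd hc a)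
    refine integral_congr_ae (Eventually.of_forall fun u => ?_)
    have h1 : HasFDerivAt (fun u : E d => (u, τ)) _ u :=
      (hasFDerivAt_id (𝕜 := ℝ) u).prodMk (hasFDerivAt_const τ u)
    have h2 := (hkd.differentiable one_ne_zero (u, τ)).hasFDerivAt.comp u h1
    have h3 : fderiv ℝ (fun u => k (u, τ)) u = _ := h2.fderiv
    simp only [h3]
    simp
  -- the derivative in `τ` integrates to a boundary value
  have hslice2 : ∀ u, ∫ τ in Ioi (0 : ℝ), fderiv ℝ k (u, τ) (0, 1) = - g (graphMap T φ u) := by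
    intro u
    have hd : ContDiff ℝ 1 fun τ => k (u, τ) := hkd.comp (contDiff_const.prodMk contDiff_id)
    have hc : HasCompactSupport fun τ => k (u, τ) :=
      hkc.comp_isClosedEmbedding (Function.LeftInverse.isClosedEmbedding (f := Prod.snd)
        (fun _ => rfl) continuous_snd (continuous_const.prodMk continuous_id))
    have h0 : k (u, 0) = g (graphMap T φ u) := by
      simp [hk, hΨ, flatteningMap_apply, graphMap]
    rw [← h0, ← hc.integral_Ioi_deriv_eq hd 0]
    refine integral_congr_ae (Eventually.of_forall fun τ => ?_)
    have h1 : HasDerivAt (fun τ : ℝ => (u, τ)) ((0 : E d), (1 : ℝ)) τ :=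
      (hasDerivAt_const τ u).prodMk (hasDerivAt_id τ)
    exact ((hkd.differentiable one_ne_zero (u, τ)).hasFDerivAt.comp_hasDerivAt τ h1).deriv.symm
  have hLHS : ∫ x in Ω, fderiv ℝ g x e = ∫ q in (univ : Set (E d)) ×ˢ Ioi (0 : ℝ),
      (fderiv ℝ k q (a, 0) + (b - fderiv ℝ φ q.1 a) * fderiv ℝ k q (0, 1))
        ∂(volume.prod volume) := by
    rw [← integral_indicator hΩo.measurableSet,
      ← (measurePreserving_flatteningMap T hφ.continuous).integral_comp
        Ψ.measurableEmbedding, ← integral_indicator (MeasurableSet.univ.prod measurableSet_Ioi)]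
    refine integral_congr_ae (Eventually.of_forall fun q => ?_)
    simp only [← hΨ, ← hsplit]
    by_cases hq : Ψ q ∈ Metric.ball p r
    · have : Ψ q ∈ Ω ↔ q ∈ (univ : Set (E d)) ×ˢ Ioi (0 : ℝ) := by
        rw [h _ hq, hΨ, flatteningMap_apply]
        simp
      simp only [indicator, this, hsplit]
    · simp [indicator, hg0' _ hq]
  rw [hLHS, integral_add hi1.integrableOn hi2.integrableOn, setIntegral_prod _ hi2.integrableOn]
  have h1 : ∫ q in (univ : Set (E d)) ×ˢ Ioi (0 : ℝ), fderiv ℝ k q (a, 0) ∂(volume.prod volume) =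
      0 := by
    have hi1' : Integrable (fun q => fderiv ℝ k q (a, 0))
        (volume.prod (volume.restrict (Ioi 0))) := by
      have := hi1.integrableOn (s := (univ : Set (E d)) ×ˢ Ioi (0 : ℝ))
      rwa [IntegrableOn, ← Measure.prod_restrict, Measure.restrict_univ] at this
    rw [← Measure.prod_restrict, Measure.restrict_univ, integral_prod_symm _ hi1']
    simp [hslice1]
  rw [h1, zero_add, integral_surfaceMeasure_of_chart hΩo hφ h fun x hx => by rw [hg0 x hx, zero_mul],
    Measure.restrict_univ]
  refine integral_congr_ae (Eventually.of_forall fun u => ?_)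
  simp only
  rw [integral_const_mul, hslice2]
  by_cases hu : graphMap T φ u ∈ Metric.ball p r
  · have := one_le_graphDensity φ u
    rw [outerNormal_graphMap hφ h hu, inner_graphNormal]
    field_simp
    ring
  · simp [hg0 _ hu]

theorem isFiniteMeasure_surfaceMeasure {d : ℕ} {Ω : Set (E (d + 1))} (hΩo : IsOpen Ω)
    (hΩb : Bornology.IsBounded Ω) {α : ℝ} (hΩ : HasC1HolderBoundary α Ω) :
    IsFiniteMeasure (surfaceMeasure Ω) := by
  obtain ⟨C, hC⟩ := exists_surfaceMeasure_closedBall_le hΩo hΩb hΩ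
  obtain ⟨B, hB0, hB⟩ := (isCompact_frontier_of_isBounded hΩb).isBounded.subset_closedBall_lt 0 0
  refine ⟨?_⟩
  rw [surfaceMeasure, Measure.restrict_apply_univ, ← Measure.restrict_apply_self]
  change surfaceMeasure Ω (frontier Ω) < ∞
  exact (measure_mono hB).trans_lt ((hC 0 B hB0).trans_lt
    (ENNReal.mul_lt_top ENNReal.coe_lt_top (ENNReal.pow_lt_top ENNReal.ofReal_lt_top)))

theorem surfaceMeasure_restrict_frontier {d : ℕ} (Ω : Set (E (d + 1))) :
    (surfaceMeasure Ω).restrict (frontier Ω) = surfaceMeasure Ω := by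
  rw [surfaceMeasure, Measure.restrict_restrict isClosed_frontier.measurableSet, inter_self]

theorem ae_mem_frontier {d : ℕ} (Ω : Set (E (d + 1))) :
    ∀ᵐ x ∂(surfaceMeasure Ω), x ∈ frontier Ω :=
  ae_restrict_mem isClosed_frontier.measurableSet

theorem integrable_surfaceMeasure_of_continuousOn {d : ℕ} {Ω : Set (E (d + 1))} (hΩo : IsOpen Ω)
    (hΩb : Bornology.IsBounded Ω) {α : ℝ} (hΩ : HasC1HolderBoundary α Ω) {f : E (d + 1) → ℝ}
    (hf : ContinuousOn f (frontier Ω)) : Integrable f (surfaceMeasure Ω) := by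
  have := isFiniteMeasure_surfaceMeasure hΩo hΩb hΩ
  rw [← surfaceMeasure_restrict_frontier]
  exact hf.integrableOn_compact (isCompact_frontier_of_isBounded hΩb)

theorem integrable_mul_inner_outerNormal {d : ℕ} {Ω : Set (E (d + 1))} (hΩo : IsOpen Ω)
    (hΩb : Bornology.IsBounded Ω) {α : ℝ} (hα : 0 < α) (hΩ : HasC1HolderBoundary α Ω)
    {g : E (d + 1) → ℝ} (hg : Continuous g) (e : E (d + 1)) :
    Integrable (fun x => g x * inner ℝ e (outerNormal Ω x)) (surfaceMeasure Ω) :=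
  integrable_surfaceMeasure_of_continuousOn hΩo hΩb hΩ
    (hg.continuousOn.mul (continuousOn_const.inner (continuousOn_outerNormal hΩo hΩb hα hΩ)))

theorem integrableOn_fderiv_apply {n : ℕ} {Ω : Set (E n)} (hΩb : Bornology.IsBounded Ω)
    {g : E n → ℝ} (hg : ContDiff ℝ 1 g) (e : E n) :
    IntegrableOn (fun x => fderiv ℝ g x e) Ω :=
  ((((hg.continuous_fderiv one_ne_zero).clm_apply continuous_const).continuousOn).integrableOn_compact
    hΩb.isCompact_closure).mono_set subset_closure

/-- The divergence theorem for functions with support in a small ball. -/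
theorem exists_setIntegral_fderiv_of_tsupport_subset_ball {d : ℕ} {Ω : Set (E (d + 1))}
    (hΩo : IsOpen Ω) {α : ℝ} (hΩ : HasC1HolderBoundary α Ω) {x : E (d + 1)} (hx : x ∈ closure Ω) :
    ∃ r > 0, ∀ g : E (d + 1) → ℝ, ContDiff ℝ 1 g → tsupport g ⊆ Metric.ball x r →
      ∀ e, ∫ x in Ω, fderiv ℝ g x e =
        ∫ x, g x * inner ℝ e (outerNormal Ω x) ∂(surfaceMeasure Ω) := by
  by_cases hxΩ : x ∈ Ω
  · obtain ⟨r, hr, hrΩ⟩ := Metric.isOpen_iff.1 hΩo x hxΩ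
    refine ⟨r, hr, fun g hg hgs e => ?_⟩
    have hgc : HasCompactSupport g := HasCompactSupport.of_support_subset_isCompact
      (isCompact_closedBall x r)
      ((subset_tsupport g).trans (hgs.trans Metric.ball_subset_closedBall))
    have h1 : ∫ x in Ω, fderiv ℝ g x e = 0 := by
      rw [setIntegral_eq_integral_of_forall_compl_eq_zero,
        integral_fderiv_apply_eq_zero volume hg hgc]
      intro y hy
      have : fderiv ℝ g y = 0 := image_eq_zero_of_notMem_tsupport fun hy' =>
        hy (hrΩ (hgs (tsupport_fderiv_subset ℝ hy')))
      rw [this]; rfl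
    rw [h1, integral_eq_zero_of_ae]
    filter_upwards [ae_mem_frontier Ω] with y hy
    have : g y = 0 := image_eq_zero_of_notMem_tsupport fun hy' =>
      (hΩo.frontier_eq ▸ hy).2 (hrΩ (hgs hy'))
    simp [this]
  · have hxf : x ∈ frontier Ω := by rw [hΩo.frontier_eq]; exact ⟨hx, hxΩ⟩
    obtain ⟨T, φ, r, L, hr, hφ, -, h⟩ := hΩ x hxf
    exact ⟨r, hr, fun g hg hgs e => setIntegral_fderiv_of_chart hΩo hφ h hg hgs e⟩

/-- The divergence theorem on a bounded `C^{1,α}` domain. -/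
theorem setIntegral_fderiv_eq_integral_surfaceMeasure {d : ℕ} {Ω : Set (E (d + 1))}
    (hΩo : IsOpen Ω) (hΩb : Bornology.IsBounded Ω) {α : ℝ} (hα : 0 < α)
    (hΩ : HasC1HolderBoundary α Ω) {g : E (d + 1) → ℝ} (hg : ContDiff ℝ 1 g) (e : E (d + 1)) :
    ∫ x in Ω, fderiv ℝ g x e =
      ∫ x, g x * inner ℝ e (outerNormal Ω x) ∂(surfaceMeasure Ω) := by
  choose! r hr hloc using fun x hx =>
    exists_setIntegral_fderiv_of_tsupport_subset_ball hΩo hΩ (x := x) hx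
  have hball : ∀ x, ∃ b : ContDiffBump x, x ∈ closure Ω → b.rOut < r x := by
    intro x
    by_cases hx : x ∈ closure Ω
    · have := hr x hx
      exact ⟨⟨r x / 4, r x / 2, by linarith, by linarith⟩, fun _ => by simp; linarith⟩
    · exact ⟨⟨1, 2, one_pos, one_lt_two⟩, fun h => absurd h hx⟩
  choose b hb using hball
  obtain ⟨t, htΩ, ht⟩ := hΩb.isCompact_closure.elim_nhds_subcover
    (fun x => Metric.ball x (b x).rIn) fun x _ => Metric.ball_mem_nhds _ (b x).rIn_pos
  have hprod : ∀ s : Finset (E (d + 1)), ContDiff ℝ 1 fun y => ∏ x ∈ s, (1 - b x y) := fun s =>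
    contDiff_prod fun x _ => contDiff_const.sub (b x).contDiff
  -- the formula for `g` follows from the formula for `g` cut off near finitely many points
  have key : ∀ s : Finset (E (d + 1)), (∀ x ∈ s, x ∈ closure Ω) → ∀ g : E (d + 1) → ℝ,
      ContDiff ℝ 1 g →
      (∫ x in Ω, fderiv ℝ (fun y => g y * ∏ x ∈ s, (1 - b x y)) x e =
        ∫ x, (g x * ∏ z ∈ s, (1 - b z x)) * inner ℝ e (outerNormal Ω x) ∂(surfaceMeasure Ω)) →
      ∫ x in Ω, fderiv ℝ g x e =
        ∫ x, g x * inner ℝ e (outerNormal Ω x) ∂(surfaceMeasure Ω) := by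
    classical
    intro s
    induction s using Finset.induction_on with
    | empty => intro _ g _ h; simpa using h
    | insert z s hz ih =>
      intro hs g hg h
      have hg1 : ContDiff ℝ 1 fun y => g y * (1 - b z y) :=
        hg.mul (contDiff_const.sub (b z).contDiff)
      have hg2 : ContDiff ℝ 1 fun y => g y * b z y := hg.mul (b z).contDiff
      have h1 := ih (fun x hx => hs x (Finset.mem_insert_of_mem hx)) _ hg1 (by
        simp only [Finset.prod_insert hz, ← mul_assoc] at h
        exact h)
      have hzΩ := hs z (Finset.mem_insert_self z s)
      have h2 := hloc z hzΩ _ hg2 (by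
        refine (tsupport_mul_subset_right).trans ?_
        rw [(b z).tsupport_eq]
        exact Metric.closedBall_subset_ball (hb z hzΩ)) e
      have hsum : g = (fun y => g y * (1 - b z y)) + fun y => g y * b z y := by
        ext y; simp only [Pi.add_apply]; ring
      have hderiv : ∀ y, fderiv ℝ g y e = fderiv ℝ (fun y => g y * (1 - b z y)) y e +
          fderiv ℝ (fun y => g y * b z y) y e := by
        intro y
        conv_lhs => rw [hsum]
        rw [fderiv_add (hg1.differentiable one_ne_zero y) (hg2.differentiable one_ne_zero y)]
        rfl
      simp only [hderiv]
      rw [integral_add (integrableOn_fderiv_apply hΩb hg1 e) (integrableOn_fderiv_apply hΩb hg2 e),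
        h1, h2, ← integral_add
        (integrable_mul_inner_outerNormal hΩo hΩb hα hΩ hg1.continuous e)
        (integrable_mul_inner_outerNormal hΩo hΩb hα hΩ hg2.continuous e)]
      refine integral_congr_ae (Eventually.of_forall fun y => ?_)
      ring
  refine key t htΩ g hg ?_
  have hzero : ∀ y ∈ ⋃ x ∈ t, Metric.ball x (b x).rIn, g y * ∏ x ∈ t, (1 - b x y) = 0 := by
    intro y hy
    simp only [mem_iUnion] at hy
    obtain ⟨x, hx, hxy⟩ := hy
    rw [Finset.prod_eq_zero hx, mul_zero]
    rw [(b x).one_of_mem_closedBall (Metric.ball_subset_closedBall hxy), sub_self]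
  have hopen : IsOpen (⋃ x ∈ t, Metric.ball x (b x).rIn) :=
    isOpen_biUnion fun _ _ => Metric.isOpen_ball
  rw [setIntegral_eq_zero_of_forall_eq_zero, integral_eq_zero_of_ae]
  · filter_upwards [ae_mem_frontier Ω] with y hy
    rw [hzero y (ht (frontier_subset_closure hy)), zero_mul]; rfl
  · intro y hy
    have : (fun y => g y * ∏ x ∈ t, (1 - b x y)) =ᶠ[𝓝 y] fun _ => 0 :=
      Filter.mem_of_superset (hopen.mem_nhds (ht (subset_closure hy))) hzero
    rw [this.fderiv_eq]; simp

/-! ### The double layer potential of a constant -/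

/-- The flux through `∂Ω` of the smooth field `(y - x) (|y - x|² + ε²)^{-(d+1)/2}`, which
regularizes the gradient of the fundamental solution of the Laplacian. -/
theorem setIntegral_div_regularized {d : ℕ} {Ω : Set (E (d + 1))}
    (hΩo : IsOpen Ω) (hΩb : Bornology.IsBounded Ω) {α : ℝ} (hα : 0 < α)
    (hΩ : HasC1HolderBoundary α Ω) (x : E (d + 1)) {ε : ℝ} (hε : 0 < ε) :
    ∫ y in Ω, (d + 1) * ε ^ 2 * (‖y - x‖ ^ 2 + ε ^ 2) ^ (-((d : ℝ) + 1) / 2 - 1) =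
      ∫ y, (‖y - x‖ ^ 2 + ε ^ 2) ^ (-((d : ℝ) + 1) / 2) * inner ℝ (y - x) (outerNormal Ω y)
        ∂(surfaceMeasure Ω) := by
  set a : ℝ := -((d : ℝ) + 1) / 2 with ha
  have hpos : ∀ y, 0 < ‖y - x‖ ^ 2 + ε ^ 2 := fun y => by positivity
  set w : E (d + 1) → ℝ := fun y => (‖y - x‖ ^ 2 + ε ^ 2) ^ a with hw
  have hwd : ContDiff ℝ 1 w := by
    refine ContDiff.rpow_const_of_ne ?_ fun y => (hpos y).ne'
    exact ((contDiff_id.sub contDiff_const).norm_sq ℝ).add contDiff_const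
  have hwf : ∀ y v, fderiv ℝ w y v =
      a * (‖y - x‖ ^ 2 + ε ^ 2) ^ (a - 1) * (2 * inner ℝ (y - x) v) := by
    intro y v
    have h1 : HasFDerivAt (fun y : E (d + 1) => ‖y - x‖ ^ 2 + ε ^ 2) _ y :=
      (((hasFDerivAt_id y).sub_const x).norm_sq).add_const (ε ^ 2)
    have h2 := h1.rpow_const (p := a) (Or.inl (hpos y).ne')
    rw [hw, h2.fderiv]
    simp [← inner_sub_left]
  set bas := EuclideanSpace.basisFun (Fin (d + 1)) ℝ with hbas
  set g : Fin (d + 1) → E (d + 1) → ℝ := fun i y => inner ℝ (bas i) (y - x) * w y with hg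
  have hgd : ∀ i, ContDiff ℝ 1 (g i) := fun i =>
    (contDiff_const.inner ℝ (contDiff_id.sub contDiff_const)).mul hwd
  have hgf : ∀ i y, fderiv ℝ (g i) y (bas i) =
      w y + inner ℝ (bas i) (y - x) * fderiv ℝ w y (bas i) := by
    intro i y
    have h1 : HasFDerivAt (fun y => inner ℝ (bas i) (y - x)) (innerSL ℝ (bas i)) y :=
      ((innerSL ℝ (bas i)).hasFDerivAt (x := y - x)).comp (f := fun y => y - x) y
        ((hasFDerivAt_id y).sub_const x)
    have h2 := h1.mul (hwd.differentiable one_ne_zero y).hasFDerivAt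
    have h3 : fderiv ℝ (g i) y = _ := h2.fderiv
    rw [h3]
    simp [add_comm]
  have hsum : ∀ u v : E (d + 1), ∑ i, inner ℝ (bas i) u * inner ℝ (bas i) v = inner ℝ u v := by
    intro u v
    rw [← bas.sum_inner_mul_inner u v]
    exact Finset.sum_congr rfl fun i _ => by rw [real_inner_comm u]
  have hL : ∀ y, (d + 1) * ε ^ 2 * (‖y - x‖ ^ 2 + ε ^ 2) ^ (a - 1) =
      ∑ i, fderiv ℝ (g i) y (bas i) := by
    intro y
    have e1 : ∑ i, inner ℝ (bas i) (y - x) * inner ℝ (y - x) (bas i) = ‖y - x‖ ^ 2 := by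
      rw [← real_inner_self_eq_norm_sq, ← hsum]
      exact Finset.sum_congr rfl fun i _ => by rw [real_inner_comm (y - x)]
    have e2 : w y = (‖y - x‖ ^ 2 + ε ^ 2) * (‖y - x‖ ^ 2 + ε ^ 2) ^ (a - 1) := by
      rw [hw, mul_comm, ← Real.rpow_add_one (hpos y).ne']; ring_nf
    have e3 : ∑ i, fderiv ℝ (g i) y (bas i) = (d + 1) * w y +
        a * (‖y - x‖ ^ 2 + ε ^ 2) ^ (a - 1) * 2 *
          ∑ i, inner ℝ (bas i) (y - x) * inner ℝ (y - x) (bas i) := by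
      simp only [hgf, hwf, Finset.sum_add_distrib, Finset.mul_sum]
      congr 1
      · simp
      · exact Finset.sum_congr rfl fun i _ => by ring
    rw [e3, e1, e2, ha]
    ring
  have hR : ∀ y, w y * inner ℝ (y - x) (outerNormal Ω y) =
      ∑ i, g i y * inner ℝ (bas i) (outerNormal Ω y) := by
    intro y
    rw [← hsum, Finset.mul_sum]
    exact Finset.sum_congr rfl fun i _ => by simp only [hg]; ring
  simp only [hL]
  change _ = ∫ y, w y * inner ℝ (y - x) (outerNormal Ω y) ∂(surfaceMeasure Ω)
  simp only [hR]
  rw [integral_finsetSum _ fun i _ => integrableOn_fderiv_apply hΩb (hgd i) (bas i),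
    integral_finsetSum _ fun i _ =>
      integrable_mul_inner_outerNormal hΩo hΩb hα hΩ (hgd i).continuous (bas i)]
  exact Finset.sum_congr rfl fun i _ =>
    setIntegral_fderiv_eq_integral_surfaceMeasure hΩo hΩb hα hΩ (hgd i) (bas i)

theorem ae_inner_ne_zero {n : ℕ} {ν : E n} (hν : ν ≠ 0) : ∀ᵐ w : E n, inner ℝ w ν ≠ 0 := by
  have hne : (innerSL ℝ ν).ker ≠ ⊤ := by
    intro htop
    have : ν ∈ (innerSL ℝ ν).ker := htop ▸ Submodule.mem_top
    simp [hν] at this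
  have h0 := Measure.addHaar_submodule (volume : Measure (E n)) _ hne
  rw [ae_iff]
  convert h0 using 2
  ext w
  simp [real_inner_comm]

/-- Each side of a hyperplane through the origin carries half of the integral of an even function. -/
theorem integral_indicator_inner_neg {n : ℕ} {h : E n → ℝ} (hi : Integrable h)
    (heven : ∀ w, h (-w) = h w) {ν : E n} (hν : ν ≠ 0) :
    ∫ w, indicator {w | inner ℝ w ν < 0} h w = (∫ w, h w) / 2 := by
  have hc : Continuous fun w : E n => inner ℝ w ν := by fun_prop
  have m1 : MeasurableSet {w : E n | inner ℝ w ν < 0} := (isOpen_Iio.preimage hc).measurableSet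
  have m2 : MeasurableSet {w : E n | 0 < inner ℝ w ν} := (isOpen_Ioi.preimage hc).measurableSet
  have hswap : ∫ w, indicator {w | inner ℝ w ν < 0} h w =
      ∫ w, indicator {w | 0 < inner ℝ w ν} h w := by
    rw [← integral_neg_eq_self]
    refine integral_congr_ae (Eventually.of_forall fun w => ?_)
    simp [indicator, heven]
  have hnull := ae_inner_ne_zero hν
  have hadd : ∫ w, h w = (∫ w, indicator {w | inner ℝ w ν < 0} h w) +
      ∫ w, indicator {w | 0 < inner ℝ w ν} h w := by
    rw [← integral_add (hi.indicator m1) (hi.indicator m2)]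
    refine integral_congr_ae (hnull.mono fun w hw => ?_)
    rcases lt_or_gt_of_ne hw with h1 | h1
    · simp [indicator, h1, h1.le]
    · simp [indicator, h1, h1.le]
  rw [hadd, ← hswap]
  ring

/-- At a point with an outer normal, the dilations of `Ω` converge to a half space. -/
theorem tendsto_setIntegral_regularized {d : ℕ} {Ω : Set (E (d + 1))} (hΩo : IsOpen Ω)
    {x ν : E (d + 1)} (hν : IsOuterUnitNormal Ω x ν) :
    Tendsto (fun ε : ℝ => ∫ y in Ω,
        (d + 1) * ε ^ 2 * (‖y - x‖ ^ 2 + ε ^ 2) ^ (-((d : ℝ) + 1) / 2 - 1)) (𝓝[>] 0)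
      (𝓝 ((∫ w : E (d + 1), ((d : ℝ) + 1) * (1 + ‖w‖ ^ 2) ^ (-((d : ℝ) + 3) / 2)) / 2)) := by
  set h : E (d + 1) → ℝ := fun w => ((d : ℝ) + 1) * (1 + ‖w‖ ^ 2) ^ (-((d : ℝ) + 3) / 2) with hh
  have hi : Integrable h := by
    refine (integrable_rpow_neg_one_add_norm_sq (μ := (volume : Measure (E (d + 1)))) ?_).const_mul _
    simp
  have hν0 : ν ≠ 0 := norm_ne_zero_iff.1 (by rw [hν.1]; exact one_ne_zero)
  rw [← integral_indicator_inner_neg hi (fun w => by simp [hh]) hν0]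
  -- the dilation `y = x + ε w` turns the integrand into the fixed function `h`
  have hscale : ∀ ε : ℝ, 0 < ε →
      ∫ y in Ω, (d + 1) * ε ^ 2 * (‖y - x‖ ^ 2 + ε ^ 2) ^ (-((d : ℝ) + 1) / 2 - 1) =
        ∫ w, indicator {w | x + ε • w ∈ Ω} h w := by
    intro ε hε
    set F : E (d + 1) → ℝ := indicator Ω fun y =>
      (d + 1) * ε ^ 2 * (‖y - x‖ ^ 2 + ε ^ 2) ^ (-((d : ℝ) + 1) / 2 - 1) with hF
    have e1 : ∫ w, F (x + ε • w) = |(ε ^ (d + 1))⁻¹| * ∫ y, F y := by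
      have := Measure.integral_comp_smul (volume : Measure (E (d + 1))) (fun z => F (x + z)) ε
      rw [this, integral_add_left_eq_self F x]
      simp
    have e2 : ∀ w, F (x + ε • w) = (ε ^ (d + 1))⁻¹ * indicator {w | x + ε • w ∈ Ω} h w := by
      intro w
      by_cases hw : x + ε • w ∈ Ω
      · simp only [hF, indicator, hw, mem_ofPred_eq, if_true, hh, add_sub_cancel_left]
        have e3 : ‖ε • w‖ ^ 2 + ε ^ 2 = ε ^ 2 * (1 + ‖w‖ ^ 2) := by
          rw [norm_smul, Real.norm_of_nonneg hε.le]; ring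
        have e4 : (-((d : ℝ) + 1) / 2 - 1) = -((d : ℝ) + 3) / 2 := by ring
        have e5 : ε ^ 2 * (ε ^ 2) ^ (-((d : ℝ) + 3) / 2) = (ε ^ (d + 1))⁻¹ := by
          rw [← Real.rpow_natCast ε (d + 1), ← Real.rpow_neg hε.le, ← Real.rpow_natCast ε 2,
            ← Real.rpow_mul hε.le, ← Real.rpow_add hε]
          congr 1
          push_cast
          ring
        rw [e3, e4, Real.mul_rpow (by positivity) (by positivity), ← e5]
        ring
      · simp [hF, indicator, hw]
    have hεp : (0 : ℝ) < (ε ^ (d + 1))⁻¹ := by positivity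
    rw [← integral_indicator hΩo.measurableSet]
    simp only [e2, integral_const_mul, abs_of_pos hεp] at e1
    exact (mul_left_cancel₀ hεp.ne' e1).symm
  refine Tendsto.congr' (eventually_mem_nhdsWithin.mono fun ε hε => (hscale ε hε).symm) ?_
  refine tendsto_integral_filter_of_dominated_convergence (fun w => ‖h w‖) ?_ ?_ hi.norm ?_
  · refine Eventually.of_forall fun ε => hi.aestronglyMeasurable.indicator ?_
    exact (hΩo.preimage (by fun_prop : Continuous fun w => x + ε • w)).measurableSet
  · exact Eventually.of_forall fun ε => Eventually.of_forall fun w => norm_indicator_le_norm_self _ _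
  · -- off the tangent hyperplane, `x + ε w` is eventually inside or outside `Ω`, as `w` tells
    filter_upwards [ae_inner_ne_zero hν0] with w hw
    have hw0 : 0 < ‖w‖ := norm_pos_iff.2 (by rintro rfl; simp at hw)
    have ht : Tendsto (fun ε : ℝ => x + ε • w) (𝓝[>] 0) (𝓝 x) := by
      have : Continuous fun ε : ℝ => x + ε • w := by fun_prop
      simpa using (this.tendsto 0).mono_left nhdsWithin_le_nhds
    have hη : 0 < |inner ℝ w ν| / (2 * ‖w‖) := div_pos (abs_pos.2 hw) (by linarith)
    refine tendsto_const_nhds.congr' ?_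
    filter_upwards [ht.eventually (hν.2 _ hη), self_mem_nhdsWithin] with ε hε (hε0 : 0 < ε)
    have e1 : |inner ℝ w ν| / (2 * ‖w‖) * ‖ε • w‖ = ε * (|inner ℝ w ν| / 2) := by
      rw [norm_smul, Real.norm_of_nonneg hε0.le]; field_simp
    simp only [add_sub_cancel_left, real_inner_smul_left, e1] at hε
    rcases lt_or_gt_of_ne hw with h1 | h1
    · have : x + ε • w ∈ Ω := hε.1 (by rw [abs_of_neg h1]; nlinarith)
      simp [indicator, h1, this]
    · have : x + ε • w ∉ Ω := hε.2 (by rw [abs_of_pos h1]; nlinarith)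
      simp [indicator, h1.le, this]

/-- Gauss' lemma: the double layer potential of the constant `1` is constant on `∂Ω`. -/
theorem exists_integral_doubleLayer_eq {d : ℕ} {Ω : Set (E (d + 1))}
    (hΩo : IsOpen Ω) (hΩb : Bornology.IsBounded Ω) {α : ℝ} (hα : 0 < α)
    (hΩ : HasC1HolderBoundary α Ω) :
    ∃ c : ℝ, ∀ x ∈ frontier Ω,
      Integrable (fun y => inner ℝ (x - y) (outerNormal Ω y) / ‖x - y‖ ^ (d + 1))
        (surfaceMeasure Ω) →
      ∫ y, inner ℝ (x - y) (outerNormal Ω y) / ‖x - y‖ ^ (d + 1) ∂(surfaceMeasure Ω) = c := by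
  refine ⟨-((∫ w : E (d + 1), ((d : ℝ) + 1) * (1 + ‖w‖ ^ 2) ^ (-((d : ℝ) + 3) / 2)) / 2),
    fun x hx hi => ?_⟩
  have hlim := tendsto_setIntegral_regularized hΩo (isOuterUnitNormal_outerNormal hΩo hΩ hx)
  rw [← neg_eq_iff_eq_neg, ← integral_neg]
  refine (tendsto_nhds_unique hlim ?_).symm
  refine Tendsto.congr' (eventually_mem_nhdsWithin.mono fun ε hε =>
    (setIntegral_div_regularized hΩo hΩb hα hΩ x hε).symm) ?_
  -- the regularized kernels are dominated by the kernel itself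
  have hbase : ∀ (ε : ℝ) (y : E (d + 1)), y ≠ x →
      (‖y - x‖ ^ 2 + ε ^ 2) ^ (-((d : ℝ) + 1) / 2) ≤ (‖x - y‖ ^ (d + 1))⁻¹ := by
    intro ε y hy
    have hpos : 0 < ‖y - x‖ := norm_pos_iff.2 (sub_ne_zero.2 hy)
    have e1 : (‖x - y‖ ^ (d + 1))⁻¹ = (‖y - x‖ ^ 2) ^ (-((d : ℝ) + 1) / 2) := by
      rw [norm_sub_rev, ← Real.rpow_natCast _ (d + 1), ← Real.rpow_neg hpos.le,
        ← Real.rpow_natCast _ 2, ← Real.rpow_mul hpos.le]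
      congr 1
      push_cast
      ring
    rw [e1]
    refine Real.rpow_le_rpow_of_nonpos (by positivity) (by nlinarith [sq_nonneg ε]) ?_
    have : (0 : ℝ) ≤ d := d.cast_nonneg
    linarith
  refine tendsto_integral_filter_of_dominated_convergence
    (fun y => ‖inner ℝ (x - y) (outerNormal Ω y) / ‖x - y‖ ^ (d + 1)‖) ?_ ?_ hi.norm ?_
  · filter_upwards [self_mem_nhdsWithin] with ε (hε : 0 < ε)
    refine (integrable_surfaceMeasure_of_continuousOn hΩo hΩb hΩ ?_).aestronglyMeasurable
    refine ContinuousOn.mul (Continuous.continuousOn ?_)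
      ((by fun_prop : ContinuousOn (fun y => y - x) _).inner (continuousOn_outerNormal hΩo hΩb hα hΩ))
    exact (by fun_prop : Continuous fun y => ‖y - x‖ ^ 2 + ε ^ 2).rpow_const
      fun y => Or.inl (by positivity)
  · refine Eventually.of_forall fun ε => Eventually.of_forall fun y => ?_
    by_cases hy : y = x
    · simp [hy]
    have e : inner ℝ (y - x) (outerNormal Ω y) = -inner ℝ (x - y) (outerNormal Ω y) := by
      rw [← neg_sub x y, inner_neg_left]
    have h0 : 0 ≤ (‖y - x‖ ^ 2 + ε ^ 2) ^ (-((d : ℝ) + 1) / 2) :=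
      Real.rpow_nonneg (by positivity) _
    rw [e, norm_mul, norm_neg, norm_div, Real.norm_of_nonneg h0, norm_pow, norm_norm]
    exact (mul_le_mul_of_nonneg_right (hbase ε y hy) (norm_nonneg _)).trans_eq (inv_mul_eq_div _ _)
  · refine Eventually.of_forall fun y => ?_
    by_cases hy : y = x
    · simp [hy]
    have hpos : 0 < ‖y - x‖ := norm_pos_iff.2 (sub_ne_zero.2 hy)
    have hc : ContinuousAt (fun ε : ℝ => (‖y - x‖ ^ 2 + ε ^ 2) ^ (-((d : ℝ) + 1) / 2)) 0 :=
      (by fun_prop : ContinuousAt (fun ε : ℝ => ‖y - x‖ ^ 2 + ε ^ 2) 0).rpow_const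
        (Or.inl (by positivity))
    have hlim' := (hc.tendsto.mono_left (nhdsWithin_le_nhds (s := Ioi 0))).mul_const
      (inner ℝ (y - x) (outerNormal Ω y))
    convert hlim' using 2
    have e1 : (‖y - x‖ ^ 2 + (0 : ℝ) ^ 2) ^ (-((d : ℝ) + 1) / 2) = (‖x - y‖ ^ (d + 1))⁻¹ := by
      rw [norm_sub_rev x y, ← Real.rpow_natCast _ (d + 1), ← Real.rpow_neg hpos.le]
      rw [zero_pow two_ne_zero, add_zero, ← Real.rpow_natCast _ 2, ← Real.rpow_mul hpos.le]
      congr 1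
      push_cast
      ring
    rw [e1, ← neg_sub y x, inner_neg_left, norm_neg]
    ring

/-! ### Integrals of powers of the distance -/

/-- `σ` is upper Ahlfors regular of dimension `d`: balls of radius `ρ` have measure at most
`C ρ ^ d`. -/
def UpperRegular {X : Type*} [PseudoEMetricSpace X] [MeasurableSpace X] (σ : Measure X) (d : ℝ)
    (C : ℝ≥0) : Prop :=
  ∀ (x : X) (ρ : ℝ≥0∞), ρ ≠ 0 → ρ ≠ ∞ → σ {y | edist x y ≤ ρ} ≤ C * ρ ^ d

theorem ENNReal.exists_half_pow_near {r ρ : ℝ≥0∞} (hr : r ≠ 0) (hrρ : r ≤ ρ) (hρ : ρ ≠ ∞) :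
    ∃ j : ℕ, 2⁻¹ * (2⁻¹ ^ j * ρ) ≤ r ∧ r ≤ 2⁻¹ ^ j * ρ := by
  lift ρ to ℝ≥0 using hρ
  lift r to ℝ≥0 using (hrρ.trans_lt ENNReal.coe_lt_top).ne
  have hr0 : 0 < r := pos_iff_ne_zero.2 (by exact_mod_cast hr)
  have hrρ' : r ≤ ρ := by exact_mod_cast hrρ
  have hρ0 : 0 < ρ := hr0.trans_le hrρ'
  have hρ' : (0 : ℝ) < ρ := hρ0
  obtain ⟨j, h1, h2⟩ := exists_nat_pow_near_of_lt_one (x := (r / ρ : ℝ)) (y := 1 / 2)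
    (by positivity) (div_le_one_of_le₀ (by exact_mod_cast hrρ') (by positivity)) (by norm_num)
    (by norm_num)
  rw [lt_div_iff₀ hρ'] at h1
  rw [div_le_iff₀ hρ'] at h2
  refine ⟨j, ?_, ?_⟩
  · have : (2⁻¹ * (2⁻¹ ^ j * ρ) : ℝ≥0) ≤ r := by
      rw [← NNReal.coe_le_coe]; push_cast
      rw [pow_succ, one_div] at h1
      linarith
    simpa only [ENNReal.coe_mul, ENNReal.coe_pow, ENNReal.coe_inv two_ne_zero, ENNReal.coe_ofNat]
      using ENNReal.coe_le_coe.2 this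
  · have : r ≤ (2⁻¹ ^ j * ρ : ℝ≥0) := by
      rw [← NNReal.coe_le_coe]; push_cast
      rwa [one_div] at h2
    simpa only [ENNReal.coe_mul, ENNReal.coe_pow, ENNReal.coe_inv two_ne_zero, ENNReal.coe_ofNat]
      using ENNReal.coe_le_coe.2 this

theorem ENNReal.exists_two_pow_near {r ρ : ℝ≥0∞} (hρ : ρ ≠ 0) (hrρ : ρ ≤ r) (hr : r ≠ ∞) :
    ∃ j : ℕ, 2 ^ j * ρ ≤ r ∧ r ≤ 2 * (2 ^ j * ρ) := by
  lift r to ℝ≥0 using hr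
  lift ρ to ℝ≥0 using (hrρ.trans_lt ENNReal.coe_lt_top).ne
  have hρ0 : 0 < ρ := pos_iff_ne_zero.2 (by exact_mod_cast hρ)
  have hρ' : (0 : ℝ) < ρ := hρ0
  have hrρ' : ρ ≤ r := by exact_mod_cast hrρ
  obtain ⟨j, h1, h2⟩ := exists_nat_pow_near (x := (r / ρ : ℝ)) (y := 2)
    ((one_le_div hρ').2 (by exact_mod_cast hrρ')) (by norm_num)
  rw [le_div_iff₀ hρ'] at h1
  rw [div_lt_iff₀ hρ'] at h2
  refine ⟨j, ?_, ?_⟩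
  · have : (2 ^ j * ρ : ℝ≥0) ≤ r := by
      rw [← NNReal.coe_le_coe]; push_cast; exact h1
    exact_mod_cast ENNReal.coe_le_coe.2 this
  · have : r ≤ (2 * (2 ^ j * ρ) : ℝ≥0) := by
      rw [← NNReal.coe_le_coe]; push_cast
      rw [pow_succ] at h2
      linarith
    exact_mod_cast ENNReal.coe_le_coe.2 this

theorem ENNReal.exists_tsum_pow_eq {q : ℝ≥0∞} (hq : q < 1) :
    ∃ K : ℝ≥0, ∑' j : ℕ, q ^ j = K := by
  rw [ENNReal.tsum_geometric]
  refine ⟨((1 - q)⁻¹).toNNReal, (ENNReal.coe_toNNReal ?_).symm⟩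
  rw [ENNReal.inv_ne_top]
  exact (tsub_pos_of_lt hq).ne'

theorem ENNReal.rpow_le_rpow_of_exponent_nonpos {a b : ℝ≥0∞} {p : ℝ} (h : a ≤ b) (hp : p ≤ 0) :
    b ^ p ≤ a ^ p := by
  rw [← neg_neg p, ENNReal.rpow_neg, ENNReal.rpow_neg a]
  exact ENNReal.inv_le_inv.2 (ENNReal.rpow_le_rpow h (by linarith))

theorem UpperRegular.measure_singleton {X : Type*} [MetricSpace X] [MeasurableSpace X]
    {σ : Measure X} {d : ℝ} {C : ℝ≥0} (hσ : UpperRegular σ d C) (hd : 0 < d) (x : X) :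
    σ {x} = 0 := by
  have ht : Tendsto (fun ρ : ℝ≥0∞ => (C : ℝ≥0∞) * ρ ^ d) (𝓝[>] 0) (𝓝 (C * 0 ^ d)) := by
    refine ENNReal.Tendsto.const_mul ?_ (Or.inr ENNReal.coe_ne_top)
    exact ((ENNReal.continuous_rpow_const).tendsto 0).mono_left nhdsWithin_le_nhds
  rw [ENNReal.zero_rpow_of_pos hd, mul_zero] at ht
  refine le_antisymm (ge_of_tendsto ht ?_) zero_le
  have h1 : ∀ᶠ ρ : ℝ≥0∞ in 𝓝[>] 0, ρ < 1 := nhdsWithin_le_nhds (Iio_mem_nhds one_pos)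
  filter_upwards [h1, self_mem_nhdsWithin] with ρ hρ hρ0
  refine (measure_mono ?_).trans (hσ x ρ (ne_of_gt hρ0) (hρ.trans ENNReal.one_lt_top).ne)
  rintro y rfl
  simp

theorem UpperRegular.ae_ne {X : Type*} [MetricSpace X] [MeasurableSpace X] {σ : Measure X}
    {d : ℝ} {C : ℝ≥0} (hσ : UpperRegular σ d C) (hd : 0 < d) (x : X) :
    ∀ᵐ y ∂σ, edist x y ≠ 0 := by
  rw [ae_iff]
  convert hσ.measure_singleton hd x using 2
  ext y
  simp [eq_comm]

section UpperRegular

variable {X : Type*} [MetricSpace X] [SecondCountableTopology X] [MeasurableSpace X]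
  [BorelSpace X] {σ : Measure X} {d : ℝ}
  {C : ℝ≥0}

theorem measurableSet_edist_le (x : X) (ρ : ℝ≥0∞) : MeasurableSet {y | edist x y ≤ ρ} :=
  measurableSet_le (measurable_const.edist measurable_id) measurable_const

/-- Integral of a power of the distance with exponent above `-d`, near the singularity, by
decomposition into dyadic shells. -/
theorem UpperRegular.exists_lintegral_near_le (hσ : UpperRegular σ d C) (hd : 0 < d) {b : ℝ}
    (hb : 0 < b) : ∃ K : ℝ≥0, ∀ (x : X) (ρ : ℝ≥0∞), ρ ≠ 0 → ρ ≠ ∞ →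
      ∫⁻ y in {y | edist x y ≤ ρ}, edist x y ^ (b - d) ∂σ ≤ K * ρ ^ b := by
  obtain ⟨K, hK⟩ := ENNReal.exists_tsum_pow_eq (q := (2⁻¹ : ℝ≥0∞) ^ b)
    (ENNReal.rpow_lt_one (by simp) hb)
  refine ⟨C * 2 ^ d * K, fun x ρ hρ0 hρ => ?_⟩
  set s : ℕ → ℝ≥0∞ := fun j => 2⁻¹ ^ j * ρ with hs
  have hs0 : ∀ j, s j ≠ 0 := fun j => mul_ne_zero (pow_ne_zero _ (by simp)) hρ0
  have hsT : ∀ j, s j ≠ ∞ := fun j => ENNReal.mul_ne_top (ENNReal.pow_ne_top (by simp)) hρ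
  set c : ℕ → ℝ≥0∞ := fun j => s j ^ b * ((2⁻¹ * s j) ^ d)⁻¹
  have hpt : ∀ᵐ y ∂σ, y ∈ {y | edist x y ≤ ρ} → edist x y ^ (b - d) ≤
      ∑' j, indicator {y | edist x y ≤ s j} (fun _ => c j) y := by
    filter_upwards [hσ.ae_ne hd x] with y hy hyρ
    obtain ⟨j, h1, h2⟩ := ENNReal.exists_half_pow_near hy hyρ hρ
    refine le_trans ?_ (ENNReal.le_tsum j)
    rw [indicator_of_mem (by exact h2), ENNReal.rpow_sub _ _ hy (edist_ne_top x y), div_eq_mul_inv]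
    exact mul_le_mul' (ENNReal.rpow_le_rpow h2 hb.le)
      (ENNReal.inv_le_inv.2 (ENNReal.rpow_le_rpow h1 hd.le))
  have hterm : ∀ j, c j * (C * s j ^ d) = C * 2 ^ d * ρ ^ b * (2⁻¹ ^ b) ^ j := by
    intro j
    have e1 : ((2⁻¹ * s j) ^ d)⁻¹ * s j ^ d = 2 ^ d := by
      rw [ENNReal.mul_rpow_of_nonneg _ _ hd.le, ENNReal.inv_rpow,
        ENNReal.mul_inv (Or.inl (ENNReal.inv_ne_zero.2 (by simp)))
          (Or.inl (ENNReal.inv_ne_top.2 (by simp))), inv_inv, mul_assoc,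
        ENNReal.inv_mul_cancel, mul_one]
      · simp [ENNReal.rpow_eq_zero_iff, hs0 j, hsT j]
      · exact ENNReal.rpow_ne_top_of_nonneg hd.le (hsT j)
    have e2 : s j ^ b = (2⁻¹ ^ b) ^ j * ρ ^ b := by
      rw [hs, ENNReal.mul_rpow_of_nonneg _ _ hb.le, ← ENNReal.rpow_natCast, ← ENNReal.rpow_natCast,
        ← ENNReal.rpow_mul, ← ENNReal.rpow_mul, mul_comm b]
    calc c j * (C * s j ^ d) = C * (((2⁻¹ * s j) ^ d)⁻¹ * s j ^ d) * s j ^ b := by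
          simp only [c]; ring
      _ = _ := by rw [e1, e2]; ring
  calc ∫⁻ y in {y | edist x y ≤ ρ}, edist x y ^ (b - d) ∂σ
      ≤ ∫⁻ y in {y | edist x y ≤ ρ}, ∑' j, indicator {y | edist x y ≤ s j} (fun _ => c j) y ∂σ :=
        setLIntegral_mono_ae' (measurableSet_edist_le x ρ) hpt
    _ ≤ ∫⁻ y, ∑' j, indicator {y | edist x y ≤ s j} (fun _ => c j) y ∂σ := setLIntegral_le_lintegral _ _
    _ = ∑' j, c j * σ {y | edist x y ≤ s j} := by
        rw [lintegral_tsum fun j =>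
          (measurable_const.indicator (measurableSet_edist_le x _)).aemeasurable]
        congr 1; ext j
        rw [lintegral_indicator_const (measurableSet_edist_le x _)]
    _ ≤ ∑' j, c j * (C * s j ^ d) := ENNReal.tsum_le_tsum fun j => by
        gcongr; exact hσ x _ (hs0 j) (hsT j)
    _ = _ := by
        simp only [hterm]
        rw [ENNReal.tsum_mul_left, hK]
        push_cast
        rw [ENNReal.coe_rpow_of_nonneg _ hd.le]
        push_cast
        ring

/-- Integral of a power of the distance with exponent below `-d`, away from the singularity. -/
theorem UpperRegular.exists_lintegral_far_le (hσ : UpperRegular σ d C) (hd : 0 < d) {b : ℝ}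
    (hb : 0 < b) : ∃ K : ℝ≥0, ∀ (x : X) (ρ : ℝ≥0∞), ρ ≠ 0 → ρ ≠ ∞ →
      ∫⁻ y in {y | ρ ≤ edist x y}, edist x y ^ (-b - d) ∂σ ≤ K * ρ ^ (-b) := by
  have h2b : (1 : ℝ≥0∞) < 2 ^ b := ENNReal.one_lt_rpow (by norm_num) hb
  obtain ⟨K, hK⟩ := ENNReal.exists_tsum_pow_eq (q := ((2 : ℝ≥0∞) ^ b)⁻¹)
    (ENNReal.inv_lt_one.2 h2b)
  refine ⟨C * 2 ^ d * K, fun x ρ hρ0 hρ => ?_⟩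
  set s : ℕ → ℝ≥0∞ := fun j => 2 ^ j * ρ with hs
  have hs0 : ∀ j, s j ≠ 0 := fun j => mul_ne_zero (pow_ne_zero _ (by simp)) hρ0
  have hsT : ∀ j, s j ≠ ∞ := fun j => ENNReal.mul_ne_top (ENNReal.pow_ne_top (by simp)) hρ
  set c : ℕ → ℝ≥0∞ := fun j => s j ^ (-b - d)
  have hm : MeasurableSet {y | ρ ≤ edist x y} :=
    measurableSet_le measurable_const (measurable_const.edist measurable_id)
  have hpt : ∀ y ∈ {y | ρ ≤ edist x y}, edist x y ^ (-b - d) ≤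
      ∑' j, indicator {y | edist x y ≤ 2 * s j} (fun _ => c j) y := by
    intro y hyρ
    obtain ⟨j, h1, h2⟩ := ENNReal.exists_two_pow_near hρ0 hyρ (edist_ne_top x y)
    refine le_trans ?_ (ENNReal.le_tsum j)
    rw [indicator_of_mem (by exact h2)]
    exact ENNReal.rpow_le_rpow_of_exponent_nonpos h1 (by linarith)
  have hterm : ∀ j, c j * (C * (2 * s j) ^ d) = C * 2 ^ d * ρ ^ (-b) * ((2 ^ b)⁻¹) ^ j := by
    intro j
    have e1 : s j ^ (-b - d) * s j ^ d = s j ^ (-b) := by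
      rw [← ENNReal.rpow_add _ _ (hs0 j) (hsT j)]; ring_nf
    have e2 : s j ^ (-b) = ((2 ^ b)⁻¹) ^ j * ρ ^ (-b) := by
      rw [hs, ENNReal.mul_rpow_of_ne_zero (pow_ne_zero _ (by simp)) hρ0, ← ENNReal.rpow_natCast,
        ← ENNReal.rpow_natCast, ← ENNReal.rpow_neg, ← ENNReal.rpow_mul, ← ENNReal.rpow_mul,
        mul_comm (-b)]
    calc c j * (C * (2 * s j) ^ d) = C * 2 ^ d * (s j ^ (-b - d) * s j ^ d) := by
          rw [ENNReal.mul_rpow_of_nonneg _ _ hd.le]; ring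
      _ = _ := by rw [e1, e2]; ring
  calc ∫⁻ y in {y | ρ ≤ edist x y}, edist x y ^ (-b - d) ∂σ
      ≤ ∫⁻ y in {y | ρ ≤ edist x y}, ∑' j, indicator {y | edist x y ≤ 2 * s j} (fun _ => c j) y ∂σ :=
        setLIntegral_mono' hm hpt
    _ ≤ ∫⁻ y, ∑' j, indicator {y | edist x y ≤ 2 * s j} (fun _ => c j) y ∂σ :=
        setLIntegral_le_lintegral _ _
    _ = ∑' j, c j * σ {y | edist x y ≤ 2 * s j} := by
        rw [lintegral_tsum fun j =>
          (measurable_const.indicator (measurableSet_edist_le x _)).aemeasurable]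
        congr 1; ext j
        rw [lintegral_indicator_const (measurableSet_edist_le x _)]
    _ ≤ ∑' j, c j * (C * (2 * s j) ^ d) := ENNReal.tsum_le_tsum fun j => by
        gcongr
        exact hσ x _ (mul_ne_zero two_ne_zero (hs0 j)) (ENNReal.mul_ne_top (by simp) (hsT j))
    _ = _ := by
        simp only [hterm]
        rw [ENNReal.tsum_mul_left, hK]
        push_cast
        rw [ENNReal.coe_rpow_of_nonneg _ hd.le]
        push_cast
        ring

theorem UpperRegular.exists_lintegral_le [IsFiniteMeasure σ] (hσ : UpperRegular σ d C)
    (hd : 0 < d) {b : ℝ} (hb : 0 < b) (hbounded : ∃ R : ℝ≥0, ∀ᵐ x ∂σ, ∀ᵐ y ∂σ, edist x y ≤ R) :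
    ∃ K : ℝ≥0, ∀ᵐ x ∂σ, ∫⁻ y, edist x y ^ (b - d) ∂σ ≤ K := by
  obtain ⟨R, hR⟩ := hbounded
  obtain ⟨K, hK⟩ := hσ.exists_lintegral_near_le hd hb
  refine ⟨K * (R + 1) ^ b, hR.mono fun x hx => ?_⟩
  have h := hK x (R + 1) (by simp) (by simp)
  have : ∫⁻ y, edist x y ^ (b - d) ∂σ = ∫⁻ y in {y | edist x y ≤ R + 1}, edist x y ^ (b - d) ∂σ := by
    rw [Measure.restrict_eq_self_of_ae_mem]
    exact hx.mono fun y hy => hy.trans le_self_add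
  rw [this]
  refine h.trans_eq ?_
  push_cast
  rw [ENNReal.coe_rpow_of_nonneg _ hb.le]
  push_cast
  rfl

end UpperRegular

/-! ### A weighted Schur test -/

theorem ENNReal.lintegral_mul_sq_le {X : Type*} [MeasurableSpace X] (μ : Measure X)
    {f g : X → ℝ≥0∞} (hf : AEMeasurable f μ) (hg : AEMeasurable g μ) :
    (∫⁻ x, f x * g x ∂μ) ^ 2 ≤ (∫⁻ x, f x ^ 2 ∂μ) * ∫⁻ x, g x ^ 2 ∂μ := by
  have h := ENNReal.lintegral_mul_le_Lp_mul_Lq μ Real.HolderConjugate.two_two hf hg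
  have e : ∀ a : ℝ≥0∞, (a ^ (1 / 2 : ℝ)) ^ 2 = a := by
    intro a
    rw [← ENNReal.rpow_natCast, ← ENNReal.rpow_mul]; norm_num
  have h2 := pow_le_pow_left' h 2
  rw [mul_pow, e, e] at h2
  simpa using h2

/-- A weighted Schur test: the kernel is split as `f * g`, and the Cauchy–Schwarz inequality with
respect to `y` moves `f` into the weight `m`. -/
theorem lintegral_mul_sq_lintegral_le {X Y : Type*} [MeasurableSpace X] [MeasurableSpace Y]
    {μ : Measure X} {ν : Measure Y} [SFinite μ] [SFinite ν] {k f g : X → Y → ℝ≥0∞}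
    {u m : X → ℝ≥0∞} {v ψ : Y → ℝ≥0∞} {A B : ℝ≥0}
    (hf : Measurable (Function.uncurry f)) (hg : Measurable (Function.uncurry g))
    (hu : Measurable u) (hm : Measurable m) (hψ : Measurable ψ)
    (hk : ∀ᵐ x ∂μ, ∀ᵐ y ∂ν, k x y ≤ f x y * g x y)
    (hA : ∀ᵐ x ∂μ, ∫⁻ y, f x y ^ 2 ∂ν ≤ A * m x)
    (hB : ∀ᵐ y ∂ν, ∫⁻ x, u x * m x * g x y ^ 2 ∂μ ≤ B * v y) :
    ∫⁻ x, u x * (∫⁻ y, k x y * ψ y ∂ν) ^ 2 ∂μ ≤ A * B * ∫⁻ y, v y * ψ y ^ 2 ∂ν := by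
  have hfx : ∀ x, Measurable (f x) := fun x => hf.comp measurable_prodMk_left
  have hgx : ∀ x, Measurable (g x) := fun x => hg.comp measurable_prodMk_left
  have hgm : Measurable fun q : X × Y => g q.1 q.2 := hg
  calc ∫⁻ x, u x * (∫⁻ y, k x y * ψ y ∂ν) ^ 2 ∂μ
      ≤ ∫⁻ x, A * ∫⁻ y, u x * m x * g x y ^ 2 * ψ y ^ 2 ∂ν ∂μ := by
        refine lintegral_mono_ae ?_
        filter_upwards [hk, hA] with x hkx hAx
        have h1 : ∫⁻ y, k x y * ψ y ∂ν ≤ ∫⁻ y, f x y * (g x y * ψ y) ∂ν := by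
          refine lintegral_mono_ae (hkx.mono fun y hy => ?_)
          rw [← mul_assoc]
          gcongr
        have h2 := (pow_le_pow_left' h1 2).trans (ENNReal.lintegral_mul_sq_le ν
          (hfx x).aemeasurable ((hgx x).mul hψ).aemeasurable)
        have h3 : ∫⁻ y, u x * m x * g x y ^ 2 * ψ y ^ 2 ∂ν =
            u x * m x * ∫⁻ y, (g x y * ψ y) ^ 2 ∂ν := by
          rw [← lintegral_const_mul (u x * m x)
            (by have := hgx x; fun_prop : Measurable fun y => (g x y * ψ y) ^ 2)]
          congr 1; ext y; ring
        rw [h3]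
        calc u x * (∫⁻ y, k x y * ψ y ∂ν) ^ 2
            ≤ u x * ((A * m x) * ∫⁻ y, (g x y * ψ y) ^ 2 ∂ν) := by
              gcongr; exact h2.trans (by gcongr)
          _ = _ := by ring
    _ = A * ∫⁻ y, ∫⁻ x, u x * m x * g x y ^ 2 * ψ y ^ 2 ∂μ ∂ν := by
        rw [lintegral_const_mul' _ _ ENNReal.coe_ne_top, lintegral_lintegral_swap]
        have hu' : Measurable fun q : X × Y => u q.1 := hu.comp measurable_fst
        have hm' : Measurable fun q : X × Y => m q.1 := hm.comp measurable_fst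
        have hψ' : Measurable fun q : X × Y => ψ q.2 := hψ.comp measurable_snd
        exact (((hu'.mul hm').mul (hgm.pow_const 2)).mul (hψ'.pow_const 2)).aemeasurable
    _ ≤ A * ∫⁻ y, B * (v y * ψ y ^ 2) ∂ν := by
        refine mul_le_mul_right (lintegral_mono_ae (hB.mono fun y hy => ?_)) _
        rw [lintegral_mul_const]
        · calc _ ≤ B * v y * ψ y ^ 2 := by gcongr
            _ = _ := by ring
        · exact (hu.mul hm).mul ((hgm.comp measurable_prodMk_right).pow_const 2)
    _ = _ := by rw [lintegral_const_mul' _ _ ENNReal.coe_ne_top, mul_assoc]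

/-! ### Near and far parts -/

/-- The kernel `|x - y| ^ p` restricted to `|x - y| ≤ 3 |x - z|`. -/
noncomputable def nearKernel {X : Type*} [EDist X] (p : ℝ) (x z y : X) : ℝ≥0∞ :=
  if edist x y ≤ 3 * edist x z then edist x y ^ p else 0

/-- The kernel `|x - y| ^ p` restricted to `2 |x - z| ≤ |x - y|`. -/
noncomputable def farKernel {X : Type*} [EDist X] (p : ℝ) (x z y : X) : ℝ≥0∞ :=
  if 2 * edist x z ≤ edist x y then edist x y ^ p else 0

theorem ENNReal.rpow_half_sq (a : ℝ≥0∞) (p : ℝ) : (a ^ (p / 2)) ^ 2 = a ^ p := by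
  rw [← ENNReal.rpow_natCast, ← ENNReal.rpow_mul]; norm_num

theorem nearKernel_half_sq {X : Type*} [EDist X] (p : ℝ) (x z y : X) :
    nearKernel (p / 2) x z y ^ 2 = nearKernel p x z y := by
  simp only [nearKernel]
  split_ifs
  · exact ENNReal.rpow_half_sq _ _
  · simp

theorem farKernel_half_sq {X : Type*} [EDist X] (p : ℝ) (x z y : X) :
    farKernel (p / 2) x z y ^ 2 = farKernel p x z y := by
  simp only [farKernel]
  split_ifs
  · exact ENNReal.rpow_half_sq _ _
  · simp

section NearFar

variable {X : Type*} [MetricSpace X] [SecondCountableTopology X] [MeasurableSpace X]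
  [BorelSpace X]

@[fun_prop]
theorem Measurable.nearKernel {Y : Type*} [MeasurableSpace Y] {a b c : Y → X} {p : ℝ}
    (ha : Measurable a) (hb : Measurable b) (hc : Measurable c) :
    Measurable fun q => nearKernel p (a q) (b q) (c q) :=
  Measurable.ite (measurableSet_le (ha.edist hc) ((ha.edist hb).const_mul 3))
    ((ha.edist hc).pow_const p) measurable_const

@[fun_prop]
theorem Measurable.farKernel {Y : Type*} [MeasurableSpace Y] {a b c : Y → X} {p : ℝ}
    (ha : Measurable a) (hb : Measurable b) (hc : Measurable c) :
    Measurable fun q => farKernel p (a q) (b q) (c q) :=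
  Measurable.ite (measurableSet_le ((ha.edist hb).const_mul 2) (ha.edist hc))
    ((ha.edist hc).pow_const p) measurable_const

variable {σ : Measure X} {d : ℝ} {C : ℝ≥0}

theorem UpperRegular.exists_lintegral_nearKernel_le (hσ : UpperRegular σ d C) (hd : 0 < d) {b : ℝ}
    (hb : 0 < b) : ∃ K : ℝ≥0, ∀ x z : X, edist x z ≠ 0 →
      ∫⁻ y, nearKernel (b - d) x z y ∂σ ≤ K * edist x z ^ b := by
  obtain ⟨K, hK⟩ := hσ.exists_lintegral_near_le hd hb
  refine ⟨K * 3 ^ b, fun x z hxz => ?_⟩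
  have e : ∫⁻ y, nearKernel (b - d) x z y ∂σ =
      ∫⁻ y in {y | edist x y ≤ 3 * edist x z}, edist x y ^ (b - d) ∂σ := by
    rw [← lintegral_indicator (measurableSet_edist_le x _)]
    simp only [nearKernel, indicator, mem_ofPred_eq]
  rw [e]
  refine (hK x _ (mul_ne_zero (by simp) hxz)
    (ENNReal.mul_ne_top (by simp) (edist_ne_top x z))).trans_eq ?_
  rw [ENNReal.mul_rpow_of_nonneg _ _ hb.le, ENNReal.coe_mul, ENNReal.coe_rpow_of_nonneg _ hb.le,
    mul_assoc]
  rfl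

theorem UpperRegular.exists_lintegral_farKernel_le (hσ : UpperRegular σ d C) (hd : 0 < d) {b : ℝ}
    (hb : 0 < b) : ∃ K : ℝ≥0, ∀ x z : X, edist x z ≠ 0 →
      ∫⁻ y, farKernel (-b - d) x z y ∂σ ≤ K * edist x z ^ (-b) := by
  obtain ⟨K, hK⟩ := hσ.exists_lintegral_far_le hd hb
  refine ⟨K * 2 ^ (-b), fun x z hxz => ?_⟩
  have hm : MeasurableSet {y | 2 * edist x z ≤ edist x y} :=
    measurableSet_le measurable_const (measurable_const.edist measurable_id)
  have e : ∫⁻ y, farKernel (-b - d) x z y ∂σ =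
      ∫⁻ y in {y | 2 * edist x z ≤ edist x y}, edist x y ^ (-b - d) ∂σ := by
    rw [← lintegral_indicator hm]
    simp only [farKernel, indicator, mem_ofPred_eq]
  rw [e]
  refine (hK x _ (mul_ne_zero (by simp) hxz)
    (ENNReal.mul_ne_top (by simp) (edist_ne_top x z))).trans_eq ?_
  rw [ENNReal.mul_rpow_of_ne_zero (by simp) hxz, ENNReal.coe_mul,
    ENNReal.coe_rpow_of_ne_zero two_ne_zero, mul_assoc]
  rfl

/-- A Hardy inequality for the near part, at a fixed base point. -/
theorem UpperRegular.exists_hardy_near (hσ : UpperRegular σ d C) [SFinite σ] (hd : 0 < d)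
    (α : ℝ) {t : ℝ} (ht : 0 < t) : ∃ K : ℝ≥0, ∀ (x : X) (ψ : X → ℝ≥0∞), Measurable ψ →
      ∫⁻ z, edist x z ^ (-2 * t - d) * (∫⁻ y, nearKernel (α - d) x z y * ψ y ∂σ) ^ 2 ∂σ ≤
        K * ∫⁻ y, edist x y ^ (2 * α - 2 * t - d) * ψ y ^ 2 ∂σ := by
  obtain ⟨A, hA⟩ := hσ.exists_lintegral_nearKernel_le hd ht
  obtain ⟨B, hB⟩ := hσ.exists_lintegral_far_le hd ht
  refine ⟨A * (B * 3 ^ t), fun x ψ hψ => ?_⟩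
  rw [ENNReal.coe_mul]
  -- Schur's test with the splitting `|x - y|^{α - d} = |x - y|^{(t - d)/2} |x - y|^{(2α - t - d)/2}`;
  -- the first factor is square integrable in `y` near `x`, the second leaves `|x - z|^{-t - d}`,
  -- which is integrable in `z` away from `x`
  refine lintegral_mul_sq_lintegral_le (m := fun z => edist x z ^ t)
    (f := fun z y => nearKernel ((t - d) / 2) x z y)
    (g := fun z y => nearKernel ((2 * α - t - d) / 2) x z y)
    (by fun_prop) (by fun_prop) (by fun_prop) (by fun_prop) hψ ?_ ?_ ?_
  · filter_upwards with z
    filter_upwards [hσ.ae_ne hd x] with y hy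
    simp only [nearKernel]
    split_ifs
    · rw [← ENNReal.rpow_add _ _ hy (edist_ne_top x y)]
      ring_nf; rfl
    · simp
  · filter_upwards [hσ.ae_ne hd x] with z hz
    simp only [nearKernel_half_sq]
    exact hA x z hz
  · filter_upwards [hσ.ae_ne hd x] with y hy
    have h3 : (3 : ℝ≥0∞)⁻¹ * edist x y ≠ 0 := mul_ne_zero (by simp) hy
    have hm : MeasurableSet {z | 3⁻¹ * edist x y ≤ edist x z} :=
      measurableSet_le measurable_const (measurable_const.edist measurable_id)
    have e : ∀ᵐ z ∂σ, edist x z ^ (-2 * t - d) * edist x z ^ t *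
        nearKernel ((2 * α - t - d) / 2) x z y ^ 2 =
        indicator {z | 3⁻¹ * edist x y ≤ edist x z} (fun z => edist x z ^ (-t - d)) z *
          edist x y ^ (2 * α - t - d) := by
      filter_upwards [hσ.ae_ne hd x] with z hz
      rw [nearKernel_half_sq, ← ENNReal.rpow_add _ _ hz (edist_ne_top x z)]
      have hiff : 3⁻¹ * edist x y ≤ edist x z ↔ edist x y ≤ 3 * edist x z := by
        rw [ENNReal.inv_mul_le_iff (by simp) (by simp)]
      simp only [indicator, mem_ofPred_eq, hiff, nearKernel]
      split_ifs
      · congr 2; ring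
      · simp
    rw [lintegral_congr_ae e, lintegral_mul_const _ ((by fun_prop : Measurable fun z =>
      edist x z ^ (-t - d)).indicator hm), lintegral_indicator hm]
    have := hB x _ h3 (ENNReal.mul_ne_top (by simp) (edist_ne_top x y))
    refine (mul_le_mul_left this _).trans_eq ?_
    rw [ENNReal.mul_rpow_of_ne_zero (by simp) hy, ENNReal.coe_mul,
      ENNReal.coe_rpow_of_nonneg _ ht.le, ENNReal.inv_rpow, ← ENNReal.rpow_neg, neg_neg]
    have e2 : edist x y ^ (2 * α - 2 * t - d) = edist x y ^ (-t) * edist x y ^ (2 * α - t - d) := by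
      rw [← ENNReal.rpow_add _ _ hy (edist_ne_top x y)]; ring_nf
    rw [e2]
    push_cast
    ring

/-- A Hardy inequality for the far part, at a fixed base point. -/
theorem UpperRegular.exists_hardy_far (hσ : UpperRegular σ d C) [SFinite σ] (hd : 0 < d)
    (α : ℝ) {t : ℝ} (ht : t < 1) : ∃ K : ℝ≥0, ∀ (x : X) (ψ : X → ℝ≥0∞), Measurable ψ →
      ∫⁻ z, edist x z ^ (2 - 2 * t - d) * (∫⁻ y, farKernel (α - d - 1) x z y * ψ y ∂σ) ^ 2 ∂σ ≤
        K * ∫⁻ y, edist x y ^ (2 * α - 2 * t - d) * ψ y ^ 2 ∂σ := by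
  have ht' : 0 < 1 - t := sub_pos.2 ht
  obtain ⟨A, hA⟩ := hσ.exists_lintegral_farKernel_le hd ht'
  obtain ⟨B, hB⟩ := hσ.exists_lintegral_near_le hd ht'
  refine ⟨A * (B * 2⁻¹ ^ (1 - t)), fun x ψ hψ => ?_⟩
  rw [ENNReal.coe_mul]
  -- the same splitting with `t` and `α` replaced by `t - 1` and `α - 1`; as `t - 1 < 0`, the
  -- neighbourhood of `x` and its complement exchange their roles
  refine lintegral_mul_sq_lintegral_le (m := fun z => edist x z ^ (-(1 - t)))
    (f := fun z y => farKernel ((-(1 - t) - d) / 2) x z y)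
    (g := fun z y => farKernel ((2 * α - 1 - t - d) / 2) x z y)
    (by fun_prop) (by fun_prop) (by fun_prop) (by fun_prop) hψ ?_ ?_ ?_
  · filter_upwards with z
    filter_upwards [hσ.ae_ne hd x] with y hy
    simp only [farKernel]
    split_ifs
    · rw [← ENNReal.rpow_add _ _ hy (edist_ne_top x y)]
      ring_nf; rfl
    · simp
  · filter_upwards [hσ.ae_ne hd x] with z hz
    simp only [farKernel_half_sq]
    exact hA x z hz
  · filter_upwards [hσ.ae_ne hd x] with y hy
    have h3 : (2 : ℝ≥0∞)⁻¹ * edist x y ≠ 0 := mul_ne_zero (by simp) hy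
    have hm := measurableSet_edist_le x (2⁻¹ * edist x y)
    have e : ∀ᵐ z ∂σ, edist x z ^ (2 - 2 * t - d) * edist x z ^ (-(1 - t)) *
        farKernel ((2 * α - 1 - t - d) / 2) x z y ^ 2 =
        indicator {z | edist x z ≤ 2⁻¹ * edist x y} (fun z => edist x z ^ ((1 - t) - d)) z *
          edist x y ^ (2 * α - 1 - t - d) := by
      filter_upwards [hσ.ae_ne hd x] with z hz
      rw [farKernel_half_sq, ← ENNReal.rpow_add _ _ hz (edist_ne_top x z)]
      have hiff : edist x z ≤ 2⁻¹ * edist x y ↔ 2 * edist x z ≤ edist x y := by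
        rw [mul_comm 2⁻¹, ← div_eq_mul_inv, ENNReal.le_div_iff_mul_le (by simp) (by simp), mul_comm]
      simp only [indicator, mem_ofPred_eq, hiff, farKernel]
      split_ifs
      · congr 2; ring
      · simp
    rw [lintegral_congr_ae e, lintegral_mul_const _ ((by fun_prop : Measurable fun z =>
      edist x z ^ ((1 - t) - d)).indicator hm), lintegral_indicator hm]
    have := hB x _ h3 (ENNReal.mul_ne_top (by simp) (edist_ne_top x y))
    refine (mul_le_mul_left this _).trans_eq ?_
    rw [ENNReal.mul_rpow_of_nonneg _ _ ht'.le, ENNReal.coe_mul,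
      ENNReal.coe_rpow_of_nonneg _ ht'.le, ENNReal.coe_inv two_ne_zero]
    have e2 : edist x y ^ (2 * α - 2 * t - d) =
        edist x y ^ (1 - t) * edist x y ^ (2 * α - 1 - t - d) := by
      rw [← ENNReal.rpow_add _ _ hy (edist_ne_top x y)]; ring_nf
    rw [e2]
    push_cast
    ring

theorem ENNReal.add_sq_le (a b : ℝ≥0∞) : (a + b) ^ 2 ≤ 2 * (a ^ 2 + b ^ 2) := by
  have := ENNReal.rpow_add_le_mul_rpow_add_rpow a b (p := 2) (by norm_num)
  norm_num at this
  exact_mod_cast this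

/-- Pointwise control of the increments of `F` by near and far parts of `Ψ` bounds the Gagliardo
seminorm of `F` of order `t` by a weighted `L²` norm of `Ψ`. -/
theorem UpperRegular.exists_gagliardo_le {G : Type*} [NormedAddCommGroup G]
    (hσ : UpperRegular σ d C) [SFinite σ] (hd : 0 < d) (α : ℝ) {t : ℝ} (ht0 : 0 < t) (ht1 : t < 1)
    (B : ℝ≥0) : ∃ K : ℝ≥0, ∀ (F : X → G) (Ψ : X → X → ℝ≥0∞), Measurable (Function.uncurry Ψ) →
      (∀ᵐ x ∂σ, ∀ᵐ z ∂σ, ‖F x - F z‖ₑ ≤ B * ((∫⁻ y, nearKernel (α - d) x z y * Ψ x y ∂σ +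
        ∫⁻ y, nearKernel (α - d) z x y * Ψ z y ∂σ) +
        (edist x z * ∫⁻ y, farKernel (α - d - 1) x z y * Ψ x y ∂σ + edist x z ^ α * Ψ x z))) →
      ∫⁻ x, ∫⁻ z, ‖F x - F z‖ₑ ^ 2 / edist x z ^ (2 * t + d) ∂σ ∂σ ≤
        K * ∫⁻ x, ∫⁻ y, edist x y ^ (2 * α - 2 * t - d) * Ψ x y ^ 2 ∂σ ∂σ := by
  obtain ⟨K₁, hK₁⟩ := hσ.exists_hardy_near hd α ht0
  obtain ⟨K₂, hK₂⟩ := hσ.exists_hardy_far hd α ht1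
  refine ⟨4 * B ^ 2 * (K₁ + K₁ + (K₂ + 1)), fun F Ψ hΨ hF => ?_⟩
  have hΨx : ∀ x, Measurable (Ψ x) := fun x => hΨ.comp measurable_prodMk_left
  have hΨ2 : Measurable fun q : X × X => Ψ q.1 q.2 := hΨ
  set N : X → X → ℝ≥0∞ := fun x z => ∫⁻ y, nearKernel (α - d) x z y * Ψ x y ∂σ with hN
  set M : X → X → ℝ≥0∞ := fun x z => ∫⁻ y, farKernel (α - d - 1) x z y * Ψ x y ∂σ with hM
  have hΨ3 : Measurable fun q : (X × X) × X => Ψ q.1.1 q.2 :=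
    hΨ.comp ((measurable_fst.comp measurable_fst).prodMk measurable_snd)
  have hNm : Measurable fun q : X × X => N q.1 q.2 :=
    Measurable.lintegral_prod_right' (f := fun q : (X × X) × X =>
      nearKernel (α - d) q.1.1 q.1.2 q.2 * Ψ q.1.1 q.2)
      ((by fun_prop : Measurable fun q : (X × X) × X => nearKernel (α - d) q.1.1 q.1.2 q.2).mul hΨ3)
  have hMm : Measurable fun q : X × X => M q.1 q.2 :=
    Measurable.lintegral_prod_right' (f := fun q : (X × X) × X =>
      farKernel (α - d - 1) q.1.1 q.1.2 q.2 * Ψ q.1.1 q.2)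
      ((by fun_prop : Measurable fun q : (X × X) × X => farKernel (α - d - 1) q.1.1 q.1.2 q.2).mul hΨ3)
  -- the four contributions: two near parts, the far part, and the boundary term `|x - z|^α Ψ x z`
  set T₁ : X → X → ℝ≥0∞ := fun x z => edist x z ^ (-2 * t - d) * N x z ^ 2 with hT₁
  set T₂ : X → X → ℝ≥0∞ := fun x z => edist x z ^ (-2 * t - d) * N z x ^ 2 with hT₂
  set T₃ : X → X → ℝ≥0∞ := fun x z => edist x z ^ (2 - 2 * t - d) * M x z ^ 2 with hT₃
  set T₄ : X → X → ℝ≥0∞ := fun x z => edist x z ^ (2 * α - 2 * t - d) * Ψ x z ^ 2 with hT₄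
  have m₁ : Measurable (Function.uncurry T₁) :=
    (by fun_prop : Measurable fun q : X × X => edist q.1 q.2 ^ (-2 * t - d)).mul (hNm.pow_const 2)
  have m₂ : Measurable (Function.uncurry T₂) :=
    (by fun_prop : Measurable fun q : X × X => edist q.1 q.2 ^ (-2 * t - d)).mul
      ((hNm.comp measurable_swap).pow_const 2)
  have m₃ : Measurable (Function.uncurry T₃) :=
    (by fun_prop : Measurable fun q : X × X => edist q.1 q.2 ^ (2 - 2 * t - d)).mul
      (hMm.pow_const 2)
  have m₄ : Measurable (Function.uncurry T₄) :=
    (by fun_prop : Measurable fun q : X × X => edist q.1 q.2 ^ (2 * α - 2 * t - d)).mul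
      (hΨ2.pow_const 2)
  have mx : ∀ {T : X → X → ℝ≥0∞}, Measurable (Function.uncurry T) → ∀ x, Measurable (T x) :=
    fun hT x => hT.comp measurable_prodMk_left
  have mi : ∀ {T : X → X → ℝ≥0∞}, Measurable (Function.uncurry T) →
      Measurable fun x => ∫⁻ z, T x z ∂σ := fun hT => Measurable.lintegral_prod_right' hT
  set I := ∫⁻ x, ∫⁻ y, T₄ x y ∂σ ∂σ with hI
  have i₁ : ∫⁻ x, ∫⁻ z, T₁ x z ∂σ ∂σ ≤ K₁ * I := by
    rw [hI, ← lintegral_const_mul' _ _ ENNReal.coe_ne_top]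
    exact lintegral_mono fun x => hK₁ x (Ψ x) (hΨx x)
  have i₂ : ∫⁻ x, ∫⁻ z, T₂ x z ∂σ ∂σ ≤ K₁ * I := by
    rw [lintegral_lintegral_swap m₂.aemeasurable]
    refine le_trans (le_of_eq ?_) i₁
    congr 1; ext x; congr 1; ext z
    simp only [hT₁, hT₂, edist_comm x z]
  have i₃ : ∫⁻ x, ∫⁻ z, T₃ x z ∂σ ∂σ ≤ K₂ * I := by
    rw [hI, ← lintegral_const_mul' _ _ ENNReal.coe_ne_top]
    exact lintegral_mono fun x => hK₂ x (Ψ x) (hΨx x)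
  have hpt : ∀ᵐ x ∂σ, ∀ᵐ z ∂σ, ‖F x - F z‖ₑ ^ 2 / edist x z ^ (2 * t + d) ≤
      ((4 * B ^ 2 : ℝ≥0) : ℝ≥0∞) * ((T₁ x z + T₂ x z) + (T₃ x z + T₄ x z)) := by
    filter_upwards [hF] with x hx
    filter_upwards [hx, hσ.ae_ne hd x] with z hz hxz
    have hT := edist_ne_top x z
    have hsq : ‖F x - F z‖ₑ ^ 2 ≤ ((4 * B ^ 2 : ℝ≥0) : ℝ≥0∞) * ((N x z ^ 2 + N z x ^ 2) +
        ((edist x z * M x z) ^ 2 + (edist x z ^ α * Ψ x z) ^ 2)) := by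
      refine (pow_le_pow_left' hz 2).trans ?_
      rw [mul_pow]
      calc (B : ℝ≥0∞) ^ 2 * ((N x z + N z x) + (edist x z * M x z + edist x z ^ α * Ψ x z)) ^ 2
          ≤ (B : ℝ≥0∞) ^ 2 * (2 * (2 * (N x z ^ 2 + N z x ^ 2) +
            2 * ((edist x z * M x z) ^ 2 + (edist x z ^ α * Ψ x z) ^ 2))) := by
            gcongr
            refine (ENNReal.add_sq_le _ _).trans ?_
            gcongr
            · exact ENNReal.add_sq_le _ _
            · exact ENNReal.add_sq_le _ _
        _ = _ := by push_cast; ring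
    rw [div_eq_mul_inv, ← ENNReal.rpow_neg]
    refine (mul_le_mul_left hsq _).trans_eq ?_
    have e0 : -(2 * t + d) = -2 * t - d := by ring
    have e3 : edist x z ^ (2 - 2 * t - d) = edist x z ^ (-2 * t - d) * edist x z ^ 2 := by
      rw [← ENNReal.rpow_natCast, ← ENNReal.rpow_add _ _ hxz hT]; push_cast; ring_nf
    have e4 : edist x z ^ (2 * α - 2 * t - d) =
        edist x z ^ (-2 * t - d) * (edist x z ^ α) ^ 2 := by
      rw [← ENNReal.rpow_natCast, ← ENNReal.rpow_mul, ← ENNReal.rpow_add _ _ hxz hT]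
      push_cast; ring_nf
    simp only [hT₁, hT₂, hT₃, hT₄]
    rw [e0, e3, e4]
    ring
  calc ∫⁻ x, ∫⁻ z, ‖F x - F z‖ₑ ^ 2 / edist x z ^ (2 * t + d) ∂σ ∂σ
      ≤ ∫⁻ x, ∫⁻ z, ((4 * B ^ 2 : ℝ≥0) : ℝ≥0∞) * ((T₁ x z + T₂ x z) + (T₃ x z + T₄ x z)) ∂σ ∂σ :=
        lintegral_mono_ae (hpt.mono fun x hx => lintegral_mono_ae hx)
    _ = ((4 * B ^ 2 : ℝ≥0) : ℝ≥0∞) * ((∫⁻ x, ∫⁻ z, T₁ x z ∂σ ∂σ + ∫⁻ x, ∫⁻ z, T₂ x z ∂σ ∂σ) +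
        (∫⁻ x, ∫⁻ z, T₃ x z ∂σ ∂σ + I)) := by
        have hs : Measurable fun x => ∫⁻ z, T₁ x z ∂σ + ∫⁻ z, T₂ x z ∂σ := (mi m₁).add (mi m₂)
        rw [← lintegral_add_left (mi m₃), ← lintegral_add_left (mi m₁), ← lintegral_add_left hs,
          ← lintegral_const_mul' _ _ ENNReal.coe_ne_top]
        congr 1; ext x
        have hs' : Measurable fun z => T₁ x z + T₂ x z := (mx m₁ x).add (mx m₂ x)
        rw [lintegral_const_mul' _ _ ENNReal.coe_ne_top, lintegral_add_left hs', lintegral_add_left (mx m₁ x),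
          lintegral_add_left (mx m₃ x)]
    _ ≤ ((4 * B ^ 2 : ℝ≥0) : ℝ≥0∞) * ((K₁ * I + K₁ * I) + (K₂ * I + I)) := by gcongr
    _ = _ := by push_cast; ring

end NearFar

/-! ### Weakly singular integral operators -/

/-- `k` is a kernel on `S` of size `|x - y|^{α - d}` which, away from the diagonal, is Lipschitz in
its first variable with constant of size `|x - y|^{α - d - 1}`. -/
structure IsWeaklySingular {X 𝕜 : Type*} [MetricSpace X] [MeasurableSpace X] [RCLike 𝕜]
    (S : Set X) (k : X → X → 𝕜) (d α : ℝ) (A : ℝ≥0) : Prop where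
  stronglyMeasurable : StronglyMeasurable (Function.uncurry k)
  enorm_le : ∀ x ∈ S, ∀ y ∈ S, ‖k x y‖ₑ ≤ A * edist x y ^ (α - d)
  enorm_sub_le : ∀ x ∈ S, ∀ z ∈ S, ∀ y ∈ S, edist x z ≠ 0 → 2 * edist x z ≤ edist x y →
    ‖k x y - k z y‖ₑ ≤ A * (edist x z * edist x y ^ (α - d - 1))

theorem IsWeaklySingular.stronglyMeasurable_mul {X 𝕜 : Type*} [MetricSpace X]
    [MeasurableSpace X] [RCLike 𝕜] {S : Set X} {k : X → X → 𝕜} {d α : ℝ} {A : ℝ≥0}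
    (hk : IsWeaklySingular S k d α A) {f : X → 𝕜}
    (hf : StronglyMeasurable f) (x : X) : StronglyMeasurable fun y => k x y * f y :=
  (hk.stronglyMeasurable.comp_measurable measurable_prodMk_left).mul hf

section WeaklySingular

variable {X 𝕜 : Type*} [MetricSpace X] [SecondCountableTopology X] [MeasurableSpace X]
  [BorelSpace X] [RCLike 𝕜] {σ : Measure X} {d α : ℝ} {A C : ℝ≥0} {S : Set X} {k : X → X → 𝕜}

/-- The `L²` bound, by Schur's test. -/
theorem IsWeaklySingular.exists_lintegral_sq_le [IsFiniteMeasure σ] (hk : IsWeaklySingular S k d α A)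
    (hσ : UpperRegular σ d C) (hd : 0 < d) (hα : 0 < α) (hS : ∀ᵐ x ∂σ, x ∈ S)
    (hR : ∃ R : ℝ≥0, ∀ᵐ x ∂σ, ∀ᵐ y ∂σ, edist x y ≤ R) :
    ∃ K : ℝ≥0, ∀ f : X → 𝕜, StronglyMeasurable f →
      ∫⁻ x, (∫⁻ y, ‖k x y * f y‖ₑ ∂σ) ^ 2 ∂σ ≤ K * ∫⁻ y, ‖f y‖ₑ ^ 2 ∂σ := by
  obtain ⟨K, hK⟩ := hσ.exists_lintegral_le hd hα hR
  refine ⟨A ^ 2 * (K * K), fun f hf => ?_⟩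
  have h1 := lintegral_mul_sq_lintegral_le (μ := σ) (ν := σ) (u := 1) (m := 1) (v := 1)
    (k := fun x y => edist x y ^ (α - d)) (f := fun x y => edist x y ^ ((α - d) / 2))
    (g := fun x y => edist x y ^ ((α - d) / 2)) (ψ := fun y => ‖f y‖ₑ) (A := K) (B := K)
    (by fun_prop) (by fun_prop) measurable_one measurable_one hf.enorm
    (by
      refine Eventually.of_forall fun x => Eventually.of_forall fun y => ?_
      rw [← sq, ENNReal.rpow_half_sq])
    (by simpa only [ENNReal.rpow_half_sq, Pi.one_apply, mul_one] using hK)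
    (by
      refine hK.mono fun y hy => ?_
      simp only [ENNReal.rpow_half_sq, Pi.one_apply, mul_one, one_mul]
      simpa only [edist_comm] using hy)
  simp only [Pi.one_apply, one_mul] at h1
  calc ∫⁻ x, (∫⁻ y, ‖k x y * f y‖ₑ ∂σ) ^ 2 ∂σ
      ≤ ∫⁻ x, ((A ^ 2 : ℝ≥0) : ℝ≥0∞) * (∫⁻ y, edist x y ^ (α - d) * ‖f y‖ₑ ∂σ) ^ 2 ∂σ := by
        refine lintegral_mono_ae (hS.mono fun x hx => ?_)
        rw [ENNReal.coe_pow, ← mul_pow, ← lintegral_const_mul' _ _ ENNReal.coe_ne_top]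
        refine pow_le_pow_left' (lintegral_mono_ae (hS.mono fun y hy => ?_)) 2
        rw [enorm_mul, ← mul_assoc]
        exact mul_le_mul_left (hk.enorm_le x hx y hy) _
    _ ≤ ((A ^ 2 : ℝ≥0) : ℝ≥0∞) * (K * K * ∫⁻ y, ‖f y‖ₑ ^ 2 ∂σ) := by
        rw [lintegral_const_mul' _ _ ENNReal.coe_ne_top]
        gcongr
    _ = _ := by push_cast; ring

theorem IsWeaklySingular.ae_integrable [IsFiniteMeasure σ] (hk : IsWeaklySingular S k d α A)
    (hσ : UpperRegular σ d C) (hd : 0 < d) (hα : 0 < α) (hS : ∀ᵐ x ∂σ, x ∈ S)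
    (hR : ∃ R : ℝ≥0, ∀ᵐ x ∂σ, ∀ᵐ y ∂σ, edist x y ≤ R) {f : X → 𝕜} (hf : StronglyMeasurable f)
    (hf2 : ∫⁻ y, ‖f y‖ₑ ^ 2 ∂σ < ∞) : ∀ᵐ x ∂σ, Integrable (fun y => k x y * f y) σ := by
  obtain ⟨K, hK⟩ := hk.exists_lintegral_sq_le hσ hd hα hS hR
  have hfin := (hK f hf).trans_lt (ENNReal.mul_lt_top ENNReal.coe_lt_top hf2)
  have hm : Measurable fun x => (∫⁻ y, ‖k x y * f y‖ₑ ∂σ) ^ 2 := by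
    refine Measurable.pow_const ?_ 2
    refine Measurable.lintegral_prod_right' (f := fun q : X × X => ‖k q.1 q.2 * f q.2‖ₑ) ?_
    exact (StronglyMeasurable.mul hk.stronglyMeasurable (hf.comp_measurable measurable_snd)).enorm
  filter_upwards [ae_lt_top hm hfin.ne] with x hx
  refine ⟨(hk.stronglyMeasurable_mul hf x).aestronglyMeasurable, ?_⟩
  by_contra h
  have htop : ∫⁻ y, ‖k x y * f y‖ₑ ∂σ = ∞ := by
    simpa [HasFiniteIntegral] using h
  rw [htop] at hx
  simp at hx

/-- The increments of the potential of `h`, by splitting the integral at `|x - y| = 2 |x - z|`. -/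
theorem IsWeaklySingular.enorm_integral_sub_le (hk : IsWeaklySingular S k d α A)
    (hS : ∀ᵐ x ∂σ, x ∈ S) {x z : X} (hx : x ∈ S) (hz : z ∈ S) (hxz : edist x z ≠ 0) {h : X → 𝕜}
    (hix : Integrable (fun y => k x y * h y) σ) (hiz : Integrable (fun y => k z y * h y) σ)
    {ψ χ : X → ℝ≥0∞} (hψ : Measurable ψ) (hχ : Measurable χ) {c : ℝ≥0∞}
    (h1 : ∀ y, ‖h y‖ₑ ≤ ψ y) (h2 : ∀ y, ‖h y‖ₑ ≤ χ y + c) :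
    ‖∫ y, k x y * h y ∂σ - ∫ y, k z y * h y ∂σ‖ₑ ≤
      A * ((∫⁻ y, nearKernel (α - d) x z y * ψ y ∂σ +
        ∫⁻ y, nearKernel (α - d) z x y * χ y ∂σ) +
        (edist x z * ∫⁻ y, farKernel (α - d - 1) x z y * ψ y ∂σ +
          (∫⁻ y, nearKernel (α - d) z x y ∂σ) * c)) := by
  have m1 : Measurable fun y => nearKernel (α - d) x z y * ψ y := by fun_prop
  have m2 : Measurable fun y => nearKernel (α - d) z x y * χ y := by fun_prop
  have m3 : Measurable fun y => farKernel (α - d - 1) x z y * ψ y := by fun_prop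
  have m3' : Measurable fun y => edist x z * (farKernel (α - d - 1) x z y * ψ y) := by fun_prop
  have m4 : Measurable fun y => nearKernel (α - d) z x y := by fun_prop
  have m12 : Measurable fun y => nearKernel (α - d) x z y * ψ y +
    nearKernel (α - d) z x y * χ y := m1.add m2
  rw [← integral_sub hix hiz, ← lintegral_const_mul _ m3, ← lintegral_mul_const _ m4,
    ← lintegral_add_left m3', ← lintegral_add_left m1, ← lintegral_add_left m12,
    ← lintegral_const_mul' _ _ ENNReal.coe_ne_top]
  refine (enorm_integral_le_lintegral_enorm _).trans (lintegral_mono_ae (hS.mono fun y hy => ?_))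
  rw [← sub_mul, enorm_mul]
  rcases le_or_gt (2 * edist x z) (edist x y) with hfar | hnear
  · calc ‖k x y - k z y‖ₑ * ‖h y‖ₑ ≤ A * (edist x z * edist x y ^ (α - d - 1)) * ψ y :=
          mul_le_mul' (hk.enorm_sub_le x hx z hz y hy hxz hfar) (h1 y)
      _ = A * (edist x z * (farKernel (α - d - 1) x z y * ψ y)) := by
          rw [farKernel, if_pos hfar]; ring
      _ ≤ _ := by
          gcongr
          exact le_add_left le_self_add
  · have hn1 : edist x y ≤ 3 * edist x z := hnear.le.trans (by gcongr; norm_num)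
    have hn2 : edist z y ≤ 3 * edist z x := by
      rw [edist_comm z x]
      calc edist z y ≤ edist z x + edist x y := edist_triangle _ _ _
        _ ≤ edist x z + 2 * edist x z := by rw [edist_comm z x]; gcongr
        _ = _ := by ring
    calc ‖k x y - k z y‖ₑ * ‖h y‖ₑ ≤ (‖k x y‖ₑ + ‖k z y‖ₑ) * ‖h y‖ₑ := by
          gcongr; exact _root_.enorm_sub_le
      _ = ‖k x y‖ₑ * ‖h y‖ₑ + ‖k z y‖ₑ * ‖h y‖ₑ := add_mul _ _ _
      _ ≤ A * edist x y ^ (α - d) * ψ y + A * edist z y ^ (α - d) * (χ y + c) :=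
          add_le_add (mul_le_mul' (hk.enorm_le x hx y hy) (h1 y))
            (mul_le_mul' (hk.enorm_le z hz y hy) (h2 y))
      _ = A * ((nearKernel (α - d) x z y * ψ y + nearKernel (α - d) z x y * χ y) +
            (0 + nearKernel (α - d) z x y * c)) := by
          rw [nearKernel, nearKernel, if_pos hn1, if_pos hn2]; ring
      _ ≤ _ := by gcongr; exact zero_le

/-- The Gagliardo seminorm of `F`, if `F x - F z` is the increment from `z` to `x` of the potential of
a function `h x`, which may depend on `x`, and `h` is controlled by `Ψ`. -/
theorem IsWeaklySingular.exists_gagliardo_le [IsFiniteMeasure σ] (hk : IsWeaklySingular S k d α A)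
    (hσ : UpperRegular σ d C) (hd : 0 < d) (hα : 0 < α) (hS : ∀ᵐ x ∂σ, x ∈ S)
    {t : ℝ} (ht0 : 0 < t) (ht1 : t < 1) :
    ∃ K : ℝ≥0, ∀ (F : X → 𝕜) (h : X → X → 𝕜) (Ψ : X → X → ℝ≥0∞),
      Measurable (Function.uncurry Ψ) → (∀ x y, ‖h x y‖ₑ ≤ Ψ x y) →
      (∀ x y z, ‖h x y‖ₑ ≤ Ψ z y + Ψ x z) →
      (∀ᵐ x ∂σ, ∀ᵐ z ∂σ, Integrable (fun y => k x y * h x y) σ ∧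
        Integrable (fun y => k z y * h x y) σ ∧
        F x - F z = ∫ y, k x y * h x y ∂σ - ∫ y, k z y * h x y ∂σ) →
      ∫⁻ x, ∫⁻ z, ‖F x - F z‖ₑ ^ 2 / edist x z ^ (2 * t + d) ∂σ ∂σ ≤
        K * ∫⁻ x, ∫⁻ y, edist x y ^ (2 * α - 2 * t - d) * Ψ x y ^ 2 ∂σ ∂σ := by
  obtain ⟨B, hB⟩ := hσ.exists_lintegral_nearKernel_le hd hα
  obtain ⟨K, hK⟩ := hσ.exists_gagliardo_le (G := 𝕜) hd α ht0 ht1 (A * (1 + B))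
  refine ⟨K, fun F h Ψ hΨ h1 h2 hF => hK F Ψ hΨ ?_⟩
  have hΨx : ∀ x, Measurable (Ψ x) := fun x => hΨ.comp measurable_prodMk_left
  filter_upwards [hF, hS] with x hx hxS
  filter_upwards [hx, hS, hσ.ae_ne hd x] with z ⟨hix, hiz, hFxz⟩ hzS hxz
  rw [hFxz]
  refine (hk.enorm_integral_sub_le hS hxS hzS hxz hix hiz (hΨx x) (hΨx z) (h1 x)
    (fun y => h2 x y z)).trans ?_
  rw [ENNReal.coe_mul, mul_assoc]
  refine mul_le_mul_right ?_ _
  have hBz : ∫⁻ y, nearKernel (α - d) z x y ∂σ ≤ B * edist x z ^ α := by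
    rw [edist_comm x z]; exact hB z x (by rwa [edist_comm])
  have e1 : (1 : ℝ≥0∞) ≤ ((1 + B : ℝ≥0) : ℝ≥0∞) := by
    rw [ENNReal.coe_add, ENNReal.coe_one]; exact le_self_add
  have e2 : (B : ℝ≥0∞) ≤ ((1 + B : ℝ≥0) : ℝ≥0∞) := ENNReal.coe_le_coe.2 le_add_self
  rw [mul_add, mul_add ((1 + B : ℝ≥0) : ℝ≥0∞) (edist x z * _)]
  refine add_le_add (le_mul_of_one_le_left' e1) (add_le_add (le_mul_of_one_le_left' e1) ?_)
  rw [← mul_assoc]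
  exact mul_le_mul_left (hBz.trans (mul_le_mul_left e2 _)) _

/-- A weakly singular operator of order `-α` maps `L²` into `H^t` for `t < α`. -/
theorem IsWeaklySingular.exists_gagliardo_le_lintegral [IsFiniteMeasure σ]
    (hk : IsWeaklySingular S k d α A) (hσ : UpperRegular σ d C) (hd : 0 < d) (hα : 0 < α)
    (hS : ∀ᵐ x ∂σ, x ∈ S) (hR : ∃ R : ℝ≥0, ∀ᵐ x ∂σ, ∀ᵐ y ∂σ, edist x y ≤ R)
    {t : ℝ} (ht0 : 0 < t) (ht1 : t < 1) (htα : t < α) :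
    ∃ K : ℝ≥0, ∀ f : X → 𝕜, StronglyMeasurable f → ∫⁻ y, ‖f y‖ₑ ^ 2 ∂σ < ∞ →
      ∫⁻ x, ∫⁻ z, ‖∫ y, k x y * f y ∂σ - ∫ y, k z y * f y ∂σ‖ₑ ^ 2 /
        edist x z ^ (2 * t + d) ∂σ ∂σ ≤ K * ∫⁻ y, ‖f y‖ₑ ^ 2 ∂σ := by
  obtain ⟨K, hK⟩ := hk.exists_gagliardo_le hσ hd hα hS ht0 ht1
  obtain ⟨B, hB⟩ := hσ.exists_lintegral_le hd (b := 2 * α - 2 * t) (by linarith) hR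
  refine ⟨K * B, fun f hf hf2 => ?_⟩
  have hi := hk.ae_integrable hσ hd hα hS hR hf hf2
  have hfm : Measurable fun q : X × X => ‖f q.2‖ₑ := (hf.comp_measurable measurable_snd).enorm
  refine (hK (fun x => ∫ y, k x y * f y ∂σ) (fun _ y => f y) (fun _ y => ‖f y‖ₑ) hfm
    (fun _ _ => le_rfl) (fun _ _ _ => le_self_add) ?_).trans ?_
  · filter_upwards [hi] with x hx
    filter_upwards [hi] with z hz
    exact ⟨hx, hz, rfl⟩
  · rw [lintegral_lintegral_swap, ENNReal.coe_mul, mul_assoc]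
    · refine mul_le_mul_right ?_ _
      rw [← lintegral_const_mul' _ _ ENNReal.coe_ne_top]
      refine lintegral_mono_ae (hB.mono fun y hy => ?_)
      rw [lintegral_mul_const _ (by fun_prop)]
      simp only [edist_comm] at hy ⊢
      exact mul_le_mul_left hy _
    · exact ((by fun_prop : Measurable fun q : X × X => edist q.1 q.2 ^ (2 * α - 2 * t - d)).mul
        (hfm.pow_const 2)).aemeasurable

/-- A weakly singular operator of order `-α` which maps constants to constants maps `H^s` into
`H^{s+α}`: the cancellation allows one to replace `f` by `f - f x`. -/
theorem IsWeaklySingular.exists_gagliardo_le_gagliardo [IsFiniteMeasure σ]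
    (hk : IsWeaklySingular S k d α A) (hσ : UpperRegular σ d C) (hd : 0 < d) (hα : 0 < α)
    (hS : ∀ᵐ x ∂σ, x ∈ S) (hR : ∃ R : ℝ≥0, ∀ᵐ x ∂σ, ∀ᵐ y ∂σ, edist x y ≤ R)
    {s : ℝ} (hs : 0 < s) (hsα : s + α < 1) {c : 𝕜} (hc : ∀ᵐ x ∂σ, ∫ y, k x y ∂σ = c) :
    ∃ K : ℝ≥0, ∀ f : X → 𝕜, StronglyMeasurable f → ∫⁻ y, ‖f y‖ₑ ^ 2 ∂σ < ∞ →
      ∫⁻ x, ∫⁻ z, ‖∫ y, k x y * f y ∂σ - ∫ y, k z y * f y ∂σ‖ₑ ^ 2 /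
        edist x z ^ (2 * (s + α) + d) ∂σ ∂σ ≤
      K * ∫⁻ x, ∫⁻ y, ‖f x - f y‖ₑ ^ 2 / edist x y ^ (2 * s + d) ∂σ ∂σ := by
  obtain ⟨K, hK⟩ := hk.exists_gagliardo_le hσ hd hα hS (t := s + α) (by linarith) hsα
  refine ⟨K, fun f hf hf2 => ?_⟩
  have hi := hk.ae_integrable hσ hd hα hS hR hf hf2
  have hi1 := hk.ae_integrable hσ hd hα hS hR (f := fun _ => 1) stronglyMeasurable_const
    (by simp [measure_lt_top])
  have hfm : Measurable fun q : X × X => ‖f q.1 - f q.2‖ₑ :=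
    ((hf.comp_measurable measurable_fst).sub (hf.comp_measurable measurable_snd)).enorm
  refine (hK (fun x => ∫ y, k x y * f y ∂σ) (fun x y => f y - f x) (fun x y => ‖f x - f y‖ₑ) hfm
    (fun x y => by rw [enorm_sub_rev]) (fun x y z => ?_) ?_).trans_eq ?_
  · have : f y - f x = -((f z - f y) + (f x - f z)) := by ring
    rw [this, enorm_neg]
    exact enorm_add_le _ _
  · filter_upwards [hi, hi1, hc] with x hx hx1 hxc
    filter_upwards [hi, hi1, hc] with z hz hz1 hzc
    simp only [mul_one] at hx1 hz1
    simp only [mul_sub]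
    refine ⟨hx.sub (hx1.mul_const _), hz.sub (hz1.mul_const _), ?_⟩
    rw [integral_sub hx (hx1.mul_const _), integral_sub hz (hz1.mul_const _), integral_mul_const,
      integral_mul_const, hxc, hzc]
    ring
  · congr 1
    refine lintegral_congr fun x => lintegral_congr fun y => ?_
    rw [div_eq_mul_inv, ← ENNReal.rpow_neg, mul_comm]
    congr 2
    ring

end WeaklySingular

/-! ### The double layer kernel -/

/-- A kernel `⟨x - y, ν_y⟩ / |x - y|^{d + 1}` is Lipschitz in `x` away from the diagonal. In the
numerator `x - z` is almost orthogonal to `ν_z`, hence to `ν_y`. -/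
theorem abs_inner_div_norm_pow_sub_le {V : Type*} [NormedAddCommGroup V] [InnerProductSpace ℝ V]
    (d : ℕ) {α C₁ C₂ : ℝ} (hα : 0 < α) (hC₁ : 0 ≤ C₁) (hC₂ : 0 ≤ C₂) {x y z u v : V}
    (hxz : |inner ℝ (x - z) v| ≤ C₁ * ‖x - z‖ ^ (1 + α))
    (hzy : |inner ℝ (z - y) u| ≤ C₁ * ‖z - y‖ ^ (1 + α)) (huv : ‖u - v‖ ≤ C₂ * ‖y - z‖ ^ α)
    (hne : 0 < ‖x - z‖) (hle : 2 * ‖x - z‖ ≤ ‖x - y‖) :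
    |inner ℝ (x - y) u / ‖x - y‖ ^ (d + 1) - inner ℝ (z - y) u / ‖z - y‖ ^ (d + 1)| ≤
      (C₁ + C₂ * 2 ^ α + C₁ * 2 ^ (1 + α) * (d + 1) * 2 ^ d * 2 ^ (d + 1)) *
        (‖x - z‖ * ‖x - y‖ ^ (α - d - 1)) := by
  rw [norm_sub_rev y z] at huv
  have e : x - y = (x - z) + (z - y) := by abel
  have t1 : ‖x - y‖ ≤ ‖x - z‖ + ‖z - y‖ := e ▸ norm_add_le _ _
  have t2 : ‖z - y‖ ≤ ‖x - z‖ + ‖x - y‖ := by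
    have : z - y = (x - y) - (x - z) := by abel
    rw [this, add_comm]
    exact norm_sub_le _ _
  have e2 : inner ℝ (x - y) u = inner ℝ (x - z) v + inner ℝ (x - z) (u - v) + inner ℝ (z - y) u := by
    rw [e, inner_add_left, inner_sub_right]
    ring
  have i1 : |inner ℝ (x - z) (u - v)| ≤ ‖x - z‖ * ‖u - v‖ := abs_real_inner_le_norm _ _
  generalize inner ℝ (x - z) (u - v) = p at *
  generalize inner ℝ (x - z) v = q at *
  rw [e2]
  generalize inner ℝ (z - y) u = w at *
  generalize ‖u - v‖ = m at *
  generalize ‖x - z‖ = δ at *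
  generalize ‖z - y‖ = ρ at *
  generalize ‖x - y‖ = r at *
  have hr : 0 < r := by linarith
  have hρ : 0 < ρ := by linarith
  have hρr : ρ ≤ 2 * r := by linarith
  have hrρ : r ≤ 2 * ρ := by linarith
  have hδr : δ ≤ r := by linarith
  have a1 : |q + p| ≤ (C₁ + C₂ * 2 ^ α) * (δ * r ^ α) := by
    have b1 : δ ^ (1 + α) ≤ δ * r ^ α := by
      rw [Real.rpow_add hne, Real.rpow_one]
      gcongr
    have b2 : ρ ^ α ≤ 2 ^ α * r ^ α := by
      rw [← Real.mul_rpow (by norm_num) hr.le]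
      gcongr
    calc |q + p| ≤ |q| + |p| := abs_add_le _ _
      _ ≤ C₁ * (δ * r ^ α) + δ * (C₂ * (2 ^ α * r ^ α)) := by
        refine add_le_add (hxz.trans (by gcongr)) (i1.trans ?_)
        gcongr
        exact huv.trans (by gcongr)
      _ = _ := by ring
  have a2 : |w| ≤ C₁ * 2 ^ (1 + α) * (r * r ^ α) := by
    have b2 : ρ ^ (1 + α) ≤ 2 ^ (1 + α) * (r * r ^ α) := by
      calc ρ ^ (1 + α) ≤ (2 * r) ^ (1 + α) := by gcongr
        _ = _ := by rw [Real.mul_rpow (by norm_num) hr.le, Real.rpow_add hr, Real.rpow_one]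
    calc |w| ≤ C₁ * ρ ^ (1 + α) := hzy
      _ ≤ C₁ * (2 ^ (1 + α) * (r * r ^ α)) := by gcongr
      _ = _ := by ring
  have a3 : |ρ ^ (d + 1) - r ^ (d + 1)| ≤ (d + 1) * 2 ^ d * (δ * r ^ d) := by
    have b := abs_pow_sub_pow_le ρ r (d + 1)
    rw [abs_of_pos hρ, abs_of_pos hr] at b
    have b1 : |ρ - r| ≤ δ := abs_le.2 ⟨by linarith, by linarith⟩
    have b2 : max ρ r ≤ 2 * r := max_le hρr (by linarith)
    calc _ ≤ _ := b
      _ ≤ δ * (d + 1 : ℕ) * (2 * r) ^ d := by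
        rw [Nat.add_sub_cancel]
        gcongr
      _ = _ := by push_cast; ring
  have a4 : (ρ ^ (d + 1))⁻¹ ≤ 2 ^ (d + 1) * (r ^ (d + 1))⁻¹ := by
    rw [← div_eq_mul_inv, inv_eq_one_div, div_le_div_iff₀ (by positivity) (by positivity), one_mul,
      ← mul_pow]
    gcongr
  have e3 : r ^ (α - d - 1) = r ^ α * (r ^ (d + 1))⁻¹ := by
    rw [show α - d - 1 = α + -((d + 1 : ℕ) : ℝ) by push_cast; ring, Real.rpow_add hr,
      Real.rpow_neg hr.le, Real.rpow_natCast]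
  have e4 : (q + p + w) / r ^ (d + 1) - w / ρ ^ (d + 1) =
      (q + p) * (r ^ (d + 1))⁻¹ +
        w * ((ρ ^ (d + 1) - r ^ (d + 1)) * ((ρ ^ (d + 1))⁻¹ * (r ^ (d + 1))⁻¹)) := by
    field_simp
    ring
  have hri : 0 < (r ^ (d + 1))⁻¹ := by positivity
  have hρi : 0 < (ρ ^ (d + 1))⁻¹ := by positivity
  rw [e4, e3]
  calc _ ≤ |(q + p) * (r ^ (d + 1))⁻¹| + |w * ((ρ ^ (d + 1) - r ^ (d + 1)) *
        ((ρ ^ (d + 1))⁻¹ * (r ^ (d + 1))⁻¹))| := abs_add_le _ _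
    _ = |q + p| * (r ^ (d + 1))⁻¹ + |w| * (|ρ ^ (d + 1) - r ^ (d + 1)| *
        ((ρ ^ (d + 1))⁻¹ * (r ^ (d + 1))⁻¹)) := by
      rw [abs_mul, abs_mul, abs_mul, abs_mul, abs_of_pos hri, abs_of_pos hρi]
    _ ≤ (C₁ + C₂ * 2 ^ α) * (δ * r ^ α) * (r ^ (d + 1))⁻¹ + C₁ * 2 ^ (1 + α) * (r * r ^ α) *
        ((d + 1) * 2 ^ d * (δ * r ^ d) * (2 ^ (d + 1) * (r ^ (d + 1))⁻¹ * (r ^ (d + 1))⁻¹)) := by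
      gcongr
    _ = _ := by
      field_simp
      ring

/-- The kernel `⟨x - y, ν_y⟩ / |x - y|^{d + 1}`, with `ν` replaced by `0` off the boundary. -/
noncomputable def doubleLayerKernel {d : ℕ} (Ω : Set (E (d + 1))) (x y : E (d + 1)) : ℝ :=
  inner ℝ (x - y) ((frontier Ω).indicator (outerNormal Ω) y) / ‖x - y‖ ^ (d + 1)

theorem doubleLayerKernel_of_mem {d : ℕ} {Ω : Set (E (d + 1))} (x : E (d + 1)) {y : E (d + 1)}
    (hy : y ∈ frontier Ω) :
    doubleLayerKernel Ω x y = inner ℝ (x - y) (outerNormal Ω y) / ‖x - y‖ ^ (d + 1) := by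
  rw [doubleLayerKernel, indicator_of_mem hy]

theorem exists_isWeaklySingular_doubleLayerKernel {d : ℕ} {Ω : Set (E (d + 1))} (hΩo : IsOpen Ω)
    (hΩb : Bornology.IsBounded Ω) {α : ℝ} (hα : 0 < α) (hΩ : HasC1HolderBoundary α Ω) :
    ∃ A : ℝ≥0, IsWeaklySingular (frontier Ω) (doubleLayerKernel Ω) d α A := by
  obtain ⟨C₁, hC₁, h₁⟩ := exists_abs_inner_outerNormal_le hΩo hΩb hα hΩ
  obtain ⟨C₂, hC₂', h₂⟩ : ∃ C₂, 0 ≤ C₂ ∧ ∀ x ∈ frontier Ω, ∀ y ∈ frontier Ω,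
      ‖outerNormal Ω x - outerNormal Ω y‖ ≤ C₂ * ‖x - y‖ ^ α := by
    obtain ⟨C, hC⟩ := exists_norm_outerNormal_sub_le hΩo hΩb hα hΩ
    exact ⟨|C|, abs_nonneg _, fun x hx y hy => ((hC.2 x hx y hy).trans (by gcongr; exact le_abs_self C))⟩
  set B := C₁ + C₂ * 2 ^ α + C₁ * 2 ^ (1 + α) * (d + 1) * 2 ^ d * 2 ^ (d + 1) with hB
  have hC₁B : C₁ ≤ B := by
    rw [hB, add_assoc]
    exact le_add_of_nonneg_right (by positivity)
  have hν : Measurable ((frontier Ω).indicator (outerNormal Ω)) := by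
    classical
    rw [← piecewise_eq_indicator]
    exact (continuousOn_outerNormal hΩo hΩb hα hΩ).measurable_piecewise continuousOn_const
      isClosed_frontier.measurableSet
  refine ⟨B.toNNReal, Measurable.stronglyMeasurable ?_, fun x hx y hy => ?_,
    fun x hx z hz y hy hne hle => ?_⟩
  · refine Measurable.div (Measurable.inner (by fun_prop) (hν.comp measurable_snd)) (by fun_prop)
  · rw [doubleLayerKernel_of_mem x hy]
    rcases eq_or_ne x y with rfl | hxy
    · simp
    have hr : 0 < ‖x - y‖ := norm_pos_iff.2 (sub_ne_zero.2 hxy)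
    rw [edist_dist, dist_eq_norm, ENNReal.ofReal_rpow_of_pos hr, ← ENNReal.ofReal,
      ← ENNReal.ofReal_mul (hC₁.trans hC₁B), ← ofReal_norm, Real.norm_eq_abs, abs_div, abs_pow,
      abs_norm]
    refine ENNReal.ofReal_le_ofReal ?_
    rw [div_le_iff₀ (by positivity), mul_assoc, ← Real.rpow_natCast ‖x - y‖ (d + 1),
      ← Real.rpow_add hr]
    refine (h₁ x hx y hy).trans ?_
    rw [show α - d + ((d + 1 : ℕ) : ℝ) = 1 + α by push_cast; ring]
    gcongr
  · have hxz : 0 < ‖x - z‖ := by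
      rw [← dist_eq_norm]
      exact dist_pos.2 fun h => hne (by rw [h, edist_self])
    have hle' : 2 * ‖x - z‖ ≤ ‖x - y‖ := by
      have h := ENNReal.toReal_mono (edist_ne_top x y) hle
      rwa [ENNReal.toReal_mul, ENNReal.toReal_ofNat, ← dist_edist, ← dist_edist, dist_eq_norm,
        dist_eq_norm] at h
    rw [doubleLayerKernel_of_mem x hy, doubleLayerKernel_of_mem z hy]
    rw [edist_dist, edist_dist, dist_eq_norm, dist_eq_norm,
      ENNReal.ofReal_rpow_of_pos (by linarith), ← ENNReal.ofReal_mul hxz.le, ← ENNReal.ofReal,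
      ← ENNReal.ofReal_mul (hC₁.trans hC₁B), ← ofReal_norm, Real.norm_eq_abs]
    exact ENNReal.ofReal_le_ofReal (abs_inner_div_norm_pow_sub_le d hα hC₁ hC₂' (h₁ x hx z hz)
      (h₁ z hz y hy) (h₂ y hy z hz) hxz hle')

theorem IsWeaklySingular.ofReal_const_mul {X : Type*} (𝕜 : Type*) [MetricSpace X]
    [MeasurableSpace X] [RCLike 𝕜] {S : Set X} {k : X → X → ℝ} {d α : ℝ} {A : ℝ≥0}
    (hk : IsWeaklySingular S k d α A) (a : ℝ) :
    IsWeaklySingular S (fun x y => ((a * k x y : ℝ) : 𝕜)) d α (‖a‖₊ * A) := by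
  have h (b : ℝ) : ‖((a * b : ℝ) : 𝕜)‖ₑ = ‖a‖₊ * ‖b‖ₑ := by
    rw [← ofReal_norm, RCLike.norm_ofReal, abs_mul, ENNReal.ofReal_mul (abs_nonneg a),
      ← Real.norm_eq_abs, ← Real.norm_eq_abs, ofReal_norm, ofReal_norm, enorm_eq_nnnorm]
  refine ⟨?_, fun x hx y hy => ?_, fun x hx z hz y hy hne hle => ?_⟩
  · exact RCLike.continuous_ofReal.comp_stronglyMeasurable
      (hk.stronglyMeasurable.const_mul a)
  · rw [h, ENNReal.coe_mul, mul_assoc]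
    gcongr
    exact hk.enorm_le x hx y hy
  · rw [← RCLike.ofReal_sub, ← mul_sub, h, ENNReal.coe_mul, mul_assoc]
    gcongr
    exact hk.enorm_sub_le x hx z hz y hy hne hle

theorem exists_upperRegular_surfaceMeasure {d : ℕ} {Ω : Set (E (d + 1))} (hΩo : IsOpen Ω)
    (hΩb : Bornology.IsBounded Ω) {α : ℝ} (hΩ : HasC1HolderBoundary α Ω) :
    ∃ C : ℝ≥0, UpperRegular (surfaceMeasure Ω) d C := by
  obtain ⟨C, hC⟩ := exists_surfaceMeasure_closedBall_le hΩo hΩb hΩ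
  refine ⟨C, fun x ρ h0 htop => ?_⟩
  have h := hC x ρ.toReal (ENNReal.toReal_pos h0 htop)
  rw [ENNReal.ofReal_toReal htop] at h
  rw [ENNReal.rpow_natCast]
  refine (measure_mono fun y hy => ?_).trans h
  rw [Metric.mem_closedBall, dist_comm, dist_edist]
  exact ENNReal.toReal_mono htop hy

theorem exists_ae_edist_le_surfaceMeasure {d : ℕ} {Ω : Set (E (d + 1))}
    (hΩb : Bornology.IsBounded Ω) : ∃ R : ℝ≥0, ∀ᵐ x ∂(surfaceMeasure Ω),
      ∀ᵐ y ∂(surfaceMeasure Ω), edist x y ≤ R := by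
  obtain ⟨R, hR⟩ := (Metric.isBounded_iff.1 (isCompact_frontier_of_isBounded hΩb).isBounded)
  refine ⟨R.toNNReal, (ae_mem_frontier Ω).mono fun x hx => (ae_mem_frontier Ω).mono fun y hy => ?_⟩
  rw [edist_dist]
  exact ENNReal.ofReal_le_ofReal (hR hx hy)

/-- The double layer potential of a constant is constant on the boundary. -/
theorem exists_ae_integral_doubleLayerKernel_eq (𝕜 : Type*) [RCLike 𝕜] {d : ℕ} (hd : 1 ≤ d)
    {Ω : Set (E (d + 1))} (hΩo : IsOpen Ω) (hΩb : Bornology.IsBounded Ω) {α : ℝ} (hα : 0 < α)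
    (hΩ : HasC1HolderBoundary α Ω) (a : ℝ) : ∃ c : 𝕜, ∀ᵐ x ∂(surfaceMeasure Ω),
      ∫ y, ((a * doubleLayerKernel Ω x y : ℝ) : 𝕜) ∂(surfaceMeasure Ω) = c := by
  have := isFiniteMeasure_surfaceMeasure hΩo hΩb hΩ
  obtain ⟨A, hA⟩ := exists_isWeaklySingular_doubleLayerKernel hΩo hΩb hα hΩ
  obtain ⟨C, hC⟩ := exists_upperRegular_surfaceMeasure hΩo hΩb hΩ
  obtain ⟨c, hc⟩ := exists_integral_doubleLayer_eq hΩo hΩb hα hΩ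
  refine ⟨((a * c : ℝ) : 𝕜), ?_⟩
  filter_upwards [hA.ae_integrable hC (by exact_mod_cast hd) hα (ae_mem_frontier Ω)
    (exists_ae_edist_le_surfaceMeasure hΩb) (f := fun _ => (1 : ℝ)) stronglyMeasurable_const
    (by simp [measure_lt_top]), ae_mem_frontier Ω] with x hi hx
  have h : doubleLayerKernel Ω x =ᵐ[surfaceMeasure Ω]
      fun y => inner ℝ (x - y) (outerNormal Ω y) / ‖x - y‖ ^ (d + 1) :=
    (ae_mem_frontier Ω).mono fun y hy => doubleLayerKernel_of_mem x hy
  simp only [mul_one] at hi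
  rw [integral_ofReal, integral_const_mul, integral_congr_ae h, hc x hx (hi.congr h)]

/-! ### Principal values -/

theorem tendsto_setIntegral_lt_norm_sub {V G : Type*} [NormedAddCommGroup V] [MeasurableSpace V]
    [BorelSpace V] [NormedAddCommGroup G] [NormedSpace ℝ G] {σ : Measure V} {h : V → G} {x : V}
    (hi : Integrable h σ) (hx : ∀ᵐ y ∂σ, edist x y ≠ 0) :
    Tendsto (fun δ : ℝ => ∫ y in {y | δ < ‖x - y‖}, h y ∂σ) (𝓝[>] 0) (𝓝 (∫ y, h y ∂σ)) := by
  have hm (δ : ℝ) : MeasurableSet {y | δ < ‖x - y‖} :=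
    (isOpen_lt continuous_const (by fun_prop)).measurableSet
  simp_rw [← integral_indicator (hm _)]
  refine tendsto_integral_filter_of_dominated_convergence (fun y => ‖h y‖)
    (Eventually.of_forall fun δ => hi.aestronglyMeasurable.indicator (hm δ))
    (Eventually.of_forall fun δ => Eventually.of_forall fun y => norm_indicator_le_norm_self _ _)
    hi.norm (hx.mono fun y hy => ?_)
  have hpos : 0 < ‖x - y‖ := by
    rw [← dist_eq_norm]
    exact dist_pos.2 fun h => hy (by rw [h, edist_self])
  refine tendsto_const_nhds.congr' ?_
  filter_upwards [mem_nhdsWithin_of_mem_nhds (Iio_mem_nhds hpos)] with δ hδ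
  rw [indicator_of_mem]
  exact hδ

/-! ### Sobolev norms -/

theorem eLpNorm_two_sq {X F : Type*} [MeasurableSpace X] [NormedAddCommGroup F] (μ : Measure X)
    (f : X → F) : eLpNorm f 2 μ ^ 2 = ∫⁻ x, ‖f x‖ₑ ^ 2 ∂μ := by
  have h := eLpNorm_nnreal_pow_eq_lintegral (μ := μ) (f := f) (p := 2) two_ne_zero
  simpa using h

theorem enorm_integral_mul_le {X 𝕜 : Type*} [MeasurableSpace X] [RCLike 𝕜] {μ : Measure X}
    {f g : X → 𝕜} (hf : AEStronglyMeasurable f μ) (hg : AEStronglyMeasurable g μ) :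
    ‖∫ x, f x * g x ∂μ‖ₑ ≤ eLpNorm f 2 μ * eLpNorm g 2 μ := by
  rw [← ENNReal.pow_le_pow_left_iff two_ne_zero, mul_pow, eLpNorm_two_sq, eLpNorm_two_sq]
  refine le_trans ?_ (ENNReal.lintegral_mul_sq_le μ hf.enorm hg.enorm)
  refine pow_le_pow_left' ((enorm_integral_le_lintegral_enorm _).trans_eq ?_) 2
  simp_rw [enorm_mul]

section Sobolev

variable {𝕜 : Type*} [RCLike 𝕜] {d : ℕ} {Ω : Set (E (d + 1))}

theorem slobodeckijNorm_sq (s : ℝ) (f : E (d + 1) → 𝕜) : slobodeckijNorm Ω s f ^ 2 =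
    eLpNorm f 2 (surfaceMeasure Ω) ^ 2 +
      ∫⁻ x, ∫⁻ y, ‖f x - f y‖ₑ ^ 2 / edist x y ^ (2 * s + d)
        ∂(surfaceMeasure Ω) ∂(surfaceMeasure Ω) := by
  rw [slobodeckijNorm, ← ENNReal.rpow_natCast, ← ENNReal.rpow_mul]
  norm_num

theorem eLpNorm_le_slobodeckijNorm (s : ℝ) (f : E (d + 1) → 𝕜) :
    eLpNorm f 2 (surfaceMeasure Ω) ≤ slobodeckijNorm Ω s f := by
  rw [← ENNReal.pow_le_pow_left_iff two_ne_zero, slobodeckijNorm_sq]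
  exact le_self_add

theorem slobodeckijNorm_congr_ae (s : ℝ) {f g : E (d + 1) → 𝕜}
    (h : f =ᵐ[surfaceMeasure Ω] g) : slobodeckijNorm Ω s f = slobodeckijNorm Ω s g := by
  rw [slobodeckijNorm, slobodeckijNorm, eLpNorm_congr_ae h]
  congr 2
  refine lintegral_congr_ae (h.mono fun x hx => lintegral_congr_ae (h.mono fun y hy => ?_))
  simp only [hx, hy]

theorem sobolevNorm_of_pos {s : ℝ} (hs : 0 < s) (f : E (d + 1) → 𝕜) :
    sobolevNorm Ω s f = slobodeckijNorm Ω s f := by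
  rw [sobolevNorm, if_pos hs]

theorem sobolevNorm_zero (f : E (d + 1) → 𝕜) :
    sobolevNorm Ω 0 f = eLpNorm f 2 (surfaceMeasure Ω) := by
  rw [sobolevNorm, if_neg (lt_irrefl 0), if_pos rfl]

theorem sobolevNorm_congr_ae (s : ℝ) {f g : E (d + 1) → 𝕜} (h : f =ᵐ[surfaceMeasure Ω] g) :
    sobolevNorm Ω s f = sobolevNorm Ω s g := by
  rw [sobolevNorm, sobolevNorm, slobodeckijNorm_congr_ae s h, eLpNorm_congr_ae h]
  have (φ : E (d + 1) → 𝕜) : ∫ x, f x * φ x ∂(surfaceMeasure Ω) =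
      ∫ x, g x * φ x ∂(surfaceMeasure Ω) :=
    integral_congr_ae (h.mono fun x hx => by simp only [hx])
  simp_rw [this]

theorem sobolevNorm_le_eLpNorm {s : ℝ} (hs : s ≤ 0) {f : E (d + 1) → 𝕜}
    (hf : AEStronglyMeasurable f (surfaceMeasure Ω)) :
    sobolevNorm Ω s f ≤ eLpNorm f 2 (surfaceMeasure Ω) := by
  rcases hs.eq_or_lt with rfl | hs
  · rw [sobolevNorm_zero]
  rw [sobolevNorm, if_neg hs.not_gt, if_neg hs.ne]
  refine iSup_le fun φ => iSup_le fun hφ => iSup_le fun h1 => ?_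
  refine (enorm_integral_mul_le hf hφ.1).trans ?_
  exact mul_le_of_le_one_right' ((eLpNorm_le_slobodeckijNorm (-s) φ).trans h1)

end Sobolev

/-! ### The Neumann–Poincaré operator -/

section NeumannPoincare

variable {𝕜 : Type*} [RCLike 𝕜] {d : ℕ} {Ω : Set (E (d + 1))}

/-- The kernel of the Neumann–Poincaré operator, with values in `𝕜` and vanishing for `y` off the
boundary. -/
noncomputable def npKernelOn (𝕜 : Type*) [RCLike 𝕜] {d : ℕ} (Ω : Set (E (d + 1)))
    (x y : E (d + 1)) : 𝕜 :=
  ((-(1 / sphereArea d) * doubleLayerKernel Ω x y : ℝ) : 𝕜)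

theorem npKernelOn_of_mem (x : E (d + 1)) {y : E (d + 1)} (hy : y ∈ frontier Ω) :
    npKernelOn 𝕜 Ω x y = (npKernel Ω x y : 𝕜) := by
  rw [npKernelOn, npKernel, doubleLayerKernel_of_mem x hy]

theorem exists_isWeaklySingular_npKernelOn (𝕜 : Type*) [RCLike 𝕜] (hΩo : IsOpen Ω)
    (hΩb : Bornology.IsBounded Ω) {α : ℝ} (hα : 0 < α) (hΩ : HasC1HolderBoundary α Ω) :
    ∃ A : ℝ≥0, IsWeaklySingular (frontier Ω) (npKernelOn 𝕜 Ω) d α A := by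
  obtain ⟨A, hA⟩ := exists_isWeaklySingular_doubleLayerKernel hΩo hΩb hα hΩ
  exact ⟨_, hA.ofReal_const_mul 𝕜 (-(1 / sphereArea d))⟩

/-- The kernel is absolutely integrable against `L²` functions, so the principal value is an
ordinary integral. -/
theorem ae_tendsto_npTruncated (hd : 1 ≤ d) (hΩo : IsOpen Ω) (hΩb : Bornology.IsBounded Ω) {α : ℝ}
    (hα : 0 < α) (hΩ : HasC1HolderBoundary α Ω) {f g : E (d + 1) → 𝕜}
    (hg : StronglyMeasurable g) (hg2 : ∫⁻ y, ‖g y‖ₑ ^ 2 ∂(surfaceMeasure Ω) < ∞)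
    (hfg : f =ᵐ[surfaceMeasure Ω] g) : ∀ᵐ x ∂(surfaceMeasure Ω),
      Tendsto (npTruncated Ω f x) (𝓝[>] 0)
        (𝓝 (∫ y, npKernelOn 𝕜 Ω x y * g y ∂(surfaceMeasure Ω))) := by
  have := isFiniteMeasure_surfaceMeasure hΩo hΩb hΩ
  obtain ⟨A, hA⟩ := exists_isWeaklySingular_npKernelOn 𝕜 hΩo hΩb hα hΩ
  obtain ⟨C, hC⟩ := exists_upperRegular_surfaceMeasure hΩo hΩb hΩ
  have hd0 : (0 : ℝ) < d := by exact_mod_cast hd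
  filter_upwards [hA.ae_integrable hC hd0 hα (ae_mem_frontier Ω)
    (exists_ae_edist_le_surfaceMeasure hΩb) hg hg2] with x hi
  refine (tendsto_setIntegral_lt_norm_sub hi (hC.ae_ne hd0 x)).congr fun δ => ?_
  refine integral_congr_ae (ae_restrict_of_ae ?_)
  filter_upwards [hfg, ae_mem_frontier Ω] with y hy hyS
  rw [hy, npKernelOn_of_mem x hyS]

theorem exists_eLpNorm_integral_npKernelOn_sq_le (𝕜 : Type*) [RCLike 𝕜] (hd : 1 ≤ d)
    (hΩo : IsOpen Ω) (hΩb : Bornology.IsBounded Ω) {α : ℝ} (hα : 0 < α)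
    (hΩ : HasC1HolderBoundary α Ω) : ∃ B : ℝ≥0, ∀ g : E (d + 1) → 𝕜, StronglyMeasurable g →
      eLpNorm (fun x => ∫ y, npKernelOn 𝕜 Ω x y * g y ∂(surfaceMeasure Ω)) 2
        (surfaceMeasure Ω) ^ 2 ≤ B * eLpNorm g 2 (surfaceMeasure Ω) ^ 2 := by
  have := isFiniteMeasure_surfaceMeasure hΩo hΩb hΩ
  obtain ⟨A, hA⟩ := exists_isWeaklySingular_npKernelOn 𝕜 hΩo hΩb hα hΩ
  obtain ⟨C, hC⟩ := exists_upperRegular_surfaceMeasure hΩo hΩb hΩ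
  obtain ⟨B, hB⟩ := hA.exists_lintegral_sq_le hC (by exact_mod_cast hd) hα (ae_mem_frontier Ω)
    (exists_ae_edist_le_surfaceMeasure hΩb)
  refine ⟨B, fun g hg => ?_⟩
  rw [eLpNorm_two_sq, eLpNorm_two_sq]
  refine le_trans ?_ (hB g hg)
  exact lintegral_mono fun x => pow_le_pow_left' (enorm_integral_le_lintegral_enorm _) 2

/-- Boundedness of the Neumann–Poincaré operator may be checked on the absolutely convergent
integrals of strongly measurable functions. -/
theorem npBounded_of_forall_le (hd : 1 ≤ d) (hΩo : IsOpen Ω) (hΩb : Bornology.IsBounded Ω) {α : ℝ}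
    (hα : 0 < α) (hΩ : HasC1HolderBoundary α Ω) {s t : ℝ} {K : ℝ≥0}
    (hK : ∀ g : E (d + 1) → 𝕜, StronglyMeasurable g → MemLp g 2 (surfaceMeasure Ω) →
      MemLp (fun x => ∫ y, npKernelOn 𝕜 Ω x y * g y ∂(surfaceMeasure Ω)) 2 (surfaceMeasure Ω) →
      sobolevNorm Ω t (fun x => ∫ y, npKernelOn 𝕜 Ω x y * g y ∂(surfaceMeasure Ω)) ≤
        K * sobolevNorm Ω s g) : NPBounded 𝕜 Ω s t := by
  have := isFiniteMeasure_surfaceMeasure hΩo hΩb hΩ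
  obtain ⟨A, hA⟩ := exists_isWeaklySingular_npKernelOn 𝕜 hΩo hΩb hα hΩ
  obtain ⟨B, hB⟩ := exists_eLpNorm_integral_npKernelOn_sq_le 𝕜 hd hΩo hΩb hα hΩ
  refine ⟨K, fun f hf => ?_⟩
  have hfg : f =ᵐ[surfaceMeasure Ω] hf.1.1.mk f := hf.1.1.ae_eq_mk
  have hg : StronglyMeasurable (hf.1.1.mk f) := hf.1.1.stronglyMeasurable_mk
  have hgL : MemLp (hf.1.1.mk f) 2 (surfaceMeasure Ω) := hf.1.ae_eq hfg
  rw [MemSobolev, sobolevNorm_congr_ae s hfg] at hf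
  rw [sobolevNorm_congr_ae s hfg]
  obtain ⟨-, hfin⟩ := hf
  generalize hf.1.1.mk f = g at *
  have hg2 : ∫⁻ y, ‖g y‖ₑ ^ 2 ∂(surfaceMeasure Ω) < ∞ := by
    rw [← eLpNorm_two_sq]
    exact ENNReal.pow_lt_top hgL.2
  have hlim := ae_tendsto_npTruncated hd hΩo hΩb hα hΩ hg hg2 hfg
  have hae : npOperator Ω f =ᵐ[surfaceMeasure Ω]
      fun x => ∫ y, npKernelOn 𝕜 Ω x y * g y ∂(surfaceMeasure Ω) :=
    hlim.mono fun x hx => hx.limUnder_eq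
  have hFm : StronglyMeasurable
      fun x => ∫ y, npKernelOn 𝕜 Ω x y * g y ∂(surfaceMeasure Ω) :=
    StronglyMeasurable.integral_prod_right'
      (f := fun q : E (d + 1) × E (d + 1) => npKernelOn 𝕜 Ω q.1 q.2 * g q.2)
      (hA.stronglyMeasurable.mul (hg.comp_measurable measurable_snd))
  have hFL : MemLp (fun x => ∫ y, npKernelOn 𝕜 Ω x y * g y ∂(surfaceMeasure Ω)) 2
      (surfaceMeasure Ω) := by
    refine ⟨hFm.aestronglyMeasurable, ?_⟩
    have h := (hB g hg).trans_lt (ENNReal.mul_lt_top ENNReal.coe_lt_top (ENNReal.pow_lt_top hgL.2))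
    exact (ENNReal.pow_lt_top_iff.1 h).resolve_right two_ne_zero
  have hle := hK g hg hgL hFL
  rw [MemSobolev, sobolevNorm_congr_ae t hae]
  exact ⟨hlim.mono fun x hx => ⟨_, hx⟩, ⟨hFL.ae_eq hae.symm,
    hle.trans_lt (ENNReal.mul_lt_top ENNReal.coe_lt_top hfin)⟩, hle⟩

end NeumannPoincare


theorem theoremA1 {𝕜 : Type*} [RCLike 𝕜] (d : ℕ) (hd : 1 ≤ d) (Ω : Set (E (d + 1)))
    (hΩo : IsOpen Ω) (hΩc : IsConnected Ω) (hΩb : Bornology.IsBounded Ω)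
    (α : ℝ) (hα0 : 0 < α) (hα1 : α < 1) (hΩ : HasC1HolderBoundary α Ω) :
    (∀ s : ℝ, 0 < s → s < (1 - α) / 2 → NPBounded 𝕜 Ω s (s + α)) ∧
    (∀ ε : ℝ, 0 < ε → ε < 1 + α → NPBounded 𝕜 Ω 0 (α - ε)) := by
  have := isFiniteMeasure_surfaceMeasure hΩo hΩb hΩ
  obtain ⟨A, hA⟩ := exists_isWeaklySingular_npKernelOn 𝕜 hΩo hΩb hα0 hΩ
  obtain ⟨C, hC⟩ := exists_upperRegular_surfaceMeasure hΩo hΩb hΩ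
  have hd0 : (0 : ℝ) < d := by exact_mod_cast hd
  have hS := ae_mem_frontier Ω
  have hR := exists_ae_edist_le_surfaceMeasure hΩb
  obtain ⟨B, hL2⟩ := exists_eLpNorm_integral_npKernelOn_sq_le 𝕜 hd hΩo hΩb hα0 hΩ
  have hfin {g : E (d + 1) → 𝕜} (hg : MemLp g 2 (surfaceMeasure Ω)) :
      ∫⁻ y, ‖g y‖ₑ ^ 2 ∂(surfaceMeasure Ω) < ∞ := by
    rw [← eLpNorm_two_sq]
    exact ENNReal.pow_lt_top hg.2
  have hsqrt {a b : ℝ≥0∞} {M : ℝ≥0} (h : a ^ 2 ≤ M * b ^ 2) : a ≤ (NNReal.sqrt M : ℝ≥0) * b := by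
    rw [← ENNReal.pow_le_pow_left_iff two_ne_zero, mul_pow, ← ENNReal.coe_pow, NNReal.sq_sqrt]
    exact h
  refine ⟨fun s hs0 hs1 => ?_, fun ε hε0 hε1 => ?_⟩
  · obtain ⟨c, hc⟩ := exists_ae_integral_doubleLayerKernel_eq 𝕜 hd hΩo hΩb hα0 hΩ
      (-(1 / sphereArea d))
    obtain ⟨M, hM⟩ := hA.exists_gagliardo_le_gagliardo hC hd0 hα0 hS hR hs0
      (by linarith : s + α < 1) hc
    refine npBounded_of_forall_le hd hΩo hΩb hα0 hΩ (K := NNReal.sqrt (max B M))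
      fun g hg hgL _ => hsqrt ?_
    rw [sobolevNorm_of_pos hs0, sobolevNorm_of_pos (by linarith), slobodeckijNorm_sq,
      slobodeckijNorm_sq, mul_add ((max B M : ℝ≥0) : ℝ≥0∞)]
    refine add_le_add ((hL2 g hg).trans ?_) ((hM g hg (hfin hgL)).trans ?_)
    · gcongr
      exact le_max_left _ _
    · gcongr
      exact le_max_right _ _
  · rcases le_or_gt (α - ε) 0 with ht | ht
    · refine npBounded_of_forall_le hd hΩo hΩb hα0 hΩ (K := NNReal.sqrt B)
        fun g hg _ hF => (sobolevNorm_le_eLpNorm ht hF.1).trans ?_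
      rw [sobolevNorm_zero]
      exact hsqrt (hL2 g hg)
    · obtain ⟨M, hM⟩ := hA.exists_gagliardo_le_lintegral hC hd0 hα0 hS hR ht
        (by linarith : α - ε < 1) (by linarith)
      refine npBounded_of_forall_le hd hΩo hΩb hα0 hΩ (K := NNReal.sqrt (B + M))
        fun g hg hgL _ => hsqrt ?_
      rw [sobolevNorm_zero, sobolevNorm_of_pos ht, slobodeckijNorm_sq, ENNReal.coe_add, add_mul]
      refine add_le_add (hL2 g hg) ((hM g hg (hfin hgL)).trans_eq ?_)
      rw [eLpNorm_two_sq]
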